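/- Let $G$ be a compact Lie group with Lie algebra $\mathfrak g$. Let $\mathrm{Hom}(U(1),G)$ be the set of continuous homomorphisms $U(1)\to G$ with the compact-open topology, and let $\mathrm{Hom}(U(1),G)/G$ be its quotient by conjugation in $G$, with the quotient topology. 1. The space $\mathrm{Hom}(U(1),G)/G$ is discrete. 2. Its points are the equivalence classes of Yang–Mills connections on $S^2$, so Yang–Mills connections on $S^2$ are isolated. Precisely, let $h$ be any smooth Riemannian metric on $S^2$, let $\omega$ be its area form (for the standard orientation) and $a$ its total area. Consider all smooth connections $A$ on all smooth principal $G$-bundles over $S^2$ that satisfy the Yang–Mills equation $d_A{*}F(A)=0$; two of them are equivalent if there is an isomorphism of the bundles, over the identity of $S^2$, that carries one connection to the other. There is a bijection from the set of equivalence classes onto $\mathrm{Hom}(U(1),G)/G$ under which the class of $A$ corresponds to the class of $\rho$ if and only if $F(A)=\Lambda\otimes\frac{1}{a}\omega$ up to the adjoint action of $G$, where $\Lambda=\frac{d}{dt}\big|_{t=0}\rho(e^{2\pi i t})\in\mathfrak g$; that is, at every point and in every local trivialization $a\,{*}F(A)$ lies in the adjoint orbit of $\Lambda$. 3. These classes correspond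 to the conjugacy classes of closed geodesics through the identity of $G$. Precisely, for every bi-invariant Riemannian metric on $G$, the curves $t\mapsto\rho(e^{it})$ with $\rho\in\mathrm{Hom}(U(1),G)$ are exactly the $2\pi$-periodic geodesics $\gamma:\mathbb R\to G$ with $\gamma(0)=1$ (constant and multiply covered ones included), and this induces a bijection from $\mathrm{Hom}(U(1),G)/G$ onto the set of conjugacy classes of such geodesics. -/

import Mathlib

open scoped Manifold ContDiff

noncomputable section

/-! ### Homomorphisms from the circle group up to conjugation -/

section Homomorphisms

variable (G : Type*) [Group G] [TopologicalSpace G]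

/-- Conjugacy of continuous homomorphisms `U(1) → G`. The type `Circle →ₜ* G` carries the
compact-open topology. -/
def homConj : Setoid (Circle →ₜ* G) where
  r ρ₁ ρ₂ := ∃ g : G, ∀ z, ρ₁ z = g * ρ₂ z * g⁻¹
  iseqv :=
    { refl := fun ρ => ⟨1, fun z => by simp⟩
      symm := by
        rintro ρ₁ ρ₂ ⟨g, hg⟩
        exact ⟨g⁻¹, fun z => by rw [hg z]; group⟩
      trans := by
        rintro ρ₁ ρ₂ ρ₃ ⟨g, hg⟩ ⟨h, hh⟩
        exact ⟨g * h, fun z => by rw [hg z, hh z]; group⟩ }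

/-- The space `Hom(U(1), G) / G`, with the quotient of the compact-open topology. -/
abbrev HomModConj : Type _ := Quotient (homConj G)

end Homomorphisms

/-! ### Closed geodesics of a Lie group -/

section Geodesics

variable {n : ℕ} {G : Type*} [Group G] [TopologicalSpace G]
  [ChartedSpace (EuclideanSpace ℝ (Fin n)) G] [LieGroup (𝓡 n) ∞ G]

/-- Smooth Riemannian metrics on `G`. -/
abbrev LieRiemannianMetric (n : ℕ) (G : Type*) [Group G] [TopologicalSpace G]
    [ChartedSpace (EuclideanSpace ℝ (Fin n)) G] [LieGroup (𝓡 n) ∞ G] : Type _ :=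
  Bundle.ContMDiffRiemannianMetric (𝓡 n) ∞ (EuclideanSpace ℝ (Fin n))
    (fun x : G => TangentSpace (𝓡 n) x)

/-- Invariance of a Riemannian metric under all left and right translations. -/
def IsBiinvariant (k : LieRiemannianMetric n G) : Prop :=
  (∀ (a x : G) (u v : TangentSpace (𝓡 n) x),
    k.inner (a * x) (mfderiv (𝓡 n) (𝓡 n) (fun y => a * y) x u)
      (mfderiv (𝓡 n) (𝓡 n) (fun y => a * y) x v) = k.inner x u v) ∧
  (∀ (a x : G) (u v : TangentSpace (𝓡 n) x),
    k.inner (x * a) (mfderiv (𝓡 n) (𝓡 n) (fun y => y * a) x u)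
      (mfderiv (𝓡 n) (𝓡 n) (fun y => y * a) x v) = k.inner x u v)

/-- The coefficients of the metric in the chart centred at `p`: the inner product of the
coordinate vectors `u` and `v` at the point with coordinates `y`. -/
def coordMetric (k : LieRiemannianMetric n G) (p : G) (y u v : EuclideanSpace ℝ (Fin n)) : ℝ :=
  k.inner ((extChartAt (𝓡 n) p).symm y)
    (mfderiv 𝓘(ℝ, EuclideanSpace ℝ (Fin n)) (𝓡 n) (extChartAt (𝓡 n) p).symm y u)
    (mfderiv 𝓘(ℝ, EuclideanSpace ℝ (Fin n)) (𝓡 n) (extChartAt (𝓡 n) p).symm y v)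

/-- `γ` is a geodesic: it is smooth and near every time `t₀` its coordinate expression `c`
satisfies the geodesic equation, written with lowered index:
`d/dt (k_{ij}(c) ċⁱ vʲ) = ½ (∂_v k_{ij})(c) ċⁱ ċʲ` for every coordinate vector `v`. -/
def IsGeodesic (k : LieRiemannianMetric n G) (γ : ℝ → G) : Prop :=
  ContMDiff 𝓘(ℝ, ℝ) (𝓡 n) ∞ γ ∧
  ∀ (t₀ : ℝ) (v : EuclideanSpace ℝ (Fin n)),
    let c : ℝ → EuclideanSpace ℝ (Fin n) := fun t => extChartAt (𝓡 n) (γ t₀) (γ t)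
    deriv (fun t => coordMetric k (γ t₀) (c t) (deriv c t) v) t₀ =
      (1 / 2) * fderiv ℝ (fun y => coordMetric k (γ t₀) y (deriv c t₀) (deriv c t₀)) (c t₀) v

/-- Closed geodesics through the identity, parametrized over `ℝ / 2πℤ` and based at the
identity. Constant and multiply covered ones are included. -/
structure ClosedGeodesic (k : LieRiemannianMetric n G) where
  toFun : ℝ → G
  isGeodesic : IsGeodesic k toFun
  periodic : Function.Periodic toFun (2 * Real.pi)
  map_zero : toFun 0 = 1

/-- Conjugacy of closed geodesics through the identity. -/
def geodesicConj (k : LieRiemannianMetric n G) : Setoid (ClosedGeodesic k) where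
  r γ₁ γ₂ := ∃ g : G, ∀ t, γ₁.toFun t = g * γ₂.toFun t * g⁻¹
  iseqv :=
    { refl := fun γ => ⟨1, fun t => by simp⟩
      symm := by
        rintro γ₁ γ₂ ⟨g, hg⟩
        exact ⟨g⁻¹, fun t => by rw [hg t]; group⟩
      trans := by
        rintro γ₁ γ₂ γ₃ ⟨g, hg⟩ ⟨h, hh⟩
        exact ⟨g * h, fun t => by rw [hg t, hh t]; group⟩ }

end Geodesics

/-! ### The two-sphere -/

section Sphere

/-- The two-sphere, as a submanifold of Euclidean space. -/
abbrev S2 : Type := Metric.sphere (0 : EuclideanSpace ℝ (Fin 3)) 1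

instance finrank_three : Fact (Module.finrank ℝ (EuclideanSpace ℝ (Fin 3)) = 2 + 1) :=
  ⟨by simp⟩

/-- Smooth Riemannian metrics on the two-sphere. -/
abbrev SphereMetric : Type :=
  Bundle.ContMDiffRiemannianMetric (𝓡 2) ∞ (EuclideanSpace ℝ (Fin 2))
    (fun x : S2 => TangentSpace (𝓡 2) x)

/-- The tangent vector `u` to the sphere at `x`, seen in the ambient space. -/
def ambient (x : S2) (u : TangentSpace (𝓡 2) x) : EuclideanSpace ℝ (Fin 3) :=
  mfderiv (𝓡 2) 𝓘(ℝ, EuclideanSpace ℝ (Fin 3)) (fun y : S2 => (y : EuclideanSpace ℝ (Fin 3))) x u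

/-- The area form of the round metric: `det (x, u, v)`. -/
def roundArea (x : S2) (u v : TangentSpace (𝓡 2) x) : ℝ :=
  (Matrix.of ![(x : EuclideanSpace ℝ (Fin 3)).ofLp, (ambient x u).ofLp, (ambient x v).ofLp]).det

/-- A basis of the tangent space at `x`. -/
def tangentBasis (x : S2) (i : Fin 2) : TangentSpace (𝓡 2) x :=
  (EuclideanSpace.single i (1 : ℝ) : EuclideanSpace ℝ (Fin 2))

/-- The ratio of the area element of `h` to that of the round metric, computed as the area of
the parallelogram spanned by a basis. -/
def areaDensity (h : SphereMetric) (x : S2) : ℝ :=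
  Real.sqrt (h.inner x (tangentBasis x 0) (tangentBasis x 0) *
      h.inner x (tangentBasis x 1) (tangentBasis x 1) -
      h.inner x (tangentBasis x 0) (tangentBasis x 1) ^ 2) /
    |roundArea x (tangentBasis x 0) (tangentBasis x 1)|

/-- The area form `ω` of `h`, for the orientation of the sphere by the outward normal. -/
def areaForm (h : SphereMetric) (x : S2) (u v : TangentSpace (𝓡 2) x) : ℝ :=
  areaDensity h x * roundArea x u v

/-- The total area of the sphere for `h`. -/
def totalArea (h : SphereMetric) : ℝ :=
  ∫ x, areaDensity h x
    ∂((MeasureTheory.volume : MeasureTheory.Measure (EuclideanSpace ℝ (Fin 3))).toSphere)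

end Sphere

/-! ### Connections on principal bundles over the two-sphere -/

section YangMills

variable {n : ℕ} {G : Type*} [Group G] [TopologicalSpace G]
  [ChartedSpace (EuclideanSpace ℝ (Fin n)) G]

/-- An element of the Lie algebra, the tangent space at `1`, in the coordinates of the chart
centred at `1`; in Mathlib this is the identity map. -/
def lieCoord (ξ : GroupLieAlgebra (𝓡 n) G) : EuclideanSpace ℝ (Fin n) := ξ

/-- The inverse of `lieCoord`, applied to a vector in the coordinates of the chart centred at the
identity. -/
def ofLieCoord (n : ℕ) (G : Type*) [Group G] [TopologicalSpace G]
    [ChartedSpace (EuclideanSpace ℝ (Fin n)) G] (w : EuclideanSpace ℝ (Fin n)) :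
    GroupLieAlgebra (𝓡 n) G := w

/-- The adjoint action of `G` on its Lie algebra, the derivative at `1` of conjugation. -/
def adjointAction (n : ℕ) {G : Type*} [Group G] [TopologicalSpace G]
    [ChartedSpace (EuclideanSpace ℝ (Fin n)) G] (g : G) (ξ : GroupLieAlgebra (𝓡 n) G) :
    GroupLieAlgebra (𝓡 n) G :=
  ofLieCoord n G (mfderiv (𝓡 n) (𝓡 n) (fun x : G => g * x * g⁻¹) 1 ξ)

/-- The Lie-algebra-valued one-form `g⁻¹ dg` of a function `g` from the sphere to `G`. -/
def logDerivative (n : ℕ) {G : Type*} [Group G] [TopologicalSpace G]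
    [ChartedSpace (EuclideanSpace ℝ (Fin n)) G] (g : S2 → G) (x : S2)
    (u : TangentSpace (𝓡 2) x) : GroupLieAlgebra (𝓡 n) G :=
  ofLieCoord n G (mfderiv (𝓡 2) (𝓡 n) (fun y => (g x)⁻¹ * g y) x u)

/-- Lie-algebra-valued one-forms on the sphere. -/
abbrev LieOneForm (n : ℕ) (G : Type*) [Group G] [TopologicalSpace G]
    [ChartedSpace (EuclideanSpace ℝ (Fin n)) G] : Type _ :=
  ∀ x : S2, TangentSpace (𝓡 2) x →L[ℝ] GroupLieAlgebra (𝓡 n) G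

/-- Smoothness of a one-form on the open set `U`: smoothness of the induced fibrewise linear
function on the tangent bundle over `U`. -/
def LieOneForm.SmoothOn (A : LieOneForm n G) (U : Set S2) : Prop :=
  ContMDiffOn (𝓡 2).tangent 𝓘(ℝ, EuclideanSpace ℝ (Fin n)) ∞
    (fun v : TangentBundle (𝓡 2) S2 => lieCoord (A v.proj v.snd))
    (Bundle.TotalSpace.proj ⁻¹' U)

/-- A one-form in the coordinates of the chart centred at `p`. -/
def LieOneForm.coord (A : LieOneForm n G) (p : S2) (y : EuclideanSpace ℝ (Fin 2)) :
    EuclideanSpace ℝ (Fin 2) →L[ℝ] EuclideanSpace ℝ (Fin n) :=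
  (A ((extChartAt (𝓡 2) p).symm y)).comp
    (mfderiv 𝓘(ℝ, EuclideanSpace ℝ (Fin 2)) (𝓡 2) (extChartAt (𝓡 2) p).symm y)

/-- The exterior derivative `dA (u, v)` at `x`, computed in the chart centred at `x`. -/
def LieOneForm.extDerivative (A : LieOneForm n G) (x : S2) (u v : TangentSpace (𝓡 2) x) :
    GroupLieAlgebra (𝓡 n) G :=
  let φ := extChartAt (𝓡 2) x
  let u' : EuclideanSpace ℝ (Fin 2) := mfderiv (𝓡 2) 𝓘(ℝ, EuclideanSpace ℝ (Fin 2)) φ x u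
  let v' : EuclideanSpace ℝ (Fin 2) := mfderiv (𝓡 2) 𝓘(ℝ, EuclideanSpace ℝ (Fin 2)) φ x v
  ofLieCoord n G (fderiv ℝ (A.coord x) (φ x) u' v' - fderiv ℝ (A.coord x) (φ x) v' u')

/-- The curvature `F(A) = dA + ½ [A ∧ A]`, that is `F(u, v) = dA(u, v) + [A(u), A(v)]`. -/
def LieOneForm.curvature (A : LieOneForm n G) (x : S2) (u v : TangentSpace (𝓡 2) x) :
    GroupLieAlgebra (𝓡 n) G :=
  A.extDerivative x u v + ⁅A x u, A x v⁆

/-- The Hodge dual `*F(A)` of the curvature: the function `ξ` with `F(A) = ξ ω`, where `ω` is the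
area form of `h`. -/
def LieOneForm.starCurvature (A : LieOneForm n G) (h : SphereMetric) (x : S2) :
    GroupLieAlgebra (𝓡 n) G :=
  (areaForm h x (tangentBasis x 0) (tangentBasis x 1))⁻¹ •
    A.curvature x (tangentBasis x 0) (tangentBasis x 1)

/-- The covariant derivative `d_A ξ = dξ + [A, ξ]` of a Lie-algebra-valued function. -/
def LieOneForm.covDerivative (A : LieOneForm n G) (ξ : S2 → GroupLieAlgebra (𝓡 n) G)
    (x : S2) (u : TangentSpace (𝓡 2) x) : GroupLieAlgebra (𝓡 n) G :=
  ofLieCoord n G (mfderiv (𝓡 2) 𝓘(ℝ, EuclideanSpace ℝ (Fin n)) (fun y => lieCoord (ξ y)) x u) +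
    ⁅A x u, ξ x⁆

/-- A smooth principal `G`-bundle over the sphere with a connection, described through local
sections `s i` over the members `U i` of an open cover: transition functions `g i j` with
`s j = s i * g i j`, and the pullbacks `A i` of the connection form along `s i`. -/
structure BundleConnection (n : ℕ) (G : Type*) [Group G] [TopologicalSpace G]
    [ChartedSpace (EuclideanSpace ℝ (Fin n)) G] where
  ι : Type
  U : ι → Set S2
  isOpen : ∀ i, IsOpen (U i)
  cover : ∀ x, ∃ i, x ∈ U i
  g : ι → ι → S2 → G
  smooth_g : ∀ i j, ContMDiffOn (𝓡 2) (𝓡 n) ∞ (g i j) (U i ∩ U j)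
  cocycle : ∀ i j k, ∀ x ∈ U i ∩ U j ∩ U k, g i j x * g j k x = g i k x
  A : ι → LieOneForm n G
  smooth_A : ∀ i, (A i).SmoothOn (U i)
  compat : ∀ i j, ∀ x ∈ U i ∩ U j, ∀ u : TangentSpace (𝓡 2) x,
    A j x u = adjointAction n (g i j x)⁻¹ (A i x u) + logDerivative n (g i j) x u

/-- Equivalence of connections: there is an isomorphism of the principal bundles, covering the
identity of the sphere, that carries one connection to the other. Identifying the bundles along
it, `h i k` is the transition function from the section `s i` of the first bundle to the section
`s' k` of the second: `s' k = s i * h i k`. -/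
def GaugeEquivalent (P Q : BundleConnection n G) : Prop :=
  ∃ h : P.ι → Q.ι → S2 → G,
    (∀ i k, ContMDiffOn (𝓡 2) (𝓡 n) ∞ (h i k) (P.U i ∩ Q.U k)) ∧
    (∀ i j k, ∀ x ∈ P.U i ∩ P.U j ∩ Q.U k, P.g i j x * h j k x = h i k x) ∧
    (∀ i k l, ∀ x ∈ P.U i ∩ Q.U k ∩ Q.U l, h i k x * Q.g k l x = h i l x) ∧
    (∀ i k, ∀ x ∈ P.U i ∩ Q.U k, ∀ u : TangentSpace (𝓡 2) x,
      Q.A k x u = adjointAction n (h i k x)⁻¹ (P.A i x u) + logDerivative n (h i k) x u)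

/-- The Yang-Mills equation `d_A * F(A) = 0` for the Riemannian metric `h` on the sphere. -/
def IsYangMills (h : SphereMetric) (P : BundleConnection n G) : Prop :=
  ∀ i, ∀ x ∈ P.U i, ∀ u : TangentSpace (𝓡 2) x,
    (P.A i).covDerivative ((P.A i).starCurvature h) x u = 0

/-- The infinitesimal generator of the one-parameter group `t ↦ ρ (exp (2 π i t))`. -/
def generator (n : ℕ) {G : Type*} [Group G] [TopologicalSpace G]
    [ChartedSpace (EuclideanSpace ℝ (Fin n)) G] (ρ : Circle →ₜ* G) :
    GroupLieAlgebra (𝓡 n) G :=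
  ofLieCoord n G
    (mfderiv 𝓘(ℝ, ℝ) (𝓡 n) (fun t : ℝ => ρ (Circle.exp (2 * Real.pi * t))) 0 (1 : ℝ))

/-- `F(P) = Λ ⊗ ω / totalArea` up to the adjoint action, where `ω / totalArea` is the area form
normalized to total area `1` and `Λ` is the generator of `ρ`. -/
def HasCurvatureGenerator (h : SphereMetric) (P : BundleConnection n G) (ρ : Circle →ₜ* G) :
    Prop :=
  ∀ i, ∀ x ∈ P.U i, ∃ g : G,
    totalArea h • (P.A i).starCurvature h x = adjointAction n g (generator n ρ)

end YangMills

end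

noncomputable section
set_option linter.unusedSectionVars false

/-! ### Logarithmic derivatives and the adjoint action in the chart at the identity -/

section LieCalculus

open Set Filter Topology

/-! A continuous homomorphism U(1) → G is a one-parameter group t ↦ exp(tv) with exp(v) = 1, because
continuous one-parameter groups are smooth (`exists_eq_expCurve`, `exists_circleHom`). Conjugation
acts on v through Ad (`homMk_eq_iff`). So Hom(U(1), G)/G is the set of adjoint orbits of vectors v
with exp(v) = 1, and all three statements are about these orbits. Brackets, the Maurer-Cartan
equation and the exponential are developed in the chart centred at 1.

Discreteness. If ρ' is near ρ, the loop exp(-tv) exp(tw) formed from the two generators stays near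
1. A loop in a chart has mean velocity zero, which forces w to be near v
(`eventually_norm_sub_le_of_closed`). Averaging over the circle shows that every vector is a sum of
one in the image and one in the kernel of ad v. By the open mapping form of the inverse function
theorem, w = Ad(k)(v + z) with k near 1 and [v, z] = 0 (`eventually_exists_Ad_add`). Now exp(tz) is
a closed one-parameter group that stays near 1, so z = 0 and ρ' is conjugate to ρ.

Yang-Mills connections. The equation says that ξ = *F(A) is parallel. On each of two stereographic
discs the area form has a primitive θ, and A - θξ is flat because d_A ξ = 0 (`yangMillsFlat`). In a
flat trivialization ξ becomes a constant M and the connection becomes θM (`exists_isAdapted`). On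
the overlapping annulus the transition function satisfies T⁻¹dT = (θ₊ - θ₋)M. The form θ₊ - θ₋
depends only on the angle and has period equal to the total area a. Since T is single valued,
exp(aM) = 1 (`expCurve_totalArea`), and v = aM represents the class of the connection.

If two connections have the same orbit, both can be normalized to the same M and to T(1) = 1. Then
both transition functions solve the same equation, hence coincide, and the trivializations patch to
an isomorphism (`gaugeEquivalent_of_hasCurvatureGenerator`). Conversely, for exp(v) = 1 the function
T = exp(sector area · v/a) is well defined and clutches the forms θ±v/a to a Yang-Mills connection
(`exists_isYangMills`).

Geodesics. Bi-invariance makes ad skew, and with the Maurer-Cartan equation the geodesic equation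
becomes the constancy of γ⁻¹γ' (`geodesic_equation_iff`). Geodesics through 1 are therefore the
one-parameter groups, and the 2π-periodic ones are the homomorphisms from U(1). -/

/-- Euclidean space of dimension `n`, the model space of all Lie groups and Lie algebras below. -/
abbrev Eu (n : ℕ) : Type := EuclideanSpace ℝ (Fin n)

/-- Smoothness at a point of a map from a normed space to a Lie group. -/
abbrev SmoothAt (n : ℕ) {E G : Type*} [NormedAddCommGroup E] [NormedSpace ℝ E]
    [TopologicalSpace G] [ChartedSpace (EuclideanSpace ℝ (Fin n)) G] (f : E → G) (x : E) : Prop :=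
  ContMDiffAt 𝓘(ℝ, E) (𝓡 n) ∞ f x

variable {n : ℕ} {G : Type*} [Group G] [TopologicalSpace G]
  [ChartedSpace (EuclideanSpace ℝ (Fin n)) G]
  {E F : Type*} [NormedAddCommGroup E] [NormedSpace ℝ E] [NormedAddCommGroup F] [NormedSpace ℝ F]

/-- The chart of a Lie group centred at the identity. -/
def lieChart (n : ℕ) {G : Type*} [Group G] [TopologicalSpace G]
    [ChartedSpace (EuclideanSpace ℝ (Fin n)) G] (g : G) : Eu n := extChartAt (𝓡 n) (1 : G) g

/-- The inverse of the chart of a Lie group centred at the identity. -/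
def lieParam (n : ℕ) (G : Type*) [Group G] [TopologicalSpace G]
    [ChartedSpace (EuclideanSpace ℝ (Fin n)) G] (y : Eu n) : G :=
  (extChartAt (𝓡 n) (1 : G)).symm y

/-- The coordinates of the identity. -/
def lieOrigin (n : ℕ) (G : Type*) [Group G] [TopologicalSpace G]
    [ChartedSpace (EuclideanSpace ℝ (Fin n)) G] : Eu n := lieChart n (1 : G)

/-- The domain of the chart centred at the identity. -/
def lieSource (n : ℕ) (G : Type*) [Group G] [TopologicalSpace G]
    [ChartedSpace (EuclideanSpace ℝ (Fin n)) G] : Set G := (extChartAt (𝓡 n) (1 : G)).source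

/-- The image of the chart centred at the identity. -/
def lieTarget (n : ℕ) (G : Type*) [Group G] [TopologicalSpace G]
    [ChartedSpace (EuclideanSpace ℝ (Fin n)) G] : Set (Eu n) :=
  (extChartAt (𝓡 n) (1 : G)).target

lemma isOpen_lieSource : IsOpen (lieSource n G) := isOpen_extChartAt_source _

lemma isOpen_lieTarget : IsOpen (lieTarget n G) := isOpen_extChartAt_target _

lemma one_mem_lieSource : (1 : G) ∈ lieSource n G := mem_extChartAt_source _

lemma lieOrigin_mem : lieOrigin n G ∈ lieTarget n G := mem_extChartAt_target _

lemma lieParam_mem {y : Eu n} (hy : y ∈ lieTarget n G) : lieParam n G y ∈ lieSource n G :=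
  (extChartAt (𝓡 n) (1 : G)).map_target hy

lemma lieChart_mem {g : G} (hg : g ∈ lieSource n G) : lieChart n g ∈ lieTarget n G :=
  (extChartAt (𝓡 n) (1 : G)).map_source hg

lemma lieParam_lieChart {g : G} (hg : g ∈ lieSource n G) : lieParam n G (lieChart n g) = g :=
  (extChartAt (𝓡 n) (1 : G)).left_inv hg

lemma lieChart_lieParam {y : Eu n} (hy : y ∈ lieTarget n G) : lieChart n (lieParam n G y) = y :=
  (extChartAt (𝓡 n) (1 : G)).right_inv hy

@[simp] lemma lieParam_lieOrigin : lieParam n G (lieOrigin n G) = 1 :=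
  lieParam_lieChart one_mem_lieSource

variable [LieGroup (𝓡 n) ∞ G]

lemma SmoothAt.lieChart_comp {f : E → G} {x : E} (hf : SmoothAt n f x) (hx : f x ∈ lieSource n G) :
    ContDiffAt ℝ ∞ (fun y => lieChart n (f y)) x := by
  rw [← contMDiffAt_iff_contDiffAt]
  refine ContMDiffAt.comp x (g := lieChart n) (I' := 𝓡 n) ?_ hf
  exact contMDiffAt_extChartAt' (by simpa [lieSource] using hx)

lemma smoothAt_lieParam_comp {c : E → Eu n} {x : E} (hc : ContDiffAt ℝ ∞ c x)
    (hx : c x ∈ lieTarget n G) : SmoothAt n (fun y => lieParam n G (c y)) x := by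
  refine ContMDiffAt.comp x (g := lieParam n G) (I' := 𝓘(ℝ, Eu n)) ?_ hc.contMDiffAt
  exact (contMDiffOn_extChartAt_symm (1 : G)).contMDiffAt (isOpen_lieTarget.mem_nhds hx)

lemma smoothAt_lieParam {y : Eu n} (hy : y ∈ lieTarget n G) : SmoothAt n (lieParam n G) y :=
  smoothAt_lieParam_comp contDiffAt_id hy

lemma SmoothAt.mul {f g : E → G} {x : E} (hf : SmoothAt n f x) (hg : SmoothAt n g x) :
    SmoothAt n (fun y => f y * g y) x := ContMDiffAt.mul hf hg

lemma SmoothAt.inv {f : E → G} {x : E} (hf : SmoothAt n f x) :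
    SmoothAt n (fun y => (f y)⁻¹) x := ContMDiffAt.inv hf

lemma SmoothAt.comp {f : F → G} {u : E → F} {x : E} (hf : SmoothAt n f (u x))
    (hu : ContDiffAt ℝ ∞ u x) : SmoothAt n (fun y => f (u y)) x :=
  ContMDiffAt.comp x (g := f) hf hu.contMDiffAt

lemma smoothAt_const {g : G} {x : E} : SmoothAt n (fun _ : E => g) x := contMDiffAt_const

/-- The logarithmic derivative `f⁻¹ df` of a map from a normed space to a Lie group. -/
def logDer (n : ℕ) {G : Type*} [Group G] [TopologicalSpace G]
    [ChartedSpace (EuclideanSpace ℝ (Fin n)) G] (f : E → G) (x : E) : E →L[ℝ] Eu n :=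
  fderiv ℝ (fun y => lieChart n ((f x)⁻¹ * f y)) x

/-- The adjoint action in coordinates. -/
def Ad (n : ℕ) {G : Type*} [Group G] [TopologicalSpace G]
    [ChartedSpace (EuclideanSpace ℝ (Fin n)) G] (g : G) : Eu n →L[ℝ] Eu n :=
  fderiv ℝ (fun y => lieChart n (g * lieParam n G y * g⁻¹)) (lieOrigin n G)

/-- The base point of `logDer` moves with x, so differentiating it again requires joint smoothness
in the base point and the argument. -/
lemma SmoothAt.quotient {f : E → G} {x : E} (hf : SmoothAt n f x) :
    ContDiffAt ℝ ∞ (Function.uncurry fun x y => lieChart n ((f x)⁻¹ * f y)) (x, x) := by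
  refine SmoothAt.lieChart_comp (f := fun p : E × E => (f p.1)⁻¹ * f p.2) ?_ ?_
  · exact ((SmoothAt.comp (u := Prod.fst) hf contDiffAt_fst).inv).mul
      (SmoothAt.comp (u := Prod.snd) hf contDiffAt_snd)
  · simpa using one_mem_lieSource

lemma SmoothAt.logDer {f : E → G} {x : E} (hf : SmoothAt n f x) :
    ContDiffAt ℝ ∞ (logDer n f) x :=
  ContDiffAt.fderiv (f := fun x y => lieChart n ((f x)⁻¹ * f y)) (g := fun x => x)
    hf.quotient contDiffAt_id (by simp)

lemma SmoothAt.differentiableAt_quotient {f : E → G} {x : E} (hf : SmoothAt n f x) :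
    DifferentiableAt ℝ (fun y => lieChart n ((f x)⁻¹ * f y)) x := by
  refine (SmoothAt.lieChart_comp (f := fun y : E => (f x)⁻¹ * f y) ?_ ?_).differentiableAt (by simp)
  · exact smoothAt_const.mul hf
  · simpa using one_mem_lieSource

lemma SmoothAt.hasFDerivAt {f : E → G} {x : E} (hf : SmoothAt n f x) :
    HasFDerivAt (fun y => lieChart n ((f x)⁻¹ * f y)) (_root_.logDer n f x) x :=
  hf.differentiableAt_quotient.hasFDerivAt

lemma SmoothAt.ad {f : E → G} {x : E} (hf : SmoothAt n f x) :
    ContDiffAt ℝ ∞ (fun y => Ad n (f y)) x := by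
  refine ContDiffAt.fderiv (f := fun x y => lieChart n (f x * lieParam n G y * (f x)⁻¹))
    (g := fun _ => lieOrigin n G) (m := ∞) (n := ∞) ?_ contDiffAt_const (by simp)
  refine SmoothAt.lieChart_comp (f := fun p : E × Eu n => f p.1 * lieParam n G p.2 * (f p.1)⁻¹) ?_ ?_
  · have h := SmoothAt.comp (u := Prod.fst) (x := (x, lieOrigin n G)) hf contDiffAt_fst
    exact (h.mul (smoothAt_lieParam_comp contDiffAt_snd lieOrigin_mem)).mul h.inv
  · simpa using one_mem_lieSource

lemma logDer_congr {f g : E → G} {x : E} (h : f =ᶠ[𝓝 x] g) : logDer n f x = logDer n g x := by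
  unfold logDer
  apply Filter.EventuallyEq.fderiv_eq
  filter_upwards [h] with y hy
  rw [hy, h.self_of_nhds]

lemma logDer_const_mul (g : G) (f : E → G) : logDer n (fun y => g * f y) = logDer n f := by
  funext x
  unfold logDer
  congr 1
  funext y
  congr 1
  group

lemma logDer_const (g : G) : logDer n (fun _ : E => g) = 0 := by
  funext x
  simp [logDer]

lemma logDer_comp {f : F → G} {u : E → F} {x : E} (hf : SmoothAt n f (u x))
    (hu : DifferentiableAt ℝ u x) :
    logDer n (fun y => f (u y)) x = (logDer n f (u x)).comp (fderiv ℝ u x) := by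
  have := hf.differentiableAt_quotient
  exact fderiv_comp (g := fun y => lieChart n ((f (u x))⁻¹ * f y)) x this hu

/-- The coordinate expression of the multiplication has derivative `(u, v) ↦ u + v`. -/
lemma hasFDerivAt_lieChart_mul {a b : E → G} {x : E} (ha : SmoothAt n a x) (hb : SmoothAt n b x)
    (ha1 : a x = 1) (hb1 : b x = 1) :
    HasFDerivAt (fun y => lieChart n (a y * b y))
      (fderiv ℝ (fun y => lieChart n (a y)) x + fderiv ℝ (fun y => lieChart n (b y)) x) x := by
  set e := lieOrigin n G
  have hM : ContDiffAt ℝ ∞ (fun p : Eu n × Eu n => lieChart n (lieParam n G p.1 * lieParam n G p.2))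
      (e, e) := by
    refine SmoothAt.lieChart_comp ?_ (by simpa [e] using one_mem_lieSource)
    exact (smoothAt_lieParam_comp contDiffAt_fst lieOrigin_mem).mul
      (smoothAt_lieParam_comp contDiffAt_snd lieOrigin_mem)
  have hM' := (hM.differentiableAt (by simp)).hasFDerivAt
  set M' := fderiv ℝ (fun p : Eu n × Eu n => lieChart n (lieParam n G p.1 * lieParam n G p.2)) (e, e)
  -- On each axis through (1, 1) the multiplication is the identity; this determines both partial
  -- derivatives.
  have h1 : ∀ v, M' (v, 0) = v := by
    have h := HasFDerivAt.comp (g := fun p : Eu n × Eu n =>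
      lieChart n (lieParam n G p.1 * lieParam n G p.2)) (f := fun y => (id y, e)) e hM'
      ((hasFDerivAt_id (𝕜 := ℝ) e).prodMk (hasFDerivAt_const e e))
    have h' : HasFDerivAt (fun y : Eu n => y) _ e :=
      h.congr_of_eventuallyEq (by
        filter_upwards [isOpen_lieTarget.mem_nhds lieOrigin_mem] with y hy
        simp [e, lieChart_lieParam hy])
    intro v
    have := h'.unique (hasFDerivAt_id e)
    simpa using congrArg (fun L => L v) this
  have h2 : ∀ v, M' (0, v) = v := by
    have h := HasFDerivAt.comp (g := fun p : Eu n × Eu n =>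
      lieChart n (lieParam n G p.1 * lieParam n G p.2)) (f := fun y => (e, id y)) e hM'
      ((hasFDerivAt_const e e).prodMk (hasFDerivAt_id (𝕜 := ℝ) e))
    have h' : HasFDerivAt (fun y : Eu n => y) _ e :=
      h.congr_of_eventuallyEq (by
        filter_upwards [isOpen_lieTarget.mem_nhds lieOrigin_mem] with y hy
        simp [e, lieChart_lieParam hy])
    intro v
    have := h'.unique (hasFDerivAt_id e)
    simpa using congrArg (fun L => L v) this
  have da := ((ha.lieChart_comp (ha1 ▸ one_mem_lieSource)).differentiableAt (by simp)).hasFDerivAt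
  have db := ((hb.lieChart_comp (hb1 ▸ one_mem_lieSource)).differentiableAt (by simp)).hasFDerivAt
  have hpt : (lieChart n (a x), lieChart n (b x)) = (e, e) := by rw [ha1, hb1]; rfl
  have h := HasFDerivAt.comp x (hpt ▸ hM') (da.prodMk db)
  have h' := h.congr_of_eventuallyEq (f₁ := fun y => lieChart n (a y * b y)) (by
    filter_upwards [ha.continuousAt.preimage_mem_nhds
        (isOpen_lieSource (n := n).mem_nhds (ha1 ▸ one_mem_lieSource)),
      hb.continuousAt.preimage_mem_nhds
        (isOpen_lieSource (n := n).mem_nhds (hb1 ▸ one_mem_lieSource))] with y hy hy'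
    simp only [Function.comp]
    rw [lieParam_lieChart hy, lieParam_lieChart hy'])
  refine h'.congr_fderiv ?_
  ext1 v
  have : ∀ p : Eu n × Eu n, M' p = p.1 + p.2 := by
    rintro ⟨p, q⟩
    have : (p, q) = (p, 0) + (0, q) := by simp
    calc M' (p, q) = M' ((p, 0) + (0, q)) := by rw [← this]
      _ = p + q := by rw [map_add, h1, h2]
  simp [this]

lemma Ad_one : Ad n (1 : G) = ContinuousLinearMap.id ℝ (Eu n) := by
  unfold Ad
  have : (fun y => lieChart n ((1 : G) * lieParam n G y * 1⁻¹)) =ᶠ[𝓝 (lieOrigin n G)] id := by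
    filter_upwards [isOpen_lieTarget.mem_nhds lieOrigin_mem] with y hy
    simp [lieChart_lieParam hy]
  rw [this.fderiv_eq, fderiv_id]

/-- Conjugation acts on curves through the identity by the adjoint action. -/
lemma hasFDerivAt_conj {a : E → G} {x : E} (g : G) (ha : SmoothAt n a x) (ha1 : a x = 1) :
    HasFDerivAt (fun y => lieChart n (g * a y * g⁻¹))
      ((Ad n g).comp (fderiv ℝ (fun y => lieChart n (a y)) x)) x := by
  have da := ((ha.lieChart_comp (ha1 ▸ one_mem_lieSource)).differentiableAt (by simp)).hasFDerivAt
  have hg : ContDiffAt ℝ ∞ (fun y : Eu n => lieChart n (g * lieParam n G y * g⁻¹)) (lieOrigin n G) := by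
    refine SmoothAt.lieChart_comp ?_ (by simpa using one_mem_lieSource)
    exact (smoothAt_const.mul (smoothAt_lieParam lieOrigin_mem)).mul smoothAt_const
  have hg' := (hg.differentiableAt (by simp)).hasFDerivAt
  have hpt : lieChart n (a x) = lieOrigin n G := by rw [ha1]; rfl
  rw [← hpt] at hg'
  have h := HasFDerivAt.comp x hg' da
  rw [hpt] at h
  refine h.congr_of_eventuallyEq ?_
  filter_upwards [ha.continuousAt.preimage_mem_nhds
        (isOpen_lieSource (n := n).mem_nhds (ha1 ▸ one_mem_lieSource))] with y hy
  simp only [Function.comp]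
  rw [lieParam_lieChart hy]

lemma Ad_mul (g h : G) : Ad n (g * h) = (Ad n g).comp (Ad n h) := by
  have h1 := hasFDerivAt_conj (n := n) (a := fun y : Eu n => h * lieParam n G y * h⁻¹)
    (x := lieOrigin n G) g
    ((smoothAt_const.mul (smoothAt_lieParam lieOrigin_mem)).mul smoothAt_const) (by simp)
  refine Eq.trans ?_ h1.fderiv
  unfold Ad
  congr 1
  funext y
  congr 1
  group

lemma Ad_mul_apply (g h : G) (v : Eu n) : Ad n (g * h) v = Ad n g (Ad n h v) := by
  rw [Ad_mul]; rfl

@[simp] lemma Ad_one_apply (v : Eu n) : Ad n (1 : G) v = v := by rw [Ad_one]; rfl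

@[simp] lemma Ad_inv_Ad (g : G) (v : Eu n) : Ad n g⁻¹ (Ad n g v) = v := by
  rw [← Ad_mul_apply]; simp

@[simp] lemma Ad_Ad_inv (g : G) (v : Eu n) : Ad n g (Ad n g⁻¹ v) = v := by
  rw [← Ad_mul_apply]; simp

/-- With both factors normalized to pass through 1, the quotient (fg)(x)⁻¹(fg)(y) is the conjugate
by g(x)⁻¹ of f(x)⁻¹f(y), times g(x)⁻¹g(y). The first factor contributes Ad, and derivatives at 1
add. -/
lemma logDer_mul {f g : E → G} {x : E} (hf : SmoothAt n f x) (hg : SmoothAt n g x) :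
    logDer n (fun y => f y * g y) x = (Ad n (g x)⁻¹).comp (logDer n f x) + logDer n g x := by
  have hf' : SmoothAt n (fun y => (f x)⁻¹ * f y) x := smoothAt_const.mul hf
  have h1 := hasFDerivAt_conj (n := n) (g x)⁻¹ hf' (by simp)
  have h2 := hasFDerivAt_lieChart_mul (n := n) (a := fun y => (g x)⁻¹ * ((f x)⁻¹ * f y) * (g x)⁻¹⁻¹)
    (b := fun y => (g x)⁻¹ * g y) ((smoothAt_const.mul hf').mul smoothAt_const)
    (smoothAt_const.mul hg) (by simp) (by simp)
  rw [h1.fderiv] at h2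
  unfold logDer
  rw [← h2.fderiv]
  congr 1
  funext y
  congr 1
  group

lemma logDer_inv {f : E → G} {x : E} (hf : SmoothAt n f x) :
    logDer n (fun y => (f y)⁻¹) x = -(Ad n (f x)).comp (logDer n f x) := by
  have h := logDer_mul hf hf.inv
  have h0 : logDer n (fun y => f y * (f y)⁻¹) x = 0 := by
    simp only [mul_inv_cancel]; rw [logDer_const]; rfl
  rw [h0, inv_inv] at h
  exact (neg_eq_of_add_eq_zero_right h.symm).symm

lemma logDer_lieParam_lieOrigin :
    logDer n (lieParam n G) (lieOrigin n G) = ContinuousLinearMap.id ℝ (Eu n) := by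
  have : (fun y => lieChart n ((lieParam n G (lieOrigin n G))⁻¹ * lieParam n G y))
      =ᶠ[𝓝 (lieOrigin n G)] id := by
    filter_upwards [isOpen_lieTarget.mem_nhds lieOrigin_mem] with y hy
    simp [lieChart_lieParam hy]
  rw [logDer, this.fderiv_eq, fderiv_id]

/-- The logarithmic derivative in terms of the coordinates of the map. -/
lemma logDer_eq_lieParam {f : E → G} {x : E} (hf : SmoothAt n f x) (hx : f x ∈ lieSource n G) :
    logDer n f x = (logDer n (lieParam n G) (lieChart n (f x))).comp
      (fderiv ℝ (fun y => lieChart n (f y)) x) := by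
  have h := logDer_comp (n := n) (f := lieParam n G) (u := fun y => lieChart n (f y)) (x := x)
    (smoothAt_lieParam (lieChart_mem hx)) ((hf.lieChart_comp hx).differentiableAt (by simp))
  rw [← h]
  apply logDer_congr
  filter_upwards [hf.continuousAt.preimage_mem_nhds (isOpen_lieSource.mem_nhds hx)] with y hy
  rw [lieParam_lieChart hy]

end LieCalculus

/-! ### The Lie bracket in terms of the left invariant frame and its dual form -/

section LieBracketCoordinates

open Set Filter Topology

variable {n : ℕ} {G : Type*} [Group G] [TopologicalSpace G]
  [ChartedSpace (EuclideanSpace ℝ (Fin n)) G]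
  {E : Type*} [NormedAddCommGroup E] [NormedSpace ℝ E] [LieGroup (𝓡 n) ∞ G]

/-- The derivative at the identity, in the chart centred there. -/
lemma mfderiv_one_eq_fderiv {m : ℕ} {f : G → Eu m}
    (hf : MDifferentiableAt (𝓡 n) 𝓘(ℝ, Eu m) f 1) (v : Eu n) :
    (mfderiv (𝓡 n) 𝓘(ℝ, Eu m) f 1 v : Eu m) =
      fderiv ℝ (fun y => f (lieParam n G y)) (lieOrigin n G) v := by
  refine (congrArg (fun L : Eu n →L[ℝ] Eu m => L v) hf.mfderiv).trans ?_
  simp only [writtenInExtChartAt, modelWithCornersSelf_coe, Set.range_id, fderivWithin_univ,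
    mfld_simps]
  rfl

lemma mfderiv_eq_fderiv_extChartAt {f : E → G} {x : E}
    (hf : MDifferentiableAt 𝓘(ℝ, E) (𝓡 n) f x) (v : E) :
    (mfderiv 𝓘(ℝ, E) (𝓡 n) f x v : Eu n) =
      fderiv ℝ (fun y => (extChartAt (𝓡 n) (f x) (f y) : Eu n)) x v := by
  refine (congrArg (fun L : E →L[ℝ] Eu n => L v) hf.mfderiv).trans ?_
  simp only [writtenInExtChartAt, modelWithCornersSelf_coe, Set.range_id, fderivWithin_univ,
    mfld_simps]
  rfl

lemma mfderiv_eq_fderiv_lieChart {f : E → G} {x : E}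
    (hf : MDifferentiableAt 𝓘(ℝ, E) (𝓡 n) f x) (h1 : f x = 1) (v : E) :
    (mfderiv 𝓘(ℝ, E) (𝓡 n) f x v : Eu n) = fderiv ℝ (fun y => lieChart n (f y)) x v := by
  rw [mfderiv_eq_fderiv_extChartAt hf, h1]
  rfl

/-- The logarithmic derivative, expressed by the derivative of maps between manifolds. -/
lemma logDer_eq_mfderiv {f : E → G} {x : E} (hf : SmoothAt n f x) (v : E) :
    logDer n f x v = (mfderiv 𝓘(ℝ, E) (𝓡 n) (fun y => (f x)⁻¹ * f y) x v : Eu n) := by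
  have h : SmoothAt n (fun y => (f x)⁻¹ * f y) x := smoothAt_const.mul hf
  rw [mfderiv_eq_fderiv_lieChart (h.mdifferentiableAt (by simp)) (by simp)]
  rfl

/-- The coordinate expression of left invariant vector fields. -/
def leftField (n : ℕ) (G : Type*) [Group G] [TopologicalSpace G]
    [ChartedSpace (EuclideanSpace ℝ (Fin n)) G] (y : Eu n) : Eu n →L[ℝ] Eu n :=
  fderiv ℝ (fun z => lieChart n (lieParam n G y * lieParam n G z)) (lieOrigin n G)

lemma contDiffAt_lieChart_mul_lieParam {y : Eu n} (hy : y ∈ lieTarget n G) :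
    ContDiffAt ℝ ∞ (Function.uncurry fun y z => lieChart n (lieParam n G y * lieParam n G z))
      (y, lieOrigin n G) := by
  refine SmoothAt.lieChart_comp
    (f := fun p : Eu n × Eu n => lieParam n G p.1 * lieParam n G p.2) ?_ ?_
  · exact (smoothAt_lieParam_comp contDiffAt_fst hy).mul
      (smoothAt_lieParam_comp contDiffAt_snd lieOrigin_mem)
  · simpa using lieParam_mem hy

lemma contDiffAt_leftField {y : Eu n} (hy : y ∈ lieTarget n G) :
    ContDiffAt ℝ ∞ (leftField n G) y :=
  ContDiffAt.fderiv (f := fun y z => lieChart n (lieParam n G y * lieParam n G z))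
    (g := fun _ => lieOrigin n G) (contDiffAt_lieChart_mul_lieParam hy) contDiffAt_const (by simp)

lemma contDiffAt_logDer_lieParam {y : Eu n} (hy : y ∈ lieTarget n G) :
    ContDiffAt ℝ ∞ (logDer n (lieParam n G)) y := (smoothAt_lieParam hy).logDer

/-- Left translation does not change a logarithmic derivative, so z ↦ y · z has the identity as
logarithmic derivative at the origin. Computing the same derivative through the chart shows that the
Maurer-Cartan form inverts the left invariant frame. -/
lemma logDer_leftField {y : Eu n} (hy : y ∈ lieTarget n G) (v : Eu n) :
    logDer n (lieParam n G) y (leftField n G y v) = v := by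
  have h1 : SmoothAt n (fun z => lieParam n G y * lieParam n G z) (lieOrigin n G) :=
    smoothAt_const.mul (smoothAt_lieParam lieOrigin_mem)
  have h2 := logDer_eq_lieParam (n := n) h1 (by simpa using lieParam_mem hy)
  rw [logDer_const_mul, logDer_lieParam_lieOrigin] at h2
  have := congrArg (fun L : Eu n →L[ℝ] Eu n => L v) h2
  simp only [lieParam_lieOrigin, mul_one, lieChart_lieParam hy] at this
  exact this.symm

/-- In finite dimension the one-sided inverse of `logDer_leftField` is two-sided. -/
lemma leftField_logDer {y : Eu n} (hy : y ∈ lieTarget n G) (v : Eu n) :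
    leftField n G y (logDer n (lieParam n G) y v) = v := by
  have h : (logDer n (lieParam n G) y : Eu n →ₗ[ℝ] Eu n) ∘ₗ (leftField n G y : Eu n →ₗ[ℝ] Eu n) =
      LinearMap.id := by
    ext1 v; exact logDer_leftField hy v
  have h' := (LinearMap.comp_eq_id_comm _ _).1 h
  exact congrArg (fun L : Eu n →ₗ[ℝ] Eu n => L v) h'

lemma leftField_lieOrigin (v : Eu n) : leftField n G (lieOrigin n G) v = v := by
  have := logDer_leftField (G := G) lieOrigin_mem v
  rwa [logDer_lieParam_lieOrigin] at this

/-- The Lie bracket in coordinates. -/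
def lieBr (n : ℕ) (G : Type*) [Group G] [TopologicalSpace G]
    [ChartedSpace (EuclideanSpace ℝ (Fin n)) G] (v w : Eu n) : Eu n :=
  lieCoord ⁅ofLieCoord n G v, ofLieCoord n G w⁆

lemma mfderiv_extChartAt_self_apply (v : Eu n) :
    (mfderiv (𝓡 n) 𝓘(ℝ, Eu n) (extChartAt (𝓡 n) (1 : G)) 1 v : Eu n) = v := by
  have h := mfderiv_one_eq_fderiv (n := n) (f := lieChart n (G := G))
    (mdifferentiableAt_extChartAt (mem_chart_source _ _)) v
  refine h.trans ?_
  have : (fun y => lieChart n (lieParam n G y)) =ᶠ[𝓝 (lieOrigin n G)] id := by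
    filter_upwards [isOpen_lieTarget.mem_nhds lieOrigin_mem] with y hy
    exact lieChart_lieParam hy
  rw [this.fderiv_eq, fderiv_id]; rfl

/-- This is the bridge to the bracket on `GroupLieAlgebra`, which is defined through invariant
vector fields on the manifold. -/
lemma mpullbackWithin_mulInvariantVectorField {y : Eu n} (hy : y ∈ lieTarget n G) (v : Eu n) :
    (VectorField.mpullbackWithin 𝓘(ℝ, Eu n) (𝓡 n) (extChartAt (𝓡 n) (1 : G)).symm
      (mulInvariantVectorField (ofLieCoord n G v)) (range (𝓡 n)) y : Eu n) =
      leftField n G y v := by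
  have h1 := mfderiv_extChartAt_comp_mfderivWithin_extChartAt_symm (I := 𝓡 n) (x := (1 : G)) hy
  have h2 := mfderivWithin_extChartAt_symm_comp_mfderiv_extChartAt (I := 𝓡 n) (x := (1 : G)) hy
  rw [VectorField.mpullbackWithin_apply, ContinuousLinearMap.inverse_eq h2 h1]
  have hs : SmoothAt n (lieParam n G) y := smoothAt_lieParam hy
  have hm : MDifferentiableAt (𝓡 n) (𝓡 n) (fun b : G => lieParam n G y * b) 1 :=
    (contMDiff_mul_left (I := 𝓡 n) (n := ∞)).contMDiffAt.mdifferentiableAt (by simp)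
  have hc : MDifferentiableAt (𝓡 n) 𝓘(ℝ, Eu n) (extChartAt (𝓡 n) (1 : G)) (lieParam n G y * 1) := by
    rw [mul_one]
    exact mdifferentiableAt_extChartAt (by simpa [lieSource] using lieParam_mem (G := G) hy)
  have h3 := mfderiv_comp (1 : G) hc hm
  have h4 := mfderiv_one_eq_fderiv (n := n) (hc.comp (1 : G) hm) v
  rw [h3] at h4
  refine Eq.trans ?_ h4
  simp only [mulInvariantVectorField]
  congr 2
  exact (mul_one _).symm

/-- The bracket in terms of left invariant vector fields in coordinates. -/
lemma lieBr_eq_leftField (v w : Eu n) :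
    lieBr n G v w = fderiv ℝ (leftField n G) (lieOrigin n G) v w -
      fderiv ℝ (leftField n G) (lieOrigin n G) w v := by
  let D : Eu n →L[ℝ] Eu n := mfderiv (𝓡 n) 𝓘(ℝ, Eu n) (extChartAt (𝓡 n) (1 : G)) 1
  let W : Eu n → Eu n → Eu n := fun v =>
    VectorField.mpullbackWithin 𝓘(ℝ, Eu n) (𝓡 n) (extChartAt (𝓡 n) (1 : G)).symm
      (mulInvariantVectorField (ofLieCoord n G v)) (range (𝓡 n))
  -- The bracket of invariant fields at 1 unfolds definitionally to a bracket of pulled back fields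
  -- in the chart; `D`, the derivative of that chart, turns out to be the identity.
  have h0 : lieBr n G v w = D.inverse (VectorField.lieBracketWithin ℝ (W v) (W w)
        ((extChartAt (𝓡 n) (1 : G)).symm ⁻¹' univ ∩ range (𝓡 n)) (lieOrigin n G)) := rfl
  have h1 : D = ContinuousLinearMap.id ℝ (Eu n) := by
    refine ContinuousLinearMap.ext fun v => ?_
    exact mfderiv_extChartAt_self_apply v
  rw [h0, h1]
  have h2 : ((extChartAt (𝓡 n) (1 : G)).symm ⁻¹' univ ∩ range (𝓡 n)) = univ := by simp
  rw [h2, VectorField.lieBracketWithin_univ]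
  have h3 : ∀ v : Eu n, W v =ᶠ[𝓝 (lieOrigin n G)] fun y => leftField n G y v := by
    intro v
    filter_upwards [isOpen_lieTarget.mem_nhds lieOrigin_mem] with y hy
    exact mpullbackWithin_mulInvariantVectorField hy v
  have h4 := Filter.EventuallyEq.lieBracket_vectorField_eq (𝕜 := ℝ) (h3 v) (h3 w)
  have hd : DifferentiableAt ℝ (leftField n G) (lieOrigin n G) :=
    (contDiffAt_leftField lieOrigin_mem).differentiableAt (by simp)
  have h5 : ∀ v, fderiv ℝ (fun y => leftField n G y v) (lieOrigin n G) =
      (fderiv ℝ (leftField n G) (lieOrigin n G)).flip v := by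
    intro v
    rw [fderiv_clm_apply hd (differentiableAt_const v)]
    simp
  have h6 : VectorField.lieBracket ℝ (fun y => leftField n G y v) (fun y => leftField n G y w)
      (lieOrigin n G) = fderiv ℝ (leftField n G) (lieOrigin n G) v w -
        fderiv ℝ (leftField n G) (lieOrigin n G) w v := by
    rw [VectorField.lieBracket, h5, h5]
    simp only [leftField_lieOrigin, ContinuousLinearMap.flip_apply]
  rw [show (ContinuousLinearMap.id ℝ (Eu n)).inverse = ContinuousLinearMap.id ℝ (Eu n) from
    ContinuousLinearMap.inverse_id]
  exact h4.trans h6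

/-- The bracket in terms of the Maurer-Cartan form in coordinates. -/
lemma lieBr_eq_logDer (v w : Eu n) :
    lieBr n G v w = fderiv ℝ (logDer n (lieParam n G)) (lieOrigin n G) w v -
      fderiv ℝ (logDer n (lieParam n G)) (lieOrigin n G) v w := by
  have hd : DifferentiableAt ℝ (leftField n G) (lieOrigin n G) :=
    (contDiffAt_leftField lieOrigin_mem).differentiableAt (by simp)
  have hd' : DifferentiableAt ℝ (logDer n (lieParam n G)) (lieOrigin n G) :=
    (contDiffAt_logDer_lieParam lieOrigin_mem).differentiableAt (by simp)
  -- Differentiate the identity form(y) ∘ frame(y) = id at the origin, where both factors are the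
  -- identity.
  have key : ∀ v w, fderiv ℝ (leftField n G) (lieOrigin n G) v w =
      -fderiv ℝ (logDer n (lieParam n G)) (lieOrigin n G) v w := by
    intro v w
    have h1 : (fun y => logDer n (lieParam n G) y (leftField n G y w))
        =ᶠ[𝓝 (lieOrigin n G)] fun _ => w := by
      filter_upwards [isOpen_lieTarget.mem_nhds lieOrigin_mem] with y hy
      exact logDer_leftField hy w
    have h2 := h1.fderiv_eq (𝕜 := ℝ)
    rw [fderiv_clm_apply hd' (hd.clm_apply (differentiableAt_const w)),
      fderiv_clm_apply hd (differentiableAt_const w)] at h2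
    have h3 := congrArg (fun L : Eu n →L[ℝ] Eu n => L v) h2
    simp [leftField_lieOrigin, logDer_lieParam_lieOrigin] at h3
    exact eq_neg_of_add_eq_zero_left h3
  rw [lieBr_eq_leftField, key, key]
  abel

end LieBracketCoordinates

/-! ### The Maurer-Cartan equation and uniqueness of primitives -/

section MaurerCartan

open Set Filter Topology

variable {n : ℕ} {G : Type*} [Group G] [TopologicalSpace G]
  [ChartedSpace (EuclideanSpace ℝ (Fin n)) G]
  {E : Type*} [NormedAddCommGroup E] [NormedSpace ℝ E] [LieGroup (𝓡 n) ∞ G]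

/-- The bracket as a continuous bilinear map. -/
def lieBrL (n : ℕ) (G : Type*) [Group G] [TopologicalSpace G]
    [ChartedSpace (EuclideanSpace ℝ (Fin n)) G] : Eu n →L[ℝ] Eu n →L[ℝ] Eu n :=
  (fderiv ℝ (logDer n (lieParam n G)) (lieOrigin n G)).flip -
    fderiv ℝ (logDer n (lieParam n G)) (lieOrigin n G)

lemma lieBr_eq_lieBrL (v w : Eu n) : lieBr n G v w = lieBrL n G v w := by
  rw [lieBr_eq_logDer]; rfl

@[simp] lemma lieBr_add_left (u v w : Eu n) :
    lieBr n G (u + v) w = lieBr n G u w + lieBr n G v w := by simp [lieBr_eq_lieBrL]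

@[simp] lemma lieBr_add_right (u v w : Eu n) :
    lieBr n G u (v + w) = lieBr n G u v + lieBr n G u w := by simp [lieBr_eq_lieBrL]

@[simp] lemma lieBr_sub_left (u v w : Eu n) :
    lieBr n G (u - v) w = lieBr n G u w - lieBr n G v w := by simp [lieBr_eq_lieBrL]

@[simp] lemma lieBr_sub_right (u v w : Eu n) :
    lieBr n G u (v - w) = lieBr n G u v - lieBr n G u w := by simp [lieBr_eq_lieBrL]

@[simp] lemma lieBr_neg_left (u v : Eu n) : lieBr n G (-u) v = -lieBr n G u v := by
  simp [lieBr_eq_lieBrL]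

@[simp] lemma lieBr_neg_right (u v : Eu n) : lieBr n G u (-v) = -lieBr n G u v := by
  simp [lieBr_eq_lieBrL]

@[simp] lemma lieBr_smul_left (c : ℝ) (u v : Eu n) :
    lieBr n G (c • u) v = c • lieBr n G u v := by simp [lieBr_eq_lieBrL]

@[simp] lemma lieBr_smul_right (c : ℝ) (u v : Eu n) :
    lieBr n G u (c • v) = c • lieBr n G u v := by simp [lieBr_eq_lieBrL]

lemma lieBr_skew (v w : Eu n) : lieBr n G v w = -lieBr n G w v := by
  rw [lieBr_eq_logDer, lieBr_eq_logDer]; abel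

@[simp] lemma lieBr_self (v : Eu n) : lieBr n G v v = 0 := by
  rw [lieBr_eq_logDer]; abel

/-- The Maurer-Cartan equation. -/
theorem maurerCartan {f : E → G} {x : E} (hf : ∀ᶠ y in 𝓝 x, SmoothAt n f y) (u v : E) :
    fderiv ℝ (logDer n f) x u v - fderiv ℝ (logDer n f) x v u =
      -lieBr n G (logDer n f x u) (logDer n f x v) := by
  -- Left translation by f(x)⁻¹ brings the map into the chart at 1 without changing its logarithmic
  -- derivative.
  have hf0 : ∀ᶠ y in 𝓝 x, SmoothAt n (fun y => (f x)⁻¹ * f y) y :=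
    hf.mono fun y hy => smoothAt_const.mul hy
  set c : E → Eu n := fun y => lieChart n ((f x)⁻¹ * f y) with hc
  have hcx : c x = lieOrigin n G := by simp [c, lieOrigin]
  have hcs : ContDiffAt ℝ ∞ c x :=
    hf0.self_of_nhds.lieChart_comp (by simpa using one_mem_lieSource)
  have h1 : logDer n f =ᶠ[𝓝 x]
      fun y => (logDer n (lieParam n G) (c y)).comp (fderiv ℝ c y) := by
    have hs : ∀ᶠ y in 𝓝 x, (f x)⁻¹ * f y ∈ lieSource n G :=
      hf0.self_of_nhds.continuousAt.preimage_mem_nhds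
        (isOpen_lieSource.mem_nhds (by simpa using one_mem_lieSource))
    filter_upwards [hf0, hs] with y hy hys
    rw [← logDer_const_mul (f x)⁻¹ f]
    exact logDer_eq_lieParam hy hys
  have hΘ : DifferentiableAt ℝ (logDer n (lieParam n G)) (c x) :=
    (contDiffAt_logDer_lieParam (hcx ▸ lieOrigin_mem)).differentiableAt (by simp)
  have hcd : DifferentiableAt ℝ c x := hcs.differentiableAt (by simp)
  have hcd2 : DifferentiableAt ℝ (fderiv ℝ c) x :=
    (hcs.fderiv_right (m := 1) (by norm_cast)).differentiableAt (by simp)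
  have h2 : ∀ u v, fderiv ℝ (logDer n f) x u v =
      fderiv ℝ (logDer n (lieParam n G)) (lieOrigin n G) (logDer n f x u) (logDer n f x v) +
        fderiv ℝ (fderiv ℝ c) x u v := by
    intro u v
    have hcomp : DifferentiableAt ℝ (fun y => logDer n (lieParam n G) (c y)) x := hΘ.comp x hcd
    have hcompd : fderiv ℝ (fun y => logDer n (lieParam n G) (c y)) x =
        (fderiv ℝ (logDer n (lieParam n G)) (c x)).comp (fderiv ℝ c x) := fderiv_comp x hΘ hcd
    rw [h1.fderiv_eq, fderiv_clm_comp hcomp hcd2, hcompd, hcx, logDer_lieParam_lieOrigin]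
    simp only [add_apply, ContinuousLinearMap.comp_apply,
      ContinuousLinearMap.compL_apply, ContinuousLinearMap.flip_apply, ContinuousLinearMap.id_apply]
    rw [add_comm]; rfl
  -- Second derivatives of the coordinate map are symmetric, so only the derivative of the form at
  -- the origin survives antisymmetrization, and that is the bracket.
  have hsymm : fderiv ℝ (fderiv ℝ c) x u v = fderiv ℝ (fderiv ℝ c) x v u :=
    hcs.isSymmSndFDerivAt (by
    simpa using WithTop.coe_le_coe.2 (le_top : (2 : ℕ∞) ≤ ⊤)) u v
  rw [h2, h2, hsymm, lieBr_eq_logDer]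
  abel

/-- The differential of the adjoint representation is the bracket. -/
lemma fderiv_Ad_lieParam (v w : Eu n) :
    fderiv ℝ (fun y => Ad n (lieParam n G y)) (lieOrigin n G) v w = lieBr n G v w := by
  set e := lieOrigin n G
  -- Apply the Maurer-Cartan equation to (y, z) ↦ y z⁻¹ in the directions (w, 0) and (0, v). One
  -- mixed derivative vanishes and the other is the derivative of Ad.
  set f : Eu n × Eu n → G := fun p => lieParam n G p.1 * (lieParam n G p.2)⁻¹ with hf
  have hopen : ∀ᶠ p in 𝓝 (e, e), p.1 ∈ lieTarget n G ∧ p.2 ∈ lieTarget n G :=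
    (isOpen_lieTarget.prod isOpen_lieTarget).mem_nhds ⟨lieOrigin_mem, lieOrigin_mem⟩
  have hfs : ∀ᶠ p in 𝓝 (e, e), SmoothAt n f p := by
    filter_upwards [hopen] with p hp
    exact (smoothAt_lieParam_comp contDiffAt_fst hp.1).mul
      (smoothAt_lieParam_comp contDiffAt_snd hp.2).inv
  have hlog : logDer n f =ᶠ[𝓝 (e, e)] fun p =>
      ((Ad n (lieParam n G p.2)).comp (logDer n (lieParam n G) p.1)).comp
        (ContinuousLinearMap.fst ℝ (Eu n) (Eu n)) -
      ((Ad n (lieParam n G p.2)).comp (logDer n (lieParam n G) p.2)).comp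
        (ContinuousLinearMap.snd ℝ (Eu n) (Eu n)) := by
    filter_upwards [hopen] with p hp
    have s1 : SmoothAt n (fun p : Eu n × Eu n => lieParam n G p.1) p :=
      smoothAt_lieParam_comp contDiffAt_fst hp.1
    have s2 : SmoothAt n (fun p : Eu n × Eu n => lieParam n G p.2) p :=
      smoothAt_lieParam_comp contDiffAt_snd hp.2
    rw [hf, logDer_mul s1 s2.inv, logDer_inv s2,
      logDer_comp (u := Prod.fst) (smoothAt_lieParam hp.1) differentiableAt_fst,
      logDer_comp (u := Prod.snd) (smoothAt_lieParam hp.2) differentiableAt_snd,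
      fderiv_fst, fderiv_snd, inv_inv, sub_eq_add_neg]
    rfl
  have hA : DifferentiableAt ℝ (fun y => Ad n (lieParam n G y)) e :=
    (smoothAt_lieParam lieOrigin_mem).ad.differentiableAt (by simp)
  have hΘ : DifferentiableAt ℝ (logDer n (lieParam n G)) e :=
    (contDiffAt_logDer_lieParam lieOrigin_mem).differentiableAt (by simp)
  have hlogd : DifferentiableAt ℝ (logDer n f) (e, e) :=
    hfs.self_of_nhds.logDer.differentiableAt (by simp)
  have hev : ∀ a b : Eu n × Eu n, fderiv ℝ (logDer n f) (e, e) a b =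
      fderiv ℝ (fun p => logDer n f p b) (e, e) a := by
    intro a b
    rw [fderiv_clm_apply hlogd (differentiableAt_const b)]; simp
  have h1 : fderiv ℝ (logDer n f) (e, e) (w, 0) (0, v) = 0 := by
    rw [hev]
    have : (fun p => logDer n f p (0, v)) =ᶠ[𝓝 (e, e)]
        (fun y => -Ad n (lieParam n G y) (logDer n (lieParam n G) y v)) ∘ Prod.snd := by
      filter_upwards [hlog] with p hp
      rw [hp]; simp
    rw [this.fderiv_eq, fderiv_comp (e, e)
      (hA.clm_apply (hΘ.clm_apply (differentiableAt_const v))).neg differentiableAt_snd, fderiv_snd]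
    simp
  have h2 : fderiv ℝ (logDer n f) (e, e) (0, v) (w, 0) =
      fderiv ℝ (fun y => Ad n (lieParam n G y)) e v w := by
    rw [hev]
    have : (fun p => logDer n f p (w, 0)) =ᶠ[𝓝 (e, e)]
        fun p => Ad n (lieParam n G p.2) (logDer n (lieParam n G) p.1 w) := by
      filter_upwards [hlog] with p hp
      rw [hp]; simp
    have hA' : HasFDerivAt (fun p : Eu n × Eu n => Ad n (lieParam n G p.2))
        ((fderiv ℝ (fun y => Ad n (lieParam n G y)) e).comp (ContinuousLinearMap.snd ℝ _ _))
        (e, e) := HasFDerivAt.comp (g := fun y => Ad n (lieParam n G y)) (f := Prod.snd) (e, e)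
          hA.hasFDerivAt hasFDerivAt_snd
    have hΘ' : HasFDerivAt (fun p : Eu n × Eu n => logDer n (lieParam n G) p.1)
        ((fderiv ℝ (logDer n (lieParam n G)) e).comp (ContinuousLinearMap.fst ℝ _ _))
        (e, e) := HasFDerivAt.comp (g := logDer n (lieParam n G)) (f := Prod.fst) (e, e)
          hΘ.hasFDerivAt hasFDerivAt_fst
    have h3 := hA'.clm_apply (hΘ'.clm_apply (hasFDerivAt_const w (e, e)))
    rw [this.fderiv_eq, h3.fderiv]
    simp [e, logDer_lieParam_lieOrigin]
  have h3 := maurerCartan hfs (w, 0) (0, v)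
  have h4 : logDer n f (e, e) (w, 0) = w := by
    rw [hlog.self_of_nhds]; simp [e, logDer_lieParam_lieOrigin, Ad_one]
  have h5 : logDer n f (e, e) (0, v) = -v := by
    rw [hlog.self_of_nhds]; simp [e, logDer_lieParam_lieOrigin, Ad_one]
  rw [h1, h2, h4, h5] at h3
  simp only [zero_sub, lieBr_neg_right, neg_neg, neg_eq_iff_eq_neg] at h3
  rw [h3, ← lieBr_skew]

/-- The derivative of the adjoint action along a map into the group. -/
theorem hasFDerivAt_Ad {f : E → G} {x : E} (hf : SmoothAt n f x) :
    HasFDerivAt (fun y => Ad n (f y))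
      ((ContinuousLinearMap.compL ℝ (Eu n) (Eu n) (Eu n) (Ad n (f x))).comp
        ((lieBrL n G).comp (logDer n f x))) x := by
  have hf0 : SmoothAt n (fun y => (f x)⁻¹ * f y) x := smoothAt_const.mul hf
  have hA : DifferentiableAt ℝ (fun y => Ad n (lieParam n G y)) (lieOrigin n G) :=
    (smoothAt_lieParam lieOrigin_mem).ad.differentiableAt (by simp)
  have hAd : HasFDerivAt (fun y => Ad n (lieParam n G y)) (lieBrL n G) (lieOrigin n G) := by
    refine hA.hasFDerivAt.congr_fderiv ?_
    ext1 v; ext1 w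
    rw [fderiv_Ad_lieParam, lieBr_eq_lieBrL]
  have hcx : lieChart n ((f x)⁻¹ * f x) = lieOrigin n G := by simp [lieOrigin]
  rw [← hcx] at hAd
  have h1 := HasFDerivAt.comp (g := fun y => Ad n (lieParam n G y)) x hAd hf.hasFDerivAt
  have h2 := ((ContinuousLinearMap.compL ℝ (Eu n) (Eu n) (Eu n)) (Ad n (f x))).hasFDerivAt.comp x h1
  refine h2.congr_of_eventuallyEq ?_
  have hs : ∀ᶠ y in 𝓝 x, (f x)⁻¹ * f y ∈ lieSource n G :=
      hf0.continuousAt.preimage_mem_nhds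
        (isOpen_lieSource.mem_nhds (by simpa using one_mem_lieSource))
  filter_upwards [hs] with y hy
  simp only [Function.comp]
  rw [lieParam_lieChart hy, ContinuousLinearMap.compL_apply, ← Ad_mul]
  simp

lemma hasFDerivAt_Ad_apply {f : E → G} {x : E} (hf : SmoothAt n f x) {ξ : E → Eu n}
    {ξ' : E →L[ℝ] Eu n} (hξ : HasFDerivAt ξ ξ' x) :
    HasFDerivAt (fun y => Ad n (f y) (ξ y))
      ((Ad n (f x)).comp ((lieBrL n G).flip (ξ x) ∘L (logDer n f x) + ξ')) x := by
  refine ((hasFDerivAt_Ad hf).clm_apply hξ).congr_fderiv ?_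
  ext1 v
  simp [add_comm]

/-- Differentiate Ad(g y g⁻¹) Ad(g) w = Ad(g) Ad(y) w in y at the identity. -/
lemma Ad_lieBr (g : G) (v w : Eu n) :
    Ad n g (lieBr n G v w) = lieBr n G (Ad n g v) (Ad n g w) := by
  have s : SmoothAt n (fun y => g * lieParam n G y * g⁻¹) (lieOrigin n G) :=
    (smoothAt_const.mul (smoothAt_lieParam lieOrigin_mem)).mul smoothAt_const
  have h1 := hasFDerivAt_Ad_apply s (hasFDerivAt_const (Ad n g w) (lieOrigin n G))
  have h2 := (Ad n g).hasFDerivAt.comp _ (hasFDerivAt_Ad_apply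
    (smoothAt_lieParam (G := G) lieOrigin_mem) (hasFDerivAt_const w (lieOrigin n G)))
  have h3 : (fun y => Ad n (g * lieParam n G y * g⁻¹) (Ad n g w)) =
      Ad n g ∘ fun y => Ad n (lieParam n G y) w := by
    funext y; simp [Ad_mul]
  rw [← h3] at h2
  have h4 := congrArg (fun L : Eu n →L[ℝ] Eu n => L v) (h2.unique h1)
  have h5 : logDer n (fun y => g * lieParam n G y * g⁻¹) (lieOrigin n G) = Ad n g := by
    simp [logDer, Ad]
  simpa [h5, logDer_lieParam_lieOrigin, Ad_one, ← lieBr_eq_lieBrL] using h4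

/-- A map with vanishing logarithmic derivative is constant on connected open sets. -/
lemma eq_of_logDer_eq_zero {f : E → G} {s : Set E} (ho : IsOpen s) (hs : IsPreconnected s)
    (hf : ∀ x ∈ s, SmoothAt n f x) (h0 : ∀ x ∈ s, logDer n f x = 0) {x y : E} (hx : x ∈ s)
    (hy : y ∈ s) : f x = f y := by
  refine hs.induction₂ (fun x y => f x = f y) ?_ (fun _ _ _ _ _ _ => Eq.trans)
    (fun _ _ _ _ => Eq.symm) hx hy
  intro x hx
  have hev : ∀ᶠ y in 𝓝 x, y ∈ s ∧ (f x)⁻¹ * f y ∈ lieSource n G :=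
    (ho.mem_nhds hx |> fun h => h : ∀ᶠ y in 𝓝 x, y ∈ s).and
      ((smoothAt_const.mul (hf x hx) : SmoothAt n (fun y => (f x)⁻¹ * f y) x
        ).continuousAt.preimage_mem_nhds
        (isOpen_lieSource.mem_nhds (by simpa using one_mem_lieSource)))
  obtain ⟨r, hr, hball⟩ := Metric.eventually_nhds_iff_ball.1 hev
  refine mem_nhdsWithin_of_mem_nhds ?_
  filter_upwards [Metric.ball_mem_nhds x hr] with y hy
  have hd : ∀ z ∈ Metric.ball x r, HasFDerivAt (fun y => lieChart n ((f x)⁻¹ * f y))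
      (0 : E →L[ℝ] Eu n) z := by
    intro z hz
    have hsz : SmoothAt n (fun y => (f x)⁻¹ * f y) z := smoothAt_const.mul (hf z (hball z hz).1)
    have h1 := logDer_eq_lieParam hsz (hball z hz).2
    rw [logDer_const_mul, h0 z (hball z hz).1] at h1
    refine ((hsz.lieChart_comp (hball z hz).2).differentiableAt (by simp)).hasFDerivAt.congr_fderiv ?_
    ext1 v
    rw [← leftField_logDer (lieChart_mem (hball z hz).2)
      (fderiv ℝ (fun y => lieChart n ((f x)⁻¹ * f y)) z v)]
    have h2 := congrArg (fun L : E →L[ℝ] Eu n => L v) h1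
    simp only [ContinuousLinearMap.comp_apply, zero_apply] at h2
    rw [← h2, map_zero, zero_apply]
  have h3 := (convex_ball x r).is_const_of_fderivWithin_eq_zero (𝕜 := ℝ)
    (fun z hz => (hd z hz).differentiableAt.differentiableWithinAt)
    (fun z hz => by rw [fderivWithin_of_isOpen Metric.isOpen_ball hz, (hd z hz).fderiv])
    (Metric.mem_ball_self hr) hy
  have h4 := congrArg (lieParam n G) h3
  simp only [lieParam_lieChart (hball y hy).2,
    lieParam_lieChart (hball x (Metric.mem_ball_self hr)).2] at h4
  exact mul_left_cancel h4

/-- Two maps with the same logarithmic derivative on a connected open set agree there as soon as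
they agree at one point. -/
lemma eqOn_of_logDer_eq {f g : E → G} {s : Set E} (ho : IsOpen s) (hs : IsPreconnected s)
    (hf : ∀ x ∈ s, SmoothAt n f x) (hg : ∀ x ∈ s, SmoothAt n g x)
    (h0 : ∀ x ∈ s, logDer n f x = logDer n g x) {x : E} (hx : x ∈ s) (hxy : f x = g x) :
    EqOn f g s := by
  intro y hy
  have h1 := eq_of_logDer_eq_zero (f := fun z => f z * (g z)⁻¹) ho hs
    (fun z hz => (hf z hz).mul (hg z hz).inv) (fun z hz => by
      rw [logDer_mul (hf z hz) (hg z hz).inv, logDer_inv (hg z hz), h0 z hz, inv_inv,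
        add_neg_cancel]) hx hy
  simp only [hxy, mul_inv_cancel] at h1
  exact (mul_inv_eq_one.1 h1.symm)

end MaurerCartan

/-! ### The local Frobenius theorem by integration along rays -/

section Frobenius

open Set Filter Topology

variable {E F : Type*} [NormedAddCommGroup E] [NormedSpace ℝ E] [CompleteSpace E]
  [NormedAddCommGroup F] [NormedSpace ℝ F] [CompleteSpace F]

lemma eq_of_hasDerivAt_zero {X : Type*} [NormedAddCommGroup X] [NormedSpace ℝ X] {ε : ℝ}
    (hε : 0 < ε) {f : ℝ → X} (hf : ∀ t ∈ Ioo (-ε) ε, HasDerivAt f 0 t) :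
    ∀ t ∈ Ioo (-ε) ε, f t = f 0 := fun t ht =>
  isOpen_Ioo.is_const_of_deriv_eq_zero isPreconnected_Ioo
    (fun s hs => (hf s hs).differentiableAt.differentiableWithinAt)
    (fun s hs => (hf s hs).deriv) ht ⟨by linarith, hε⟩

/-- Solutions of a total differential equation along the rays from a point. -/
lemma exists_radial_solution {Ψ : E × F → (E →L[ℝ] F)} {x₀ : E} {c₀ : F}
    (hΨ : ContDiffAt ℝ 1 Ψ (x₀, c₀)) :
    ∃ δ > (0 : ℝ), ∃ M : ℝ, 0 ≤ M ∧ ∃ y : E → ℝ → F, ∀ v, ‖v‖ < δ → y v 0 = c₀ ∧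
      ∀ t ∈ Icc (0 : ℝ) 1, HasDerivAt (y v) (Ψ (x₀ + t • v, y v t) v) t ∧
        ‖y v t - c₀‖ ≤ M * ‖v‖ := by
  -- Time and direction are added to the state with derivatives 1 and 0. The field is then
  -- autonomous, and dependence on the direction becomes dependence on the initial value.
  set V : ℝ × E × F → ℝ × E × F := fun p => (1, 0, Ψ (x₀ + p.1 • p.2.1, p.2.2) p.2.1) with hV
  have hVs : ContDiffAt ℝ 1 V (0, 0, c₀) := by
    refine contDiffAt_const.prodMk (contDiffAt_const.prodMk ?_)
    have hin : ContDiffAt ℝ 1 (fun p : ℝ × E × F => (x₀ + p.1 • p.2.1, p.2.2)) (0, 0, c₀) := by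
      fun_prop
    refine ContDiffAt.clm_apply ?_ (by fun_prop)
    refine ContDiffAt.comp (g := Ψ) _ ?_ hin
    simpa using hΨ
  obtain ⟨ε, hε, a, r, L, K, hr, hpl⟩ := IsPicardLindelof.of_contDiffAt_one hVs
  obtain ⟨α, hα, L', hL'⟩ :=
    (hpl 0).exists_forall_mem_closedBall_eq_hasDerivWithinAt_lipschitzOnWith
  have hr' : (0 : ℝ) < r := hr
  have hmem : ∀ z : E, ‖z‖ ≤ r → ((0 : ℝ), z, c₀) ∈ Metric.closedBall ((0 : ℝ), (0 : E), c₀) r := by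
    intro z hz
    simp [Prod.dist_eq, hz]
  have hd : ∀ z : E, ‖z‖ ≤ r → ∀ t ∈ Ioo (-ε) ε,
      HasDerivAt (α (0, z, c₀)) (V (α (0, z, c₀) t)) t := by
    intro z hz t ht
    refine ((hα _ (hmem z hz)).2 t ⟨by linarith [ht.1], by linarith [ht.2]⟩).hasDerivAt ?_
    exact Icc_mem_nhds (by linarith [ht.1]) (by linarith [ht.2])
  have h1 : ∀ z : E, ‖z‖ ≤ r → ∀ t ∈ Ioo (-ε) ε, (α (0, z, c₀) t).1 = t := by
    intro z hz t ht
    have := eq_of_hasDerivAt_zero hε (f := fun t => (α (0, z, c₀) t).1 - t) (fun s hs => by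
      have := (hasFDerivAt_fst.comp_hasDerivAt s (hd z hz s hs)).fun_sub (hasDerivAt_id s)
      simpa [V] using this) t ht
    simp only [(hα _ (hmem z hz)).1] at this
    linarith
  have h2 : ∀ z : E, ‖z‖ ≤ r → ∀ t ∈ Ioo (-ε) ε, (α (0, z, c₀) t).2.1 = z := by
    intro z hz t ht
    have := eq_of_hasDerivAt_zero hε (f := fun t => (α (0, z, c₀) t).2.1) (fun s hs => by
      have := (hasFDerivAt_fst.comp_hasDerivAt s
        (hasFDerivAt_snd.comp_hasDerivAt s (hd z hz s hs)))
      simpa [V, Function.comp_def] using this) t ht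
    simpa only [(hα _ (hmem z hz)).1] using this
  have h3 : ∀ z : E, ‖z‖ ≤ r → ∀ t ∈ Ioo (-ε) ε, HasDerivAt (fun t => (α (0, z, c₀) t).2.2)
      (Ψ (x₀ + t • z, (α (0, z, c₀) t).2.2) z) t := by
    intro z hz t ht
    have := (hasFDerivAt_snd.comp_hasDerivAt t
        (hasFDerivAt_snd.comp_hasDerivAt t (hd z hz t ht)))
    simpa [V, h1 z hz t ht, h2 z hz t ht, Function.comp_def] using this
  -- The solution in direction 0 is constant; comparing with it through the Lipschitz constant of
  -- the flow gives the linear bound in the direction.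
  have h4 : ∀ t ∈ Ioo (-ε) ε, (α (0, 0, c₀) t).2.2 = c₀ := by
    intro t ht
    have := eq_of_hasDerivAt_zero hε (f := fun t => (α (0, 0, c₀) t).2.2) (fun s hs => by
      simpa using h3 0 (by simp) s hs) t ht
    simpa only [(hα _ (hmem 0 (by simp))).1] using this
  -- The existence interval may be shorter than 1, so time 1 in direction v is replaced by time ε/2
  -- in direction (ε/2)⁻¹v. This direction must have norm at most r, whence δ = ε/2 · r.
  refine ⟨ε / 2 * r, by positivity, L' * (ε / 2)⁻¹, by positivity,
    fun v t => (α (0, (ε / 2)⁻¹ • v, c₀) (ε / 2 * t)).2.2, fun v hv => ?_⟩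
  have hz : ‖(ε / 2)⁻¹ • v‖ ≤ r := by
    rw [norm_smul, Real.norm_of_nonneg (by positivity), inv_mul_le_iff₀ (by positivity)]
    exact hv.le
  refine ⟨by simp only [mul_zero, (hα _ (hmem _ hz)).1], fun t ht => ?_⟩
  have htI : ε / 2 * t ∈ Ioo (-ε) ε := by
    constructor <;> nlinarith [ht.1, ht.2]
  constructor
  · have h5 := HasDerivAt.scomp t (h3 _ hz _ htI) ((hasDerivAt_id t).const_mul (ε / 2))
    have h6 : ε / 2 * t * (ε / 2)⁻¹ = t := by field_simp
    have h7 : ε / 2 * (ε / 2)⁻¹ = 1 := by field_simp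
    refine h5.congr_deriv ?_
    rw [smul_smul, h6, map_smul, smul_smul, mul_one, h7, one_smul]
  · have h5 := (hL' (ε / 2 * t) ⟨by linarith [htI.1], by linarith [htI.2]⟩).dist_le_mul _
      (hmem _ hz) _ (hmem 0 (by simp))
    have h6 : dist ((0 : ℝ), (ε / 2)⁻¹ • v, c₀) ((0 : ℝ), (0 : E), c₀) = (ε / 2)⁻¹ * ‖v‖ := by
      change max (dist (0 : ℝ) 0) (max (dist ((ε / 2)⁻¹ • v) 0) (dist c₀ c₀)) = _
      rw [dist_self, dist_self, dist_zero_right, norm_smul, Real.norm_of_nonneg (by positivity),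
        max_eq_right (le_max_of_le_left (by positivity)), max_eq_left (by positivity)]
    rw [h6] at h5
    have h7 : ‖(α (0, (ε / 2)⁻¹ • v, c₀) (ε / 2 * t)).2.2 - (α (0, 0, c₀) (ε / 2 * t)).2.2‖ ≤
        dist (α (0, (ε / 2)⁻¹ • v, c₀) (ε / 2 * t)) (α (0, 0, c₀) (ε / 2 * t)) := by
      rw [dist_eq_norm]
      exact (norm_snd_le (α (0, (ε / 2)⁻¹ • v, c₀) (ε / 2 * t) - α (0, 0, c₀) (ε / 2 * t)).2).trans
        (norm_snd_le (α (0, (ε / 2)⁻¹ • v, c₀) (ε / 2 * t) - α (0, 0, c₀) (ε / 2 * t)))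
    rw [h4 _ htI] at h7
    rw [mul_assoc]
    exact h7.trans h5

lemma gronwallBound_zero_mul {K ε : ℝ} (hK : K ≠ 0) :
    gronwallBound 0 K ε 1 = ε * ((Real.exp K - 1) / K) := by
  rw [gronwallBound_of_K_ne_0 hK]
  simp
  ring

lemma eventually_norm_lt {X Y : Type*} [TopologicalSpace X] [NormedAddCommGroup Y] {f : X → Y}
    {x : X} (h : ContinuousAt f x) {B : ℝ} (hB : ‖f x‖ < B) : ∀ᶠ y in 𝓝 x, ‖f y‖ < B :=
  Filter.Tendsto.eventually_lt_const hB h.norm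

set_option maxHeartbeats 1000000 in
/-- The local Frobenius theorem for total differential equations. -/
theorem exists_hasFDerivAt_of_integrable {Ψ : E × F → (E →L[ℝ] F)} {x₀ : E} {c₀ : F}
    (hΨ : ContDiffAt ℝ 2 Ψ (x₀, c₀))
    (hint : ∀ᶠ p in 𝓝 (x₀, c₀), ∀ u v, fderiv ℝ Ψ p (u, Ψ p u) v = fderiv ℝ Ψ p (v, Ψ p v) u) :
    ∃ c : E → F, c x₀ = c₀ ∧ ∀ᶠ x in 𝓝 x₀, HasFDerivAt c (Ψ (x, c x)) x := by
  obtain ⟨δ, hδ, M, hM, y, hy⟩ := exists_radial_solution (hΨ.of_le (by norm_num))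
  obtain ⟨K₂, s, hs, hK₂⟩ := (hΨ.fderiv_right (m := 1) (by norm_num)).exists_lipschitzOnWith
  have hbd : ∃ B : ℝ, 0 < B ∧ ∀ᶠ p in 𝓝 (x₀, c₀), ‖Ψ p‖ ≤ B ∧ ‖fderiv ℝ Ψ p‖ ≤ B := by
    have c1 : ContinuousAt Ψ (x₀, c₀) := hΨ.continuousAt
    have c2 : ContinuousAt (fderiv ℝ Ψ) (x₀, c₀) :=
      (hΨ.fderiv_right (m := 1) (by norm_num)).continuousAt
    obtain ⟨B₀, hB₀⟩ : ∃ B, B = ‖Ψ (x₀, c₀)‖ + ‖fderiv ℝ Ψ (x₀, c₀)‖ + 1 := ⟨_, rfl⟩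
    have l1 : ‖Ψ (x₀, c₀)‖ < B₀ := by linarith [norm_nonneg (fderiv ℝ Ψ (x₀, c₀))]
    have l2 : ‖fderiv ℝ Ψ (x₀, c₀)‖ < B₀ := by linarith [norm_nonneg (Ψ (x₀, c₀))]
    have e1 : ∀ᶠ p in 𝓝 (x₀, c₀), ‖Ψ p‖ < B₀ := eventually_norm_lt c1 l1
    have e2 : ∀ᶠ p in 𝓝 (x₀, c₀), ‖fderiv ℝ Ψ p‖ < B₀ :=
      eventually_norm_lt
      (Y := E × F →L[ℝ] E →L[ℝ] F) (f := fderiv ℝ Ψ) c2 l2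
    exact ⟨B₀, (norm_nonneg _).trans_lt l1, (e1.and e2).mono fun p hp => ⟨hp.1.le, hp.2.le⟩⟩
  obtain ⟨B, hB, hBe⟩ := hbd
  have hde : ∀ᶠ p in 𝓝 (x₀, c₀), DifferentiableAt ℝ Ψ p :=
    (hΨ.eventually (by simp)).mono fun p hp => hp.differentiableAt (by simp)
  obtain ⟨R, hR, hball⟩ := Metric.eventually_nhds_iff_ball.1
    (((hint.and hBe).and hde).and (Filter.eventually_iff.2 hs))
  replace hball : ∀ p ∈ Metric.ball (x₀, c₀) R,
      ((∀ u v, fderiv ℝ Ψ p (u, Ψ p u) v = fderiv ℝ Ψ p (v, Ψ p v) u) ∧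
        (‖Ψ p‖ ≤ B ∧ ‖fderiv ℝ Ψ p‖ ≤ B)) ∧ DifferentiableAt ℝ Ψ p ∧ p ∈ s :=
    fun p hp => ⟨(hball p hp).1.1, (hball p hp).1.2, (hball p hp).2⟩
  have hconv : Convex ℝ (Metric.ball (x₀, c₀) R) := convex_ball _ _
  have htaylor : ∀ p ∈ Metric.ball (x₀, c₀) R, ∀ q, p + q ∈ Metric.ball (x₀, c₀) R →
      ‖Ψ (p + q) - Ψ p - fderiv ℝ Ψ p q‖ ≤ K₂ * ‖q‖ * ‖q‖ := by
    intro p hp q hq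
    have hseg : segment ℝ p (p + q) ⊆ Metric.ball (x₀, c₀) R := hconv.segment_subset hp hq
    have := Convex.norm_image_sub_le_of_norm_hasFDerivWithin_le' (𝕜 := ℝ) (f := Ψ)
      (f' := fderiv ℝ Ψ) (φ := fderiv ℝ Ψ p) (C := K₂ * ‖q‖)
      (s := segment ℝ p (p + q)) (x := p) (y := p + q)
      (fun z hz => (hball z (hseg hz)).2.1.hasFDerivAt.hasFDerivWithinAt)
      (fun z hz => by
        have h1 := hK₂.dist_le_mul z (hball z (hseg hz)).2.2 p (hball p hp).2.2
        rw [dist_eq_norm, dist_eq_norm] at h1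
        refine h1.trans ?_
        gcongr
        have := norm_sub_le_of_mem_segment hz
        simpa using this)
      (convex_segment _ _) (left_mem_segment ℝ _ _) (right_mem_segment ℝ _ _)
    simpa using this
  have hlip : ∀ p ∈ Metric.ball (x₀, c₀) R, ∀ q ∈ Metric.ball (x₀, c₀) R,
      ‖Ψ p - Ψ q‖ ≤ B * ‖p - q‖ := fun p hp q hq =>
    Convex.norm_image_sub_le_of_norm_hasFDerivWithin_le (𝕜 := ℝ)
      (fun z hz => (hball z hz).2.1.hasFDerivAt.hasFDerivWithinAt)
      (fun z hz => (hball z hz).1.2.2) hconv hq hp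
  -- Rays of length up to 2ρ then stay in the ball of radius R/2; the other half of R is left for
  -- the first-order corrections below.
  set ρ : ℝ := min (min (δ / 2) (1 / 2)) (R / (4 * (M + 1))) with hρ
  have hρ0 : 0 < ρ := by positivity
  -- The candidate is the value at time 1 of the solution along the ray from x₀ to x. What has to be
  -- shown is that it has the prescribed derivative in non-radial directions as well.
  refine ⟨fun x => y (x - x₀) 1, by
    have h0 := (hy 0 (by simpa using hδ)).2 1 (by simp)
    have : y 0 1 - c₀ = 0 := by simpa using h0.2
    simpa using sub_eq_zero.1 this, ?_⟩
  filter_upwards [Metric.ball_mem_nhds x₀ hρ0] with x hx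
  set v := x - x₀ with hv
  have hvρ : ‖v‖ < ρ := by simpa [dist_eq_norm] using hx
  have hρ1 : ρ ≤ δ / 2 := (min_le_left _ _).trans (min_le_left _ _)
  have hρ2 : ρ ≤ 1 / 2 := (min_le_left _ _).trans (min_le_right _ _)
  have hρ3 : ρ ≤ R / (4 * (M + 1)) := min_le_right _ _
  have hρ4 : (M + 1) * (2 * ρ) ≤ R / 2 := by
    have := (le_div_iff₀ (by positivity)).1 hρ3
    nlinarith
  have hMw : ∀ w : E, ‖w‖ < 2 * ρ → ∀ t ∈ Icc (0 : ℝ) 1,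
      ‖t • w‖ < R / 2 ∧ ‖y w t - c₀‖ < R / 2 := by
    intro w hw t ht
    have h1 : ‖t • w‖ ≤ ‖w‖ := by
      rw [norm_smul, Real.norm_of_nonneg ht.1]
      exact mul_le_of_le_one_left (norm_nonneg _) ht.2
    have h2 := ((hy w (by linarith)).2 t ht).2
    have h3 := norm_nonneg w
    constructor <;> nlinarith
  have hp : ∀ w : E, ‖w‖ < 2 * ρ → ∀ t ∈ Icc (0 : ℝ) 1,
      (x₀ + t • w, y w t) ∈ Metric.ball (x₀, c₀) (R / 2) := by
    intro w hw t ht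
    rw [Metric.mem_ball, Prod.dist_eq, max_lt_iff, dist_eq_norm, dist_eq_norm]
    simpa using hMw w hw t ht
  set C : ℝ := K₂ * (1 + B) * (1 + B) + B * (1 + B) with hC
  have hC0 : 0 ≤ C := by positivity
  have hmain : ∀ᶠ h in 𝓝 (0 : E), ‖y (v + h) 1 - y v 1 - Ψ (x, y v 1) h‖ ≤
      C * ((Real.exp B - 1) / B) * ‖h‖ * ‖h‖ := by
    have hη : 0 < min ρ (R / (2 * (1 + B))) := by positivity
    filter_upwards [Metric.ball_mem_nhds (0 : E) hη] with h hh
    have hh' : ‖h‖ < min ρ (R / (2 * (1 + B))) := by simpa using hh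
    have hhρ : ‖h‖ < ρ := hh'.trans_le (min_le_left _ _)
    have hhR : (1 + B) * ‖h‖ < R / 2 := by
      have := hh'.trans_le (min_le_right _ _)
      rw [lt_div_iff₀ (by positivity)] at this
      linarith
    have hv2 : ‖v‖ < 2 * ρ := by linarith
    have hvh : ‖v + h‖ < 2 * ρ := (norm_add_le _ _).trans_lt (by linarith)
    have hvh1 : ‖v + h‖ ≤ 1 := by linarith
    set p : ℝ → E × F := fun t => (x₀ + t • v, y v t) with hpdef
    set k : ℝ → E × F := fun t => (h, Ψ (p t) h) with hkdef
    have hpm : ∀ t ∈ Icc (0 : ℝ) 1, p t ∈ Metric.ball (x₀, c₀) R := fun t ht =>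
      Metric.ball_subset_ball (by linarith) (hp v hv2 t ht)
    have hk : ∀ t ∈ Icc (0 : ℝ) 1, ‖k t‖ ≤ (1 + B) * ‖h‖ := by
      intro t ht
      rw [Prod.norm_def, max_le_iff]
      have h1 : ‖Ψ (p t) h‖ ≤ B * ‖h‖ :=
        (Ψ (p t)).le_of_opNorm_le (hball _ (hpm t ht)).1.2.1 h
      have h2 := norm_nonneg h
      constructor
      · simp only [k]; nlinarith
      · simp only [k]; nlinarith
    have htk : ∀ t ∈ Icc (0 : ℝ) 1, ‖t • k t‖ ≤ (1 + B) * ‖h‖ := by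
      intro t ht
      rw [norm_smul, Real.norm_of_nonneg ht.1]
      exact (mul_le_of_le_one_left (norm_nonneg _) ht.2).trans (hk t ht)
    have hpk : ∀ t ∈ Icc (0 : ℝ) 1, p t + t • k t ∈ Metric.ball (x₀, c₀) R := by
      intro t ht
      rw [Metric.mem_ball]
      have h1 := Metric.mem_ball.1 (hp v hv2 t ht)
      calc dist (p t + t • k t) (x₀, c₀) ≤ dist (p t + t • k t) (p t) + dist (p t) (x₀, c₀) :=
            dist_triangle _ _ _
        _ < R / 2 + R / 2 := by
            refine add_lt_add ?_ h1
            rw [dist_eq_norm, add_sub_cancel_left]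
            exact (htk t ht).trans_lt hhR
        _ = R := by ring
    -- This is the first-order prediction for the solution along the neighbouring ray v + h.
    set w : ℝ → F := fun t => y v t + t • Ψ (p t) h with hwdef
    set w' : ℝ → F := fun t => Ψ (p t) v + (Ψ (p t) h + t • fderiv ℝ Ψ (p t) (k t) v) with hw'def
    have hwd : ∀ t ∈ Icc (0 : ℝ) 1, HasDerivAt w (w' t) t := by
      intro t ht
      have d1 := ((hy v (by linarith)).2 t ht).1
      have d2 : HasDerivAt p (v, Ψ (p t) v) t := by
        refine HasDerivAt.prodMk ?_ d1
        simpa using ((hasDerivAt_id t).smul_const v).const_add x₀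
      have d3 := (hball _ (hpm t ht)).2.1.hasFDerivAt.comp_hasDerivAt t d2
      have d4 := d3.clm_apply (hasDerivAt_const t h)
      have d5 := d1.add ((hasDerivAt_id t).smul d4)
      refine d5.congr_deriv ?_
      simp only [w', k, id]
      -- Integrability exchanges h and v here. It is what makes the prediction solve the
      -- neighbouring equation up to an error of second order in h.
      rw [(hball _ (hpm t ht)).1.1 h v]
      simp [add_comm]
      rfl
    have herr : ∀ t ∈ Icc (0 : ℝ) 1, ‖w' t - Ψ (x₀ + t • (v + h), w t) (v + h)‖ ≤
        C * ‖h‖ * ‖h‖ := by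
      intro t ht
      have e1 : (x₀ + t • (v + h), w t) = p t + t • k t := by
        simp only [p, k, w, Prod.smul_mk, Prod.mk_add_mk, smul_add, add_assoc]
      have e2 : w' t - Ψ (p t + t • k t) (v + h) =
          -((Ψ (p t + t • k t) - Ψ (p t) - fderiv ℝ Ψ (p t) (t • k t)) (v + h)) -
            t • fderiv ℝ Ψ (p t) (k t) h := by
        simp only [w', map_smul, map_add, sub_apply, smul_apply]
        abel
      rw [e1, e2]
      have b1 : ‖(Ψ (p t + t • k t) - Ψ (p t) - fderiv ℝ Ψ (p t) (t • k t)) (v + h)‖ ≤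
          K₂ * ((1 + B) * ‖h‖) * ((1 + B) * ‖h‖) := by
        refine (ContinuousLinearMap.le_opNorm _ _).trans ?_
        refine (mul_le_of_le_one_right (norm_nonneg _) hvh1).trans ?_
        refine (htaylor _ (hpm t ht) _ (hpk t ht)).trans ?_
        gcongr <;> exact htk t ht
      have b2 : ‖t • fderiv ℝ Ψ (p t) (k t) h‖ ≤ B * ((1 + B) * ‖h‖) * ‖h‖ := by
        rw [norm_smul, Real.norm_of_nonneg ht.1]
        refine (mul_le_of_le_one_left (norm_nonneg _) ht.2).trans ?_
        refine (ContinuousLinearMap.le_opNorm _ _).trans ?_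
        gcongr
        refine (ContinuousLinearMap.le_opNorm _ _).trans ?_
        gcongr
        · exact (hball _ (hpm t ht)).1.2.2
        · exact hk t ht
      refine (norm_sub_le _ _).trans ?_
      rw [norm_neg]
      refine (add_le_add b1 b2).trans (le_of_eq ?_)
      simp only [C]; ring
    set S : ℝ → Set F := fun t => {z | (x₀ + t • (v + h), z) ∈ Metric.ball (x₀, c₀) R} with hS
    -- Grönwall compares the prediction with the true solution along v + h; both start at c₀, so
    -- their distance at time 1 is O(‖h‖²).
    have hgr := dist_le_of_approx_trajectories_ODE_of_mem (E := F)
      (v := fun t z => Ψ (x₀ + t • (v + h), z) (v + h)) (s := S) (K := B.toNNReal)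
      (f := w) (f' := w') (g := y (v + h)) (a := 0) (b := 1) (δ := 0)
      (g' := fun t => Ψ (x₀ + t • (v + h), y (v + h) t) (v + h))
      (εf := C * ‖h‖ * ‖h‖) (εg := 0)
      (fun t ht => LipschitzOnWith.of_dist_le_mul fun z hz z' hz' => by
        rw [dist_eq_norm, dist_eq_norm, ← sub_apply]
        refine (ContinuousLinearMap.le_opNorm _ _).trans ?_
        refine (mul_le_of_le_one_right (norm_nonneg _) hvh1).trans ?_
        refine (hlip _ hz _ hz').trans (le_of_eq ?_)
        simp [Prod.norm_def, hB.le])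
      (fun t ht => (hwd t ht).continuousAt.continuousWithinAt)
      (fun t ht => (hwd t (Ico_subset_Icc_self ht)).hasDerivWithinAt)
      (fun t ht => by rw [dist_eq_norm]; exact herr t (Ico_subset_Icc_self ht))
      (fun t ht => by
        have e1 : (x₀ + t • (v + h), w t) = p t + t • k t := by
          simp only [p, k, w, Prod.smul_mk, Prod.mk_add_mk, smul_add, add_assoc]
        simp only [S, mem_ofPred_eq, e1]
        exact hpk t (Ico_subset_Icc_self ht))
      (fun t ht => ((hy (v + h) (by linarith)).2 t ht).1.continuousAt.continuousWithinAt)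
      (fun t ht => ((hy (v + h) (by linarith)).2 t (Ico_subset_Icc_self ht)).1.hasDerivWithinAt)
      (fun t ht => by simp)
      (fun t ht => Metric.ball_subset_ball (by linarith)
        (hp (v + h) hvh t (Ico_subset_Icc_self ht)))
      (by simp [w, (hy v (by linarith)).1, (hy (v + h) (by linarith)).1])
      1 (by simp)
    rw [add_zero, sub_zero, Real.coe_toNNReal B hB.le,
      gronwallBound_zero_mul hB.ne', dist_eq_norm] at hgr
    have e3 : w 1 = y v 1 + Ψ (x, y v 1) h := by simp [w, p, hv]
    rw [e3, norm_sub_rev, ← sub_sub] at hgr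
    refine hgr.trans (le_of_eq ?_)
    ring
  rw [hasFDerivAt_iff_isLittleO_nhds_zero]
  refine Asymptotics.IsBigO.trans_isLittleO (g := fun h : E => ‖h‖ * ‖h‖) ?_ ?_
  · refine Asymptotics.IsBigO.of_bound (C * ((Real.exp B - 1) / B)) ?_
    filter_upwards [hmain] with h hh
    have e : x + h - x₀ = v + h := by rw [hv]; abel
    rw [e]
    refine hh.trans (le_of_eq ?_)
    rw [Real.norm_of_nonneg (by positivity)]; ring
  · have : (fun h : E => ‖h‖ * ‖h‖) =o[𝓝 0] fun h : E => ‖h‖ * (1 : ℝ) := by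
      refine Asymptotics.IsBigO.mul_isLittleO (Asymptotics.isBigO_refl _ _) ?_
      rw [Asymptotics.isLittleO_one_iff]
      exact tendsto_norm_zero
    simp only [mul_one] at this
    exact this.of_norm_right

end Frobenius

/-! ### Flat forms are logarithmic derivatives -/

section Cartan

open Set Filter Topology

variable {n : ℕ} {G : Type*} [Group G] [TopologicalSpace G]
  [ChartedSpace (EuclideanSpace ℝ (Fin n)) G]
  {E F : Type*} [NormedAddCommGroup E] [NormedSpace ℝ E] [NormedAddCommGroup F] [NormedSpace ℝ F]
  [LieGroup (𝓡 n) ∞ G]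

/-- Solutions of smooth total differential equations are smooth. -/
lemma contDiffOn_of_hasFDerivAt {Ψ : E × F → (E →L[ℝ] F)} {c : E → F} {U : Set E} (hU : IsOpen U)
    (h : ∀ x ∈ U, HasFDerivAt c (Ψ (x, c x)) x) (hΨ : ∀ x ∈ U, ContDiffAt ℝ ∞ Ψ (x, c x)) :
    ContDiffOn ℝ ∞ c U := by
  rw [contDiffOn_infty]
  intro m
  induction m with
  | zero =>
    exact contDiffOn_zero.2 fun x hx => (h x hx).continuousAt.continuousWithinAt
  | succ m ih =>
    have := (contDiffOn_succ_iff_fderiv_of_isOpen (𝕜 := ℝ) (n := m) (f := c) hU).2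
      ⟨fun x hx => (h x hx).differentiableAt.differentiableWithinAt, by simp, ?_⟩
    · exact_mod_cast this
    · have h2 : ContDiffOn ℝ m (fun x => Ψ (x, c x)) U := by
        intro x hx
        have h3 : ContDiffAt ℝ m Ψ (x, c x) := (hΨ x hx).of_le (by exact_mod_cast le_top)
        exact h3.comp_contDiffWithinAt (f := fun x => (x, c x)) x
          (contDiffWithinAt_id.prodMk (ih x hx))
      exact h2.congr fun x hx => (h x hx).fderiv

/-- Left invariant vector fields in coordinates are closed under the bracket. -/
lemma leftField_bracket {y : Eu n} (hy : y ∈ lieTarget n G) (v w : Eu n) :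
    fderiv ℝ (leftField n G) y (leftField n G y v) w -
      fderiv ℝ (leftField n G) y (leftField n G y w) v = leftField n G y (lieBr n G v w) := by
  have hd : DifferentiableAt ℝ (leftField n G) y :=
    (contDiffAt_leftField hy).differentiableAt (by simp)
  have hd' : DifferentiableAt ℝ (logDer n (lieParam n G)) y :=
    (contDiffAt_logDer_lieParam hy).differentiableAt (by simp)
  have key : ∀ a w, logDer n (lieParam n G) y (fderiv ℝ (leftField n G) y a w) =
      -fderiv ℝ (logDer n (lieParam n G)) y a (leftField n G y w) := by
    intro a w
    have h1 : (fun y => logDer n (lieParam n G) y (leftField n G y w))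
        =ᶠ[𝓝 y] fun _ => w := by
      filter_upwards [isOpen_lieTarget.mem_nhds hy] with y hy
      exact logDer_leftField hy w
    have h2 := h1.fderiv_eq (𝕜 := ℝ)
    rw [fderiv_clm_apply hd' (hd.clm_apply (differentiableAt_const w)),
      fderiv_clm_apply hd (differentiableAt_const w)] at h2
    have h3 := congrArg (fun L : Eu n →L[ℝ] Eu n => L a) h2
    simp at h3
    exact eq_neg_of_add_eq_zero_left h3
  have hmc := maurerCartan (n := n) (f := lieParam n G) (x := y)
    (by filter_upwards [isOpen_lieTarget.mem_nhds hy] with z hz using smoothAt_lieParam hz)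
    (leftField n G y v) (leftField n G y w)
  rw [logDer_leftField hy, logDer_leftField hy] at hmc
  rw [← leftField_logDer hy (fderiv ℝ (leftField n G) y (leftField n G y v) w -
      fderiv ℝ (leftField n G) y (leftField n G y w) v), map_sub, key, key, ← neg_neg (lieBr n G v w),
      ← hmc]
  congr 1
  abel

/-- Local existence for flat Lie-algebra-valued one-forms: every such form is a logarithmic
derivative. -/
theorem exists_logDer_eq [CompleteSpace E] {α : E → (E →L[ℝ] Eu n)} {x₀ : E} (g₀ : G)
    (hα : ∀ᶠ x in 𝓝 x₀, ContDiffAt ℝ ∞ α x)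
    (hflat : ∀ᶠ x in 𝓝 x₀, ∀ u v, fderiv ℝ α x u v - fderiv ℝ α x v u +
      lieBr n G (α x u) (α x v) = 0) :
    ∃ f : E → G, f x₀ = g₀ ∧ ∀ᶠ x in 𝓝 x₀, SmoothAt n f x ∧ logDer n f x = α x := by
  -- In coordinates the equation for f becomes dc = frame(c) ∘ α. Its integrability condition is the
  -- flatness of α combined with the closure of the left invariant fields under the bracket.
  set Ψ : E × Eu n → (E →L[ℝ] Eu n) := fun p => (leftField n G p.2).comp (α p.1) with hΨdef
  have hΨ : ∀ p : E × Eu n, ContDiffAt ℝ ∞ α p.1 → p.2 ∈ lieTarget n G → ContDiffAt ℝ ∞ Ψ p := by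
    intro p h1 h2
    have h3 : ContDiffAt ℝ ∞ (fun p : E × Eu n => leftField n G p.2) p :=
      (contDiffAt_leftField h2).comp p contDiffAt_snd
    have h4 : ContDiffAt ℝ ∞ (fun p : E × Eu n => α p.1) p := h1.comp p contDiffAt_fst
    exact h3.clm_comp h4
  have hT : ∀ᶠ y in 𝓝 (lieOrigin n G), y ∈ lieTarget n G := isOpen_lieTarget.mem_nhds lieOrigin_mem
  have hev := ((continuous_fst.tendsto (x₀, lieOrigin n G)).eventually (hα.and hflat)).and
    ((continuous_snd.tendsto (x₀, lieOrigin n G)).eventually hT)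
  obtain ⟨c, hc0, hc⟩ := exists_hasFDerivAt_of_integrable (Ψ := Ψ) (x₀ := x₀) (c₀ := lieOrigin n G)
    ((hΨ _ hα.self_of_nhds lieOrigin_mem).of_le (WithTop.coe_le_coe.2 (le_top : (2 : ℕ∞) ≤ ⊤))) (by
      filter_upwards [hev] with p hp u v
      obtain ⟨⟨h1, h2⟩, h3⟩ := hp
      have d1 : HasFDerivAt (fun p : E × Eu n => leftField n G p.2)
          ((fderiv ℝ (leftField n G) p.2).comp (ContinuousLinearMap.snd ℝ E (Eu n))) p :=
        HasFDerivAt.comp (g := leftField n G) (f := Prod.snd) p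
          ((contDiffAt_leftField h3).differentiableAt (by simp)).hasFDerivAt hasFDerivAt_snd
      have d2 : HasFDerivAt (fun p : E × Eu n => α p.1)
          ((fderiv ℝ α p.1).comp (ContinuousLinearMap.fst ℝ E (Eu n))) p :=
        HasFDerivAt.comp (g := α) (f := Prod.fst) p
          (h1.differentiableAt (by simp)).hasFDerivAt hasFDerivAt_fst
      have d3 := (d1.clm_comp d2).fderiv
      have d4 : ∀ a v, fderiv ℝ Ψ p a v = leftField n G p.2 (fderiv ℝ α p.1 a.1 v) +
          fderiv ℝ (leftField n G) p.2 a.2 (α p.1 v) := by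
        intro a v
        have := congrArg (fun L => L a v) d3
        simpa using this
      rw [d4, d4]
      have h5 := leftField_bracket h3 (α p.1 u) (α p.1 v)
      have h6 := congrArg (leftField n G p.2) (h2 u v)
      rw [map_add, map_sub, ← h5, map_zero] at h6
      simp only [Ψ, ContinuousLinearMap.comp_apply]
      rw [← sub_eq_zero, ← h6]
      abel)
  have hcx : ∀ᶠ x in 𝓝 x₀, c x ∈ lieTarget n G :=
    hc.self_of_nhds.continuousAt.preimage_mem_nhds (isOpen_lieTarget.mem_nhds (hc0 ▸ lieOrigin_mem))
  obtain ⟨U, hU, hUo, hxU⟩ := mem_nhds_iff.1 ((hc.and hcx).and hα)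
  have hcs : ContDiffOn ℝ ∞ c U := contDiffOn_of_hasFDerivAt hUo (fun x hx => (hU hx).1.1)
    (fun x hx => hΨ _ (hU hx).2 (hU hx).1.2)
  refine ⟨fun x => g₀ * lieParam n G (c x), by simp [hc0], ?_⟩
  filter_upwards [hUo.mem_nhds hxU] with x hx
  have hs : ContDiffAt ℝ ∞ c x := hcs.contDiffAt (hUo.mem_nhds hx)
  refine ⟨smoothAt_const.mul (smoothAt_lieParam_comp hs (hU hx).1.2), ?_⟩
  rw [logDer_const_mul, logDer_comp (smoothAt_lieParam (hU hx).1.2) (hs.differentiableAt (by simp)),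
    (hU hx).1.1.fderiv]
  ext1 v
  exact logDer_leftField (hU hx).1.2 _

end Cartan

/-! ### One-parameter groups -/

section Exponential

open Set Filter Topology

variable {n : ℕ} {G : Type*} [Group G] [TopologicalSpace G]
  [ChartedSpace (EuclideanSpace ℝ (Fin n)) G] [LieGroup (𝓡 n) ∞ G]

/-- The linear map `t ↦ t • v`. -/
abbrev spanL {n : ℕ} (v : Eu n) : ℝ →L[ℝ] Eu n := ContinuousLinearMap.toSpanSingleton ℝ v

/-- The adjoint action of a one-parameter group is trivial on vectors commuting with the
generator. -/
lemma Ad_eq_self_of_lieBr_eq_zero {γ : ℝ → G} {v w : Eu n} {r : ℝ} (h0 : γ 0 = 1)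
    (hs : ∀ t ∈ Ioo (-r) r, SmoothAt n γ t) (hl : ∀ t ∈ Ioo (-r) r, logDer n γ t = spanL v)
    (hvw : lieBr n G v w = 0) {t : ℝ} (ht : t ∈ Ioo (-r) r) : Ad n (γ t) w = w := by
  have h := eq_of_hasDerivAt_zero (ε := r) (f := fun t => Ad n (γ t) w)
    (by linarith [ht.1, ht.2]) (fun t ht => by
      have := (hasFDerivAt_Ad_apply (hs t ht) (hasFDerivAt_const w t)).hasDerivAt
      refine this.congr_deriv ?_
      simp [hl t ht, ← lieBr_eq_lieBrL, hvw]) t ht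
  simpa [h0] using h

/-- Doubling: γ(t/2)² lives on an interval twice as long. Ad(γ) fixes v because [v, v] = 0, so by
the product rule the logarithmic derivative is v/2 + v/2. The radius r does not depend on N. -/
lemma exists_expCurve_Ioo (v : Eu n) : ∃ r > (0 : ℝ), ∀ N : ℕ, ∃ γ : ℝ → G, γ 0 = 1 ∧
    ∀ t ∈ Ioo (-(2 ^ N * r)) (2 ^ N * r), SmoothAt n γ t ∧ logDer n γ t = spanL v := by
  obtain ⟨f, hf0, hf⟩ := exists_logDer_eq (n := n) (E := ℝ) (α := fun _ => spanL v) (x₀ := 0)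
    (1 : G) (Eventually.of_forall fun x => contDiffAt_const) (Eventually.of_forall fun x a b => by
      simp)
  obtain ⟨r, hr, hball⟩ := Metric.eventually_nhds_iff_ball.1 hf
  refine ⟨r, hr, fun N => ?_⟩
  induction N with
  | zero =>
    refine ⟨f, hf0, fun t ht => hball t ?_⟩
    rw [Real.ball_eq_Ioo]
    simpa using ht
  | succ N ih =>
    obtain ⟨γ, h0, h⟩ := ih
    refine ⟨fun t => γ (t / 2) * γ (t / 2), by simp [h0], fun t ht => ?_⟩
    have ht2 : t / 2 ∈ Ioo (-(2 ^ N * r)) (2 ^ N * r) := by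
      rw [pow_succ] at ht
      constructor <;> linarith [ht.1, ht.2]
    have hd : ContDiffAt ℝ ∞ (fun t : ℝ => t / 2) t := contDiffAt_id.div_const 2
    have hs : SmoothAt n (fun t => γ (t / 2)) t := SmoothAt.comp (u := fun t : ℝ => t / 2) (h _ ht2).1 hd
    refine ⟨hs.mul hs, ?_⟩
    have hA : Ad n (γ (t / 2))⁻¹ v = v := by
      have := Ad_eq_self_of_lieBr_eq_zero h0 (fun t ht => (h t ht).1) (fun t ht => (h t ht).2)
        (lieBr_self v) ht2
      conv_lhs => rw [← this]
      simp
    rw [logDer_mul hs hs, logDer_comp (u := fun t : ℝ => t / 2) (h _ ht2).1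
      (hd.differentiableAt (by simp)), (h _ ht2).2]
    ext1
    have hd' : fderiv ℝ (fun t : ℝ => t / 2) t 1 = 1 / 2 := by
      rw [fderiv_apply_one_eq_deriv, deriv_div_const]; simp
    simp only [add_apply, ContinuousLinearMap.comp_apply, hd',
      ContinuousLinearMap.toSpanSingleton_apply, map_smul, hA, one_smul]
    rw [← add_smul]
    norm_num

/-- The solutions on the nested intervals agree by uniqueness, so they glue to one defined for all
times. -/
theorem exists_expCurve (v : Eu n) : ∃ γ : ℝ → G, γ 0 = 1 ∧
    ∀ t, SmoothAt n γ t ∧ logDer n γ t = spanL v := by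
  obtain ⟨r, hr, h⟩ := exists_expCurve_Ioo (G := G) v
  choose γ h0 hγ using h
  have hagree : ∀ N M : ℕ, N ≤ M → EqOn (γ N) (γ M) (Ioo (-(2 ^ N * r)) (2 ^ N * r)) := by
    intro N M hNM
    have hle : (2 : ℝ) ^ N * r ≤ 2 ^ M * r := by gcongr; norm_num
    have hsub : Ioo (-(2 ^ N * r)) (2 ^ N * r) ⊆ Ioo (-(2 ^ M * r)) (2 ^ M * r) :=
      Ioo_subset_Ioo (by linarith) hle
    refine eqOn_of_logDer_eq isOpen_Ioo isPreconnected_Ioo (fun t ht => (hγ N t ht).1)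
      (fun t ht => (hγ M t (hsub ht)).1) (fun t ht => ?_) (x := 0) ?_ (by rw [h0, h0])
    · rw [(hγ N t ht).2, (hγ M t (hsub ht)).2]
    · have : 0 < (2 : ℝ) ^ N * r := by positivity
      constructor <;> linarith
  have hex : ∀ t : ℝ, ∃ N : ℕ, t ∈ Ioo (-(2 ^ N * r)) (2 ^ N * r) := by
    intro t
    obtain ⟨N, hN⟩ := pow_unbounded_of_one_lt (|t| / r) (one_lt_two)
    refine ⟨N, ?_⟩
    rw [div_lt_iff₀ hr, abs_lt] at hN
    exact hN
  choose N hN using hex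
  have hev : ∀ t, (fun s => γ (N s) s) =ᶠ[𝓝 t] γ (N t) := by
    intro t
    filter_upwards [isOpen_Ioo.mem_nhds (hN t)] with s hs
    rcases le_total (N s) (N t) with h | h
    · exact hagree _ _ h (hN s)
    · exact (hagree _ _ h hs).symm
  refine ⟨fun s => γ (N s) s, h0 _, fun t => ⟨?_, ?_⟩⟩
  · exact (hγ (N t) t (hN t)).1.congr_of_eventuallyEq (hev t)
  · rw [logDer_congr (hev t)]
    exact (hγ (N t) t (hN t)).2

/-- The one-parameter group `t ↦ exp (t v)`. -/
def expCurve (G : Type*) [Group G] [TopologicalSpace G]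
    [ChartedSpace (EuclideanSpace ℝ (Fin n)) G] [LieGroup (𝓡 n) ∞ G] (v : Eu n) : ℝ → G :=
  (exists_expCurve (G := G) v).choose

@[simp] lemma expCurve_zero (v : Eu n) : expCurve G v 0 = 1 :=
  (exists_expCurve (G := G) v).choose_spec.1

lemma smoothAt_expCurve (v : Eu n) (t : ℝ) : SmoothAt n (expCurve G v) t :=
  ((exists_expCurve (G := G) v).choose_spec.2 t).1

lemma logDer_expCurve (v : Eu n) (t : ℝ) : logDer n (expCurve G v) t = spanL v :=
  ((exists_expCurve (G := G) v).choose_spec.2 t).2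

/-- Uniqueness for a constant logarithmic derivative; the addition, scaling and conjugation laws of
the exponential below are all instances of it. -/
lemma eq_mul_expCurve {γ : ℝ → G} {v : Eu n} (hs : ∀ t, SmoothAt n γ t)
    (hl : ∀ t, logDer n γ t = spanL v) (t : ℝ) : γ t = γ 0 * expCurve G v t := by
  refine eqOn_of_logDer_eq (n := n) (g := fun t => γ 0 * expCurve G v t) isOpen_univ
    isPreconnected_univ (fun t _ => hs t) (fun t _ => smoothAt_const.mul (smoothAt_expCurve v t))
    (fun t _ => ?_) (mem_univ 0) (by simp) (mem_univ t)
  rw [hl, logDer_const_mul, logDer_expCurve]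

lemma eq_expCurve {γ : ℝ → G} {v : Eu n} (hs : ∀ t, SmoothAt n γ t)
    (hl : ∀ t, logDer n γ t = spanL v) (h0 : γ 0 = 1) : γ = expCurve G v := by
  funext t
  rw [eq_mul_expCurve hs hl t, h0, one_mul]

lemma logDer_real_comp {γ : ℝ → G} {u : ℝ → ℝ} {u' t : ℝ} {v : Eu n} (hs : SmoothAt n γ (u t))
    (hl : logDer n γ (u t) = spanL v) (hu : HasDerivAt u u' t) :
    logDer n (fun t => γ (u t)) t = spanL (u' • v) := by
  rw [logDer_comp hs hu.differentiableAt, hl]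
  ext1
  simp [hu.deriv]

lemma expCurve_add (v : Eu n) (s t : ℝ) :
    expCurve G v (s + t) = expCurve G v s * expCurve G v t := by
  have := eq_mul_expCurve (γ := fun t => expCurve G v (s + t)) (v := v)
    (fun t => SmoothAt.comp (u := fun t => s + t) (smoothAt_expCurve v _) (by fun_prop))
    (fun t => by
      have := logDer_real_comp (u := fun t => s + t) (t := t) (smoothAt_expCurve v _)
        (logDer_expCurve (G := G) v (s + t)) ((hasDerivAt_id t).const_add s)
      simpa using this) t
  simpa using this

lemma expCurve_smul (c : ℝ) (v : Eu n) (t : ℝ) : expCurve G (c • v) t = expCurve G v (c * t) := by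
  have := eq_expCurve (γ := fun t => expCurve G v (c * t)) (v := c • v)
    (fun t => SmoothAt.comp (u := fun t => c * t) (smoothAt_expCurve v _) (by fun_prop))
    (fun t => by
      have := logDer_real_comp (u := fun t => c * t) (t := t) (smoothAt_expCurve v _)
        (logDer_expCurve (G := G) v (c * t)) ((hasDerivAt_id t).const_mul c)
      simpa using this) (by simp)
  exact (congrFun this t).symm

lemma expCurve_zero_left (t : ℝ) : expCurve G (0 : Eu n) t = 1 := by
  have := expCurve_smul (G := G) 0 (0 : Eu n) t
  simpa using this

lemma expCurve_Ad (g : G) (v : Eu n) (t : ℝ) :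
    expCurve G (Ad n g v) t = g * expCurve G v t * g⁻¹ := by
  have hs : ∀ t, SmoothAt n (fun t => g * expCurve G v t) t := fun t =>
    smoothAt_const.mul (smoothAt_expCurve v t)
  have := eq_expCurve (γ := fun t => g * expCurve G v t * g⁻¹) (v := Ad n g v)
    (fun t => (hs t).mul smoothAt_const)
    (fun t => by
      rw [logDer_mul (hs t) smoothAt_const, logDer_const_mul, logDer_expCurve, logDer_const]
      ext1; simp) (by simp)
  exact (congrFun this t).symm

lemma Ad_expCurve_of_lieBr_eq_zero {v w : Eu n} (h : lieBr n G v w = 0) (t : ℝ) :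
    Ad n (expCurve G v t) w = w :=
  Ad_eq_self_of_lieBr_eq_zero (r := |t| + 1) (expCurve_zero v) (fun t _ => smoothAt_expCurve v t)
    (fun t _ => logDer_expCurve v t) h
    (by constructor <;> linarith [neg_abs_le t, le_abs_self t])

lemma expCurve_neg (v : Eu n) (t : ℝ) : expCurve G v (-t) = (expCurve G v t)⁻¹ := by
  rw [eq_inv_iff_mul_eq_one, ← expCurve_add]; simp

/-- The factor exp(tw) fixes v under Ad when the two generators commute, so the product curve has
constant logarithmic derivative v + w. -/
lemma expCurve_add_left {v w : Eu n} (h : lieBr n G w v = 0) (t : ℝ) :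
    expCurve G (v + w) t = expCurve G v t * expCurve G w t := by
  have := eq_expCurve (γ := fun t => expCurve G v t * expCurve G w t) (v := v + w)
    (fun t => (smoothAt_expCurve v t).mul (smoothAt_expCurve w t))
    (fun t => by
      rw [logDer_mul (smoothAt_expCurve v t) (smoothAt_expCurve w t), logDer_expCurve,
        logDer_expCurve, ← expCurve_neg]
      ext1; simp [Ad_expCurve_of_lieBr_eq_zero h]) (by simp)
  exact (congrFun this t).symm

end Exponential

/-! ### Automatic smoothness of continuous one-parameter groups -/

section ContinuousOneParameterGroups

open Set Filter Topology

/-- Differentiability of H ∘ c descends to a merely continuous c when the derivative of H is bounded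
below. That bound gives c(t) - c(0) = O(H(c t) - H(c 0)) = O(t), so the linearization error of H is
o(t) and the derivative of H can be inverted. -/
lemma exists_hasDerivAt_of_comp {n : ℕ} {H : Eu n → Eu n} {c : ℝ → Eu n} {L : Eu n →L[ℝ] Eu n}
    {K : ℝ} (hK : 0 < K) (hH : HasFDerivAt H L (c 0)) (hL : ∀ x, K * ‖x‖ ≤ ‖L x‖)
    (hc : ContinuousAt c 0) (hF : DifferentiableAt ℝ (fun t => H (c t)) 0) :
    ∃ w, HasDerivAt c w 0 := by
  have hinj : Function.Injective (L : Eu n →ₗ[ℝ] Eu n) := by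
    rw [← LinearMap.ker_eq_bot, LinearMap.ker_eq_bot']
    intro x hx
    have h1 := hL x
    rw [show L x = 0 from hx, norm_zero] at h1
    have h2 : ‖x‖ ≤ 0 := by
      by_contra h
      push Not at h
      nlinarith
    exact norm_le_zero_iff.1 h2
  let L' : Eu n ≃L[ℝ] Eu n := (LinearEquiv.ofInjectiveEndo _ hinj).toContinuousLinearEquiv
  have hL' : ∀ x, L' x = L x := fun x => rfl
  have h1 : (fun t => H (c t) - H (c 0) - L (c t - c 0)) =o[𝓝 0] fun t => c t - c 0 :=
    (hasFDerivAt_iff_isLittleO.1 hH).comp_tendsto hc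
  have h2 : (fun t => c t - c 0) =O[𝓝 0] fun t => H (c t) - H (c 0) := by
    refine Asymptotics.IsBigO.of_bound (2 / K) ?_
    filter_upwards [h1.bound (half_pos hK)] with t ht
    have h3 := hL (c t - c 0)
    have h4 := norm_sub_norm_le (L (c t - c 0)) (H (c t) - H (c 0))
    rw [norm_sub_rev] at ht
    rw [div_mul_eq_mul_div, le_div_iff₀ hK]
    linarith
  have h3 : (fun t => H (c t) - H (c 0)) =O[𝓝 0] fun t : ℝ => t - 0 := hF.isBigO_sub
  have h4 := h1.trans_isBigO (h2.trans h3)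
  have h5 := hasDerivAt_iff_isLittleO.1 hF.hasDerivAt
  have h6 : HasDerivAt (fun t => L' (c t)) (deriv (fun t => H (c t)) 0) 0 := by
    rw [hasDerivAt_iff_isLittleO]
    refine (h5.sub h4).congr_left fun t => ?_
    rw [hL', hL', map_sub]
    abel
  refine ⟨L'.symm (deriv (fun t => H (c t)) 0), ?_⟩
  have h7 := (L'.symm : Eu n →L[ℝ] Eu n).hasFDerivAt.comp_hasDerivAt 0 h6
  refine h7.congr_of_eventuallyEq (Eventually.of_forall fun t => ?_)
  simp

variable {n : ℕ} {G : Type*} [Group G] [TopologicalSpace G]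
  [ChartedSpace (EuclideanSpace ℝ (Fin n)) G] [LieGroup (𝓡 n) ∞ G]

/-- The multiplication in the chart centred at the identity. -/
def lieMul (n : ℕ) (G : Type*) [Group G] [TopologicalSpace G]
    [ChartedSpace (EuclideanSpace ℝ (Fin n)) G] (p : Eu n × Eu n) : Eu n :=
  lieChart n (lieParam n G p.1 * lieParam n G p.2)

lemma contDiffAt_lieMul : ContDiffAt ℝ ∞ (lieMul n G) (lieOrigin n G, lieOrigin n G) :=
  contDiffAt_lieChart_mul_lieParam lieOrigin_mem

lemma fderiv_lieMul_comp_inl :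
    (fderiv ℝ (lieMul n G) (lieOrigin n G, lieOrigin n G)).comp
      (ContinuousLinearMap.inl ℝ (Eu n) (Eu n)) = ContinuousLinearMap.id ℝ (Eu n) := by
  have h1 := ((contDiffAt_lieMul (n := n) (G := G)).differentiableAt (by simp)).hasFDerivAt
  have h2 := HasFDerivAt.comp (g := lieMul n G) (f := fun y => (y, lieOrigin n G)) (lieOrigin n G) h1
    (hasFDerivAt_prodMk_left _ _)
  have h3 : HasFDerivAt (fun y : Eu n => y) _ (lieOrigin n G) := h2.congr_of_eventuallyEq (by
    filter_upwards [isOpen_lieTarget.mem_nhds lieOrigin_mem] with y hy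
    simp [lieMul, lieChart_lieParam hy])
  exact h3.unique (hasFDerivAt_id _)

set_option maxHeartbeats 1000000 in
/-- Continuous one-parameter groups in a Lie group are differentiable at the origin. -/
lemma exists_hasDerivAt_lieChart {ρ : ℝ → G} (hc : Continuous ρ)
    (hρ : ∀ s t, ρ (s + t) = ρ s * ρ t) : ∃ w, HasDerivAt (fun t => lieChart n (ρ t)) w 0 := by
  have hρ0 : ρ 0 = 1 := by
    have := hρ 0 0
    rw [add_zero] at this
    exact left_eq_mul.1 this
  set e := lieOrigin n G with he
  set D : Eu n × Eu n → (Eu n →L[ℝ] Eu n) := fun p =>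
    (fderiv ℝ (lieMul n G) p).comp (ContinuousLinearMap.inl ℝ (Eu n) (Eu n)) with hD
  have hDc : ContinuousAt D (e, e) := by
    have := ((contDiffAt_lieMul (n := n) (G := G)).fderiv_right (m := 1) (by norm_cast)).continuousAt
    exact this.clm_comp continuousAt_const
  have hDn : ∀ᶠ p in 𝓝 (e, e), ‖D p - ContinuousLinearMap.id ℝ (Eu n)‖ < 1 / 2 := by
    refine eventually_norm_lt (hDc.sub continuousAt_const) ?_
    change ‖D (e, e) - _‖ < _
    rw [show D (e, e) = _ from fderiv_lieMul_comp_inl, sub_self, norm_zero]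
    norm_num
  have hm1 : ∀ᶠ p in 𝓝 (e, e), ContDiffAt ℝ 2 (lieMul n G) p :=
    ((contDiffAt_lieMul (n := n) (G := G)).of_le
      (WithTop.coe_le_coe.2 (le_top : (2 : ℕ∞) ≤ ⊤))).eventually (by simp)
  obtain ⟨R, hR, hball⟩ := Metric.eventually_nhds_iff_ball.1 (hDn.and hm1)
  have hballp : ∀ y ∈ Metric.ball e R, ∀ z ∈ Metric.ball e R, (y, z) ∈ Metric.ball (e, e) R := by
    intro y hy z hz
    rw [Metric.mem_ball, Prod.dist_eq]
    exact max_lt hy hz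
  have hs : ∀ᶠ t in 𝓝 (0 : ℝ), ρ t ∈ lieSource n G ∧ lieChart n (ρ t) ∈ Metric.ball e R := by
    have h1 : ∀ᶠ t in 𝓝 (0 : ℝ), ρ t ∈ lieSource n G :=
      hc.continuousAt.preimage_mem_nhds (isOpen_lieSource.mem_nhds (hρ0 ▸ one_mem_lieSource))
    have h2 : ContinuousAt (fun t => lieChart n (ρ t)) 0 := by
      refine ContinuousAt.comp (g := lieChart n) ?_ hc.continuousAt
      rw [hρ0]
      exact continuousAt_extChartAt (I := 𝓡 n) (1 : G)
    refine h1.and (h2.preimage_mem_nhds ?_)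
    rw [hρ0]
    exact Metric.ball_mem_nhds _ hR
  obtain ⟨δ, hδ, hδs⟩ := Metric.eventually_nhds_iff.1 hs
  simp only [dist_zero_right, Real.norm_eq_abs] at hδs
  set ε := δ / 4 with hε
  have hε0 : 0 < ε := by positivity
  -- Clamping the time keeps the curve in the chart and continuous on all of ℝ, without changing it
  -- on [-2ε, 2ε].
  set cl : ℝ → ℝ := fun s => max (-(2 * ε)) (min s (2 * ε)) with hcl
  have hcl1 : ∀ s, |cl s| < δ := by
    intro s
    have h1 : -(2 * ε) ≤ cl s := le_max_left _ _
    have h2 : cl s ≤ 2 * ε := max_le (by linarith) (min_le_right _ _)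
    rw [abs_lt]
    constructor <;> linarith
  have hcl2 : ∀ s, |s| ≤ 2 * ε → cl s = s := by
    intro s h
    rw [abs_le] at h
    simp only [cl]
    rw [min_eq_left h.2, max_eq_right h.1]
  set c : ℝ → Eu n := fun s => lieChart n (ρ (cl s)) with hcdef
  have hcc : Continuous c := by
    refine (continuousOn_extChartAt (I := 𝓡 n) (1 : G)).comp_continuous (f := fun s => ρ (cl s)) ?_
      (fun s => (hδs (hcl1 s)).1)
    exact hc.comp (by fun_prop)
  have hcb : ∀ s, c s ∈ Metric.ball e R := fun s => (hδs (hcl1 s)).2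
  have hc0 : c 0 = e := by
    simp only [c]
    rw [hcl2 0 (by simp [hε0.le]), hρ0]; rfl
  have hmul : ∀ t s, |t| ≤ ε → |s| ≤ ε → lieMul n G (c t, c s) = c (t + s) := by
    intro t s ht hs'
    have h1 : |t + s| ≤ 2 * ε := (abs_add_le _ _).trans (by linarith)
    simp only [lieMul, c]
    rw [lieParam_lieChart (hδs (hcl1 t)).1, lieParam_lieChart (hδs (hcl1 s)).1, ← hρ,
      hcl2 t (by linarith), hcl2 s (by linarith), hcl2 _ h1]
  -- Smoothing by averaging: H(c t) = ∫ m(c t, c s) ds = ∫ c over [t, t + ε] is differentiable in t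
  -- by the fundamental theorem of calculus, although c is only continuous.
  set H : Eu n → Eu n := fun y => ∫ s in (0 : ℝ)..ε, lieMul n G (y, c s) with hH
  have hDcont : ∀ y ∈ Metric.ball e R, Continuous fun s => D (y, c s) := by
    intro y hy
    rw [continuous_iff_continuousAt]
    intro s
    have h1 : ContinuousAt (fderiv ℝ (lieMul n G)) (y, c s) :=
      ((hball _ (hballp y hy _ (hcb s))).2.fderiv_right (m := 1) (by norm_num)).continuousAt
    have h2 : ContinuousAt (fun s => (y, c s)) s := continuousAt_const.prodMk hcc.continuousAt
    exact (ContinuousAt.comp (g := fderiv ℝ (lieMul n G)) (f := fun s => (y, c s)) h1 h2).clm_comp continuousAt_const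
  have hmcont : ∀ y ∈ Metric.ball e R, Continuous fun s => lieMul n G (y, c s) := by
    intro y hy
    rw [continuous_iff_continuousAt]
    intro s
    have h1 : ContinuousAt (lieMul n G) (y, c s) :=
      (hball _ (hballp y hy _ (hcb s))).2.continuousAt
    have h2 : ContinuousAt (fun s => (y, c s)) s := continuousAt_const.prodMk hcc.continuousAt
    exact ContinuousAt.comp (g := lieMul n G) (f := fun s => (y, c s)) h1 h2
  have heR : e ∈ Metric.ball e R := Metric.mem_ball_self hR
  have hHd : HasFDerivAt H (∫ s in (0 : ℝ)..ε, D (e, c s)) e := by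
    refine intervalIntegral.hasFDerivAt_integral_of_dominated_of_fderiv_le
      (F := fun y s => lieMul n G (y, c s)) (F' := fun y s => D (y, c s)) (bound := fun _ => 3 / 2)
      (s := Metric.ball e R) (Metric.ball_mem_nhds _ hR) ?_ ?_ ?_ ?_ ?_ ?_
    · filter_upwards [Metric.ball_mem_nhds e hR] with y hy
      exact (hmcont y hy).aestronglyMeasurable
    · exact (hmcont e heR).intervalIntegrable _ _
    · exact (hDcont e heR).aestronglyMeasurable
    · refine Eventually.of_forall fun s _ y hy => ?_
      have h1 := (hball _ (hballp y hy _ (hcb s))).1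
      have h2 : ‖ContinuousLinearMap.id ℝ (Eu n)‖ ≤ 1 := ContinuousLinearMap.norm_id_le
      calc ‖D (y, c s)‖ = ‖(D (y, c s) - ContinuousLinearMap.id ℝ (Eu n)) +
            ContinuousLinearMap.id ℝ (Eu n)‖ := by rw [sub_add_cancel]
        _ ≤ 1 / 2 + 1 := (norm_add_le _ _).trans (add_le_add h1.le h2)
        _ = 3 / 2 := by norm_num
    · exact intervalIntegrable_const
    · refine Eventually.of_forall fun s _ y hy => ?_
      have h1 := ((hball _ (hballp y hy _ (hcb s))).2.differentiableAt (by simp)).hasFDerivAt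
      exact HasFDerivAt.comp (g := lieMul n G) (f := fun y => (y, c s)) y h1
        (hasFDerivAt_prodMk_left _ _)
  -- The integrand is within 1/2 of the identity, so the derivative of H is within ε/2 of ε times
  -- the identity.
  have hLb : ∀ x, (ε / 2) * ‖x‖ ≤ ‖(∫ s in (0 : ℝ)..ε, D (e, c s)) x‖ := by
    intro x
    have h1 : ‖∫ s in (0 : ℝ)..ε, (D (e, c s) - ContinuousLinearMap.id ℝ (Eu n))‖ ≤
        1 / 2 * |ε - 0| := intervalIntegral.norm_integral_le_of_norm_le_const fun s _ =>
      (hball _ (hballp e heR _ (hcb s))).1.le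
    rw [intervalIntegral.integral_sub ((hDcont e heR).intervalIntegrable _ _)
      intervalIntegrable_const, intervalIntegral.integral_const, sub_zero, abs_of_pos hε0] at h1
    have h2 := (ContinuousLinearMap.le_of_opNorm_le _ h1 x)
    simp only [sub_apply, smul_apply, ContinuousLinearMap.id_apply] at h2
    have h3 := norm_sub_norm_le (ε • x) ((∫ s in (0 : ℝ)..ε, D (e, c s)) x)
    rw [norm_sub_rev, norm_smul, Real.norm_of_nonneg hε0.le] at h3
    linarith
  have hF : DifferentiableAt ℝ (fun t => H (c t)) 0 := by
    have h1 : DifferentiableAt ℝ (fun t => ∫ s in t..(t + ε), c s) 0 := by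
      have h2 : (fun t => ∫ s in t..(t + ε), c s) =
          fun t => (∫ s in (0 : ℝ)..(t + ε), c s) - ∫ s in (0 : ℝ)..t, c s := by
        funext t
        rw [intervalIntegral.integral_interval_sub_left] <;> exact hcc.intervalIntegrable _ _
      rw [h2]
      have h3 := (hcc.integral_hasStrictDerivAt 0 (0 + ε)).hasDerivAt
      have h4 := (hcc.integral_hasStrictDerivAt 0 0).hasDerivAt
      have h5 : HasDerivAt (fun t : ℝ => t + ε) 1 0 := (hasDerivAt_id 0).add_const ε
      exact ((HasDerivAt.scomp 0 h3 h5).sub h4).differentiableAt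
    refine h1.congr_of_eventuallyEq ?_
    filter_upwards [Metric.ball_mem_nhds (0 : ℝ) hε0] with t ht
    have ht' : |t| < ε := by simpa using ht
    simp only [H]
    have h3 : ∫ s in (0 : ℝ)..ε, lieMul n G (c t, c s) = ∫ s in (0 : ℝ)..ε, c (t + s) := by
      refine intervalIntegral.integral_congr fun s hs => ?_
      rw [uIcc_of_le hε0.le] at hs
      exact hmul t s ht'.le (by rw [abs_of_nonneg hs.1]; exact hs.2)
    rw [h3, intervalIntegral.integral_comp_add_left, add_zero]
  obtain ⟨w, hw⟩ := exists_hasDerivAt_of_comp (half_pos hε0) (hc0 ▸ hHd) hLb hcc.continuousAt hF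
  refine ⟨w, hw.congr_of_eventuallyEq ?_⟩
  filter_upwards [Metric.ball_mem_nhds (0 : ℝ) hε0] with t ht
  have ht' : |t| < ε := by simpa using ht
  simp only [c]
  rw [hcl2 t (by linarith)]

/-- Continuous one-parameter groups in a Lie group are smooth. -/
theorem exists_eq_expCurve {ρ : ℝ → G} (hc : Continuous ρ)
    (hρ : ∀ s t, ρ (s + t) = ρ s * ρ t) : ∃ v : Eu n, ρ = expCurve G v := by
  have hρ0 : ρ 0 = 1 := by
    have := hρ 0 0
    rw [add_zero] at this
    exact left_eq_mul.1 this
  obtain ⟨w, hw⟩ := exists_hasDerivAt_lieChart (n := n) hc hρ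
  set c : ℝ → Eu n := fun t => lieChart n (ρ t) with hcdef
  have hs : IsOpen {t | ρ t ∈ lieSource n G} := isOpen_lieSource.preimage hc
  have h0s : (0 : ℝ) ∈ {t | ρ t ∈ lieSource n G} := by
    change ρ 0 ∈ lieSource n G
    rw [hρ0]; exact one_mem_lieSource
  have hc0 : c 0 = lieOrigin n G := by simp only [c, hρ0]; rfl
  -- The homomorphism property moves the derivative at 0 to every t, so the coordinates solve an ODE
  -- with smooth right-hand side and are smooth by bootstrapping.
  have hd : ∀ t ∈ {t | ρ t ∈ lieSource n G},
      HasFDerivAt c ((fun p : ℝ × Eu n => spanL (leftField n G p.2 w)) (t, c t)) t := by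
    intro t ht
    have h1 : HasFDerivAt (fun z => lieChart n (lieParam n G (c t) * lieParam n G z))
        (leftField n G (c t)) (c 0) := by
      rw [hc0]
      have h2 : SmoothAt n (fun z => lieParam n G (c t) * lieParam n G z) (lieOrigin n G) :=
        smoothAt_const.mul (smoothAt_lieParam lieOrigin_mem)
      exact ((h2.lieChart_comp (by simpa using lieParam_mem (lieChart_mem ht))).differentiableAt
        (by simp)).hasFDerivAt
    have h2 := h1.comp_hasDerivAt 0 hw
    have h3 : HasDerivAt (fun s => c (t + s)) (leftField n G (c t) w) 0 := by
      refine h2.congr_of_eventuallyEq ?_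
      filter_upwards [hs.mem_nhds h0s] with s hs'
      simp only [Function.comp, c]
      rw [lieParam_lieChart ht, lieParam_lieChart hs', hρ]
    have h4 : HasDerivAt (fun s => s - t) 1 t := (hasDerivAt_id t).sub_const t
    have h5 := HasDerivAt.scomp (h := fun s => s - t) t (by simpa using h3) h4
    have h6 : HasDerivAt c (leftField n G (c t) w) t := by
      simpa [Function.comp_def] using h5
    exact h6.hasFDerivAt
  have hcs : ContDiffOn ℝ ∞ c {t | ρ t ∈ lieSource n G} := by
    refine contDiffOn_of_hasFDerivAt (Ψ := fun p : ℝ × Eu n => spanL (leftField n G p.2 w)) hs hd fun t ht => ?_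
    have h1 : ContDiffAt ℝ ∞ (fun p : ℝ × Eu n => leftField n G p.2 w) (t, c t) :=
      (((contDiffAt_leftField (lieChart_mem ht)).comp (t, c t) contDiffAt_snd)).clm_apply
        contDiffAt_const
    exact (ContinuousLinearMap.toSpanSingletonCLE (𝕜 := ℝ) (E := Eu n)).contDiff.contDiffAt.comp
      (t, c t) h1
  have hsm0 : SmoothAt n ρ 0 := by
    have h1 : SmoothAt n (fun t => lieParam n G (c t)) 0 :=
      smoothAt_lieParam_comp (hcs.contDiffAt (hs.mem_nhds h0s)) (hc0 ▸ lieOrigin_mem)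
    refine ContMDiffAt.congr_of_eventuallyEq h1 ?_
    filter_upwards [hs.mem_nhds h0s] with t ht
    exact (lieParam_lieChart ht).symm
  have hshift : ∀ t, ρ = fun s => ρ t * ρ (s - t) := by
    intro t; funext s
    rw [← hρ]; simp
  have hsm0' : ∀ t, SmoothAt n (fun s => ρ (s - t)) t := fun t => by
    have h1 : ContDiffAt ℝ ∞ (fun s : ℝ => s - t) t := by fun_prop
    exact SmoothAt.comp (u := fun s => s - t) (by simpa using hsm0) h1
  have hsm : ∀ t, SmoothAt n ρ t := fun t => by
    rw [hshift t]
    exact smoothAt_const.mul (hsm0' t)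
  refine ⟨logDer n ρ 0 1, eq_expCurve hsm (fun t => ?_) hρ0⟩
  have h1 : logDer n ρ t = logDer n (fun s => ρ (s - t)) t := by
    conv_lhs => rw [hshift t]
    rw [logDer_const_mul]
  rw [h1]
  have h2 := logDer_real_comp (γ := ρ) (u := fun s => s - t) (u' := 1) (t := t)
    (v := logDer n ρ 0 1) (hsm _) (by ext1; simp) ((hasDerivAt_id t).sub_const t)
  simpa using h2

end ContinuousOneParameterGroups

/-! ### Homomorphisms from the circle and their generators -/

section CircleHomomorphisms

open Set Filter Topology

variable {n : ℕ} {G : Type*} [Group G] [TopologicalSpace G]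
  [ChartedSpace (EuclideanSpace ℝ (Fin n)) G] [LieGroup (𝓡 n) ∞ G]

/-- The generator of a homomorphism from the circle, as a vector. -/
def genVec (n : ℕ) {G : Type*} [Group G] [TopologicalSpace G]
    [ChartedSpace (EuclideanSpace ℝ (Fin n)) G] (ρ : Circle →ₜ* G) : Eu n :=
  lieCoord (generator n ρ)

lemma genVec_eq {ρ : Circle →ₜ* G} {v : Eu n}
    (h : ∀ t : ℝ, ρ (Circle.exp (2 * Real.pi * t)) = expCurve G v t) : genVec n ρ = v := by
  have h1 : (fun t : ℝ => ρ (Circle.exp (2 * Real.pi * t))) = expCurve G v := funext h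
  have h2 := logDer_eq_mfderiv (smoothAt_expCurve (G := G) v 0) (1 : ℝ)
  have h3 : (fun y => (expCurve G v 0)⁻¹ * expCurve G v y) = expCurve G v := by
    funext y; simp
  rw [logDer_expCurve, h3, show spanL v (1 : ℝ) = v by simp [spanL]] at h2
  rw [genVec, generator, h1]
  exact h2.symm

/-- Along t ↦ e^{2πit} a homomorphism is a continuous one-parameter group of the line, hence an
exponential; its velocity at 0 is the generator. -/
lemma map_circleExp (ρ : Circle →ₜ* G) (t : ℝ) :
    ρ (Circle.exp (2 * Real.pi * t)) = expCurve G (genVec n ρ) t := by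
  obtain ⟨v, hv⟩ := exists_eq_expCurve (n := n) (ρ := fun t : ℝ => ρ (Circle.exp (2 * Real.pi * t)))
    (by fun_prop) (fun s t => by rw [mul_add, Circle.exp_add, map_mul])
  rw [genVec_eq (congrFun hv)]
  exact congrFun hv t

lemma map_circleExp' (ρ : Circle →ₜ* G) (t : ℝ) :
    ρ (Circle.exp t) = expCurve G ((2 * Real.pi)⁻¹ • genVec n ρ) t := by
  rw [expCurve_smul, ← map_circleExp]
  congr 2
  field_simp

lemma expCurve_genVec_one (ρ : Circle →ₜ* G) : expCurve G (genVec n ρ) 1 = 1 := by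
  rw [← map_circleExp]; simp

lemma expCurve_int {v : Eu n} (h : expCurve G v 1 = 1) (m : ℤ) : expCurve G v m = 1 := by
  have hn : ∀ k : ℕ, expCurve G v k = 1 := by
    intro k
    induction k with
    | zero => simp
    | succ k ih => rw [Nat.cast_succ, expCurve_add, ih, h, one_mul]
  rcases Int.eq_nat_or_neg m with ⟨k, rfl | rfl⟩
  · exact_mod_cast hn k
  · have := hn k
    push_cast
    rw [expCurve_neg, this, inv_one]

lemma circleExp_surjective (z : Circle) : ∃ t : ℝ, Circle.exp (2 * Real.pi * t) = z :=
  ⟨Complex.arg z / (2 * Real.pi), by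
    rw [mul_div_cancel₀ _ (by positivity)]; exact Circle.exp_arg z⟩

/-- If exp(v) = 1, then t ↦ exp(tv) is constant on the fibres of the quotient map ℝ → U(1) and
descends to a continuous homomorphism. -/
theorem exists_circleHom {v : Eu n} (h : expCurve G v 1 = 1) :
    ∃ ρ : Circle →ₜ* G, genVec n ρ = v := by
  have hexp : ∀ s t : ℝ, Circle.exp (2 * Real.pi * s) = Circle.exp (2 * Real.pi * t) →
      expCurve G v s = expCurve G v t := by
    intro s t hst
    obtain ⟨m, hm⟩ := Circle.exp_eq_exp.1 hst
    have : s = t + m := by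
      have hpi : (2 * Real.pi) ≠ 0 := by positivity
      refine mul_left_cancel₀ hpi ?_
      rw [hm]; ring
    rw [this, expCurve_add, expCurve_int h, mul_one]
  choose τ hτ using circleExp_surjective
  have hcomp : ∀ t : ℝ, expCurve G v (τ (Circle.exp (2 * Real.pi * t))) = expCurve G v t :=
    fun t => hexp _ _ (hτ _)
  have hquot : IsQuotientMap Circle.exp := isLocalHomeomorph_circleExp.isOpenMap.isQuotientMap
    Circle.exp.continuous fun z => ⟨_, Circle.exp_arg z⟩
  have hcont : Continuous fun z => expCurve G v (τ z) := by
    rw [hquot.continuous_iff]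
    have h1 : (fun z => expCurve G v (τ z)) ∘ Circle.exp =
        fun t => expCurve G v ((2 * Real.pi)⁻¹ * t) := by
      funext t
      have := hcomp ((2 * Real.pi)⁻¹ * t)
      rw [mul_inv_cancel_left₀ (by positivity)] at this
      exact this
    rw [h1]
    have h2 : Continuous (expCurve G v) := continuous_iff_continuousAt.2 fun t =>
      (smoothAt_expCurve v t).continuousAt
    exact h2.comp (by fun_prop)
  let ρ : Circle →ₜ* G :=
    { toFun := fun z => expCurve G v (τ z)
      map_one' := by
        have := hcomp 0
        simpa using this
      map_mul' := fun z w => by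
        rw [← expCurve_add]
        refine hexp _ _ ?_
        rw [hτ, mul_add, Circle.exp_add, hτ, hτ]
      continuous_toFun := hcont }
  exact ⟨ρ, genVec_eq hcomp⟩

lemma genVec_conj {ρ ρ' : Circle →ₜ* G} {g : G} :
    (∀ z, ρ z = g * ρ' z * g⁻¹) ↔ genVec n ρ = Ad n g (genVec n ρ') := by
  constructor
  · intro h
    refine genVec_eq fun t => ?_
    rw [h, map_circleExp (n := n), expCurve_Ad]
  · intro h z
    obtain ⟨t, rfl⟩ := circleExp_surjective z
    rw [map_circleExp (n := n), h, expCurve_Ad, map_circleExp (n := n)]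

/-- This replaces Hom(U(1), G)/G by adjoint orbits of generators throughout. -/
lemma homMk_eq_iff {ρ ρ' : Circle →ₜ* G} :
    (Quotient.mk (homConj G) ρ = Quotient.mk (homConj G) ρ') ↔
      ∃ g : G, genVec n ρ = Ad n g (genVec n ρ') := by
  rw [Quotient.eq]
  exact exists_congr fun g => genVec_conj

end CircleHomomorphisms

/-! ### Geodesics of bi-invariant metrics -/

section BiinvariantMetrics

open Set Filter Topology

variable {n : ℕ} {G : Type*} [Group G] [TopologicalSpace G]
  [ChartedSpace (EuclideanSpace ℝ (Fin n)) G] [LieGroup (𝓡 n) ∞ G]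

/-- The adjoint action in terms of its coordinate expression. -/
lemma lieCoord_adjointAction (g : G) (ξ : GroupLieAlgebra (𝓡 n) G) :
    lieCoord (adjointAction n g ξ) = Ad n g (lieCoord ξ) := by
  have hs : ContMDiffAt (𝓡 n) (𝓡 n) ∞ (fun x : G => g * x * g⁻¹) 1 :=
    (contMDiffAt_const.mul contMDiffAt_id).mul contMDiffAt_const
  have hd : MDifferentiableAt (𝓡 n) (𝓡 n) (fun x : G => g * x * g⁻¹) 1 :=
    hs.mdifferentiableAt (by simp)
  refine (congrArg (fun L : Eu n →L[ℝ] Eu n => L ξ) hd.mfderiv).trans ?_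
  simp only [writtenInExtChartAt, modelWithCornersSelf_coe, Set.range_id, fderivWithin_univ]
  -- The target chart is centred at g · 1 · g⁻¹, which equals 1 only propositionally; hence the
  -- centre is generalized before substituting.
  have h1 : ∀ q : G, q = 1 → (fderiv ℝ (extChartAt (𝓡 n) q ∘ (fun x => g * x * g⁻¹) ∘
      (extChartAt (𝓡 n) (1 : G)).symm) (extChartAt (𝓡 n) (1 : G) 1) : Eu n →L[ℝ] Eu n) =
        Ad n g := by
    rintro q rfl; rfl
  exact congrArg (fun L : Eu n →L[ℝ] Eu n => L ξ) (h1 (g * 1 * g⁻¹) (by simp))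

/-- The inner product of a Riemannian metric at the identity. -/
def innerOne (k : LieRiemannianMetric n G) : Eu n →L[ℝ] Eu n →L[ℝ] ℝ := k.inner (1 : G)

lemma innerOne_comm (k : LieRiemannianMetric n G) (u v : Eu n) :
    innerOne k u v = innerOne k v u := k.symm (1 : G) u v

lemma innerOne_self_eq_zero (k : LieRiemannianMetric n G) {u : Eu n} (h : innerOne k u u = 0) :
    u = 0 := by
  by_contra hu
  exact (k.pos (1 : G) u hu).ne' h

lemma inner_eq_innerOne (k : LieRiemannianMetric n G) {b : G} (hb : b = 1) (u v : Eu n) :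
    (k.inner b : Eu n →L[ℝ] Eu n →L[ℝ] ℝ) u v = innerOne k u v := by
  subst hb; rfl

/-- Conjugation is a left translation followed by a right translation, and both are isometries. -/
lemma innerOne_Ad {k : LieRiemannianMetric n G} (hk : IsBiinvariant k) (g : G) (u v : Eu n) :
    innerOne k (Ad n g u) (Ad n g v) = innerOne k u v := by
  have h1 := hk.1 g 1 u v
  have h2 := hk.2 g⁻¹ (g * 1) (mfderiv (𝓡 n) (𝓡 n) (fun y => g * y) 1 u)
    (mfderiv (𝓡 n) (𝓡 n) (fun y => g * y) 1 v)
  rw [h1] at h2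
  have hl : MDifferentiableAt (𝓡 n) (𝓡 n) (fun y : G => g * y) 1 :=
    ((contMDiff_mul_left (I := 𝓡 n) (n := ∞) (a := g)) 1).mdifferentiableAt (by simp)
  have hr : MDifferentiableAt (𝓡 n) (𝓡 n) (fun y : G => y * g⁻¹) (g * 1) :=
    ((contMDiff_mul_right (I := 𝓡 n) (n := ∞) (a := g⁻¹)) (g * 1)).mdifferentiableAt (by simp)
  have h3 : ∀ w : Eu n, Ad n g w = (mfderiv (𝓡 n) (𝓡 n) (fun y : G => y * g⁻¹) (g * 1)
      (mfderiv (𝓡 n) (𝓡 n) (fun y => g * y) 1 w) : Eu n) := by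
    intro w
    refine (lieCoord_adjointAction g w).symm.trans ?_
    exact congrArg (fun L : Eu n →L[ℝ] Eu n => L w) (mfderiv_comp (1 : G) hr hl)
  rw [h3, h3]
  refine Eq.trans ?_ h2
  exact (inner_eq_innerOne k (by simp) _ _).symm

/-- Differentiate the Ad-invariance of the inner product along exp(tw): ad w is skew. -/
lemma innerOne_lieBr {k : LieRiemannianMetric n G} (hk : IsBiinvariant k) (w u v : Eu n) :
    innerOne k (lieBr n G w u) v + innerOne k u (lieBr n G w v) = 0 := by
  have h1 : ∀ u : Eu n, HasDerivAt (fun t => Ad n (expCurve G w t) u) (lieBr n G w u) 0 := by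
    intro u
    have := (hasFDerivAt_Ad_apply (smoothAt_expCurve (G := G) w 0)
      (hasFDerivAt_const u 0)).hasDerivAt
    simpa [logDer_expCurve, lieBr_eq_lieBrL, Ad_one] using this
  have h2 : HasDerivAt (fun t => innerOne k (Ad n (expCurve G w t) u) (Ad n (expCurve G w t) v))
      (innerOne k u (lieBr n G w v) + innerOne k (lieBr n G w u) v) 0 := by
    have := (innerOne k).hasFDerivAt_of_bilinear (h1 u).hasFDerivAt (h1 v).hasFDerivAt
    simpa [Ad_one] using this.hasDerivAt
  have h3 := h2.unique ((hasDerivAt_const (0 : ℝ) (innerOne k u v)).congr_of_eventuallyEq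
    (Eventually.of_forall fun t => innerOne_Ad hk _ u v))
  rw [add_comm]; exact h3

/-- Left invariance carries the inner product back to 1, so the coefficients of the metric in any
chart are those of the Maurer-Cartan form. -/
lemma coordMetric_eq {k : LieRiemannianMetric n G} (hk : IsBiinvariant k) {p : G} {y : Eu n}
    (hy : y ∈ (extChartAt (𝓡 n) p).target) (u v : Eu n) :
    coordMetric k p y u v = innerOne k (logDer n (extChartAt (𝓡 n) p).symm y u)
      (logDer n (extChartAt (𝓡 n) p).symm y v) := by
  set σ : Eu n → G := fun y => (extChartAt (𝓡 n) p).symm y with hσ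
  have hs : SmoothAt n σ y := (contMDiffOn_extChartAt_symm p).contMDiffAt
    ((isOpen_extChartAt_target p).mem_nhds hy)
  have hl : MDifferentiableAt (𝓡 n) (𝓡 n) (fun z : G => (σ y)⁻¹ * z) (σ y) :=
    ((contMDiff_mul_left (I := 𝓡 n) (n := ∞) (a := (σ y)⁻¹)) (σ y)).mdifferentiableAt (by simp)
  have h1 : ∀ u : Eu n, logDer n σ y u = (mfderiv (𝓡 n) (𝓡 n) (fun z : G => (σ y)⁻¹ * z) (σ y)
      (mfderiv 𝓘(ℝ, Eu n) (𝓡 n) σ y u) : Eu n) := by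
    intro u
    rw [logDer_eq_mfderiv hs]
    exact congrArg (fun L : Eu n →L[ℝ] Eu n => L u)
      (mfderiv_comp y hl (hs.mdifferentiableAt (by simp)))
  rw [h1, h1]
  refine (hk.1 (σ y)⁻¹ (σ y) _ _).symm.trans ?_
  exact inner_eq_innerOne k (by simp) _ _

/-- The map z ↦ p · z has logarithmic derivative the identity and factors through the chart at p.
Hence coordinate vectors translated to 1 exhaust the Lie algebra, which supplies test vectors for
the geodesic equation. -/
lemma logDer_extChartAt_symm_surjective (p : G) (w : Eu n) :
    ∃ v, logDer n (extChartAt (𝓡 n) p).symm (extChartAt (𝓡 n) p p) v = w := by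
  set f : Eu n → G := fun z => p * lieParam n G z with hf
  have hfs : SmoothAt n f (lieOrigin n G) := smoothAt_const.mul (smoothAt_lieParam lieOrigin_mem)
  have hf0 : f (lieOrigin n G) = p := by simp [f]
  set u : Eu n → Eu n := fun z => extChartAt (𝓡 n) p (f z) with hu
  have hch : ContMDiffAt (𝓡 n) 𝓘(ℝ, Eu n) ∞ (extChartAt (𝓡 n) p) (f (lieOrigin n G)) := by
    rw [hf0]; exact contMDiffAt_extChartAt
  have hud : DifferentiableAt ℝ u (lieOrigin n G) :=
    (ContMDiffAt.comp (lieOrigin n G) hch hfs).contDiffAt.differentiableAt (by simp)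
  have hu0 : u (lieOrigin n G) = extChartAt (𝓡 n) p p := by simp only [u, hf0]
  have hs : SmoothAt n (extChartAt (𝓡 n) p).symm (u (lieOrigin n G)) := by
    rw [hu0]
    exact (contMDiffOn_extChartAt_symm p).contMDiffAt
      ((isOpen_extChartAt_target p).mem_nhds (mem_extChartAt_target p))
  have h1 := logDer_comp (n := n) hs hud
  have h2 : (fun z => (extChartAt (𝓡 n) p).symm (u z)) =ᶠ[𝓝 (lieOrigin n G)] f := by
    have : ∀ᶠ z in 𝓝 (lieOrigin n G), f z ∈ (extChartAt (𝓡 n) p).source :=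
      hfs.continuousAt.preimage_mem_nhds (by rw [hf0]; exact extChartAt_source_mem_nhds p)
    filter_upwards [this] with z hz
    exact (extChartAt (𝓡 n) p).left_inv hz
  rw [logDer_congr h2, hf, logDer_const_mul, logDer_lieParam_lieOrigin, hu0] at h1
  exact ⟨fderiv ℝ u (lieOrigin n G) w, (congrArg (fun L : Eu n →L[ℝ] Eu n => L w) h1).symm⟩

/-- For a bi-invariant metric, the geodesic equation says that the velocity, translated to the
identity, is constant. -/
lemma geodesic_equation_iff {k : LieRiemannianMetric n G} (hk : IsBiinvariant k) {γ : ℝ → G}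
    (hγ : ∀ t, SmoothAt n γ t) (t₀ : ℝ) :
    (∀ v : Eu n,
      let c : ℝ → EuclideanSpace ℝ (Fin n) := fun t => extChartAt (𝓡 n) (γ t₀) (γ t)
      deriv (fun t => coordMetric k (γ t₀) (c t) (deriv c t) v) t₀ =
        (1 / 2) * fderiv ℝ (fun y => coordMetric k (γ t₀) y (deriv c t₀) (deriv c t₀)) (c t₀) v) ↔
    HasDerivAt (fun t => logDer n γ t 1) 0 t₀ := by
  set p := γ t₀ with hp
  set σ : Eu n → G := fun y => (extChartAt (𝓡 n) p).symm y with hσ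
  set c : ℝ → Eu n := fun t => extChartAt (𝓡 n) p (γ t) with hc
  set Θ := logDer n σ with hΘ
  set β : ℝ → Eu n := fun t => logDer n γ t 1 with hβ
  have hsrc : ∀ᶠ t in 𝓝 t₀, γ t ∈ (extChartAt (𝓡 n) p).source :=
    (hγ t₀).continuousAt.preimage_mem_nhds (extChartAt_source_mem_nhds p)
  have hcs : ∀ t, γ t ∈ (extChartAt (𝓡 n) p).source → ContDiffAt ℝ ∞ c t := fun t ht =>
    (ContMDiffAt.comp t (contMDiffAt_extChartAt' (by simpa using ht)) (hγ t)).contDiffAt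
  have hσs : ∀ y ∈ (extChartAt (𝓡 n) p).target, SmoothAt n σ y := fun y hy =>
    (contMDiffOn_extChartAt_symm p).contMDiffAt ((isOpen_extChartAt_target p).mem_nhds hy)
  have hct : ∀ t, γ t ∈ (extChartAt (𝓡 n) p).source → c t ∈ (extChartAt (𝓡 n) p).target :=
    fun t ht => (extChartAt (𝓡 n) p).map_source ht
  have hsrc' := hsrc.eventually_nhds
  have hβΘ : ∀ᶠ t in 𝓝 t₀, β t = Θ (c t) (deriv c t) := by
    filter_upwards [hsrc'] with t ht
    have h1 := logDer_comp (n := n) (hσs _ (hct t ht.self_of_nhds))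
      ((hcs t ht.self_of_nhds).differentiableAt (by simp))
    have h2 : (fun z => σ (c z)) =ᶠ[𝓝 t] γ := by
      filter_upwards [ht] with z hz
      exact (extChartAt (𝓡 n) p).left_inv hz
    rw [logDer_congr h2] at h1
    simp only [β, h1]
    simp [Θ]
  have hsrc0 : γ t₀ ∈ (extChartAt (𝓡 n) p).source := mem_extChartAt_source p
  have hc0 : c t₀ = extChartAt (𝓡 n) p p := rfl
  have hc0t : c t₀ ∈ (extChartAt (𝓡 n) p).target := hct t₀ hsrc0
  have hΘd : HasFDerivAt Θ (fderiv ℝ Θ (c t₀)) (c t₀) :=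
    ((SmoothAt.logDer (hσs _ hc0t)).differentiableAt (by simp)).hasFDerivAt
  have hcd : HasDerivAt c (deriv c t₀) t₀ :=
    ((hcs t₀ hsrc0).differentiableAt (by simp)).hasDerivAt
  have hβd : HasDerivAt β (deriv β t₀) t₀ := by
    have : DifferentiableAt ℝ β t₀ :=
      ((SmoothAt.logDer (hγ t₀)).differentiableAt (by simp)).clm_apply (differentiableAt_const _)
    exact this.hasDerivAt
  have hβ0 : β t₀ = Θ (c t₀) (deriv c t₀) := hβΘ.self_of_nhds
  have hmc : ∀ v, fderiv ℝ Θ (c t₀) (deriv c t₀) v - fderiv ℝ Θ (c t₀) v (deriv c t₀) =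
      -lieBr n G (β t₀) (Θ (c t₀) v) := by
    intro v
    rw [hβ0]
    refine maurerCartan ?_ _ _
    filter_upwards [(isOpen_extChartAt_target p).mem_nhds hc0t] with y hy using hσs y hy
  have hleft : ∀ v, deriv (fun t => coordMetric k p (c t) (deriv c t) v) t₀ =
      innerOne k (β t₀) (fderiv ℝ Θ (c t₀) (deriv c t₀) v) +
        innerOne k (deriv β t₀) (Θ (c t₀) v) := by
    intro v
    have h1 : (fun t => coordMetric k p (c t) (deriv c t) v) =ᶠ[𝓝 t₀]
        fun t => innerOne k (β t) (Θ (c t) v) := by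
      filter_upwards [hsrc, hβΘ] with t ht ht'
      rw [coordMetric_eq hk (hct t ht), ht']
    rw [h1.deriv_eq]
    have h2 : HasDerivAt (fun t => Θ (c t) v) (fderiv ℝ Θ (c t₀) (deriv c t₀) v) t₀ := by
      have := (hΘd.comp_hasDerivAt t₀ hcd).clm_apply (hasDerivAt_const t₀ v)
      simpa [Function.comp_def] using this
    have h3 := ((innerOne k).hasFDerivAt_of_bilinear hβd.hasFDerivAt h2.hasFDerivAt).hasDerivAt
    rw [h3.deriv]
    simp
  have hright : ∀ v, fderiv ℝ (fun y => coordMetric k p y (deriv c t₀) (deriv c t₀)) (c t₀) v =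
      2 * innerOne k (β t₀) (fderiv ℝ Θ (c t₀) v (deriv c t₀)) := by
    intro v
    have h1 : (fun y => coordMetric k p y (deriv c t₀) (deriv c t₀)) =ᶠ[𝓝 (c t₀)]
        fun y => innerOne k (Θ y (deriv c t₀)) (Θ y (deriv c t₀)) := by
      filter_upwards [(isOpen_extChartAt_target p).mem_nhds hc0t] with y hy
      rw [coordMetric_eq hk hy]
    rw [h1.fderiv_eq]
    have h2 : HasFDerivAt (fun y => Θ y (deriv c t₀)) _ (c t₀) :=
      hΘd.clm_apply (hasFDerivAt_const (deriv c t₀) _)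
    rw [((innerOne k).hasFDerivAt_of_bilinear h2 h2).fderiv]
    simp only [add_apply, ContinuousLinearMap.precompR_apply, ContinuousLinearMap.compL_apply,
      ContinuousLinearMap.precompL_apply, ContinuousLinearMap.comp_apply,
      ContinuousLinearMap.flip_apply, zero_apply, map_zero, zero_add]
    rw [← hβ0, innerOne_comm k _ (β t₀)]
    ring
  have hkey : ∀ v, (deriv (fun t => coordMetric k p (c t) (deriv c t) v) t₀ =
        (1 / 2) * fderiv ℝ (fun y => coordMetric k p y (deriv c t₀) (deriv c t₀)) (c t₀) v) ↔
      innerOne k (deriv β t₀) (Θ (c t₀) v) = 0 := by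
    intro v
    rw [hleft, hright]
    -- The difference of the two sides is ⟨β', Θv⟩ plus ⟨β, dΘ(ċ)v - dΘ(v)ċ⟩. By Maurer-Cartan the
    -- latter is -⟨β, [β, Θv]⟩, which vanishes because ad β is skew and [β, β] = 0.
    have h1 := congrArg (innerOne k (β t₀)) (hmc v)
    rw [map_sub, map_neg] at h1
    have h2 := innerOne_lieBr hk (β t₀) (β t₀) (Θ (c t₀) v)
    rw [lieBr_self, map_zero, zero_apply, zero_add] at h2
    rw [h2] at h1
    constructor <;> intro h <;> linarith
  simp only [hkey]
  constructor
  · intro h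
    obtain ⟨v, hv⟩ := logDer_extChartAt_symm_surjective p (deriv β t₀)
    have h1 := h v
    rw [show Θ (c t₀) v = _ from hv] at h1
    rw [innerOne_self_eq_zero k h1] at hβd
    exact hβd
  · intro h v
    rw [h.deriv]; simp

/-- A constant translated velocity means a constant logarithmic derivative, and this characterizes
exponentials. -/
theorem isGeodesic_and_iff {k : LieRiemannianMetric n G} (hk : IsBiinvariant k) {γ : ℝ → G} :
    (IsGeodesic k γ ∧ γ 0 = 1) ↔ ∃ v : Eu n, γ = expCurve G v := by
  constructor
  · rintro ⟨⟨hs, hg⟩, h0⟩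
    have hs' : ∀ t, SmoothAt n γ t := hs
    have hd : ∀ t, HasDerivAt (fun t => logDer n γ t 1) 0 t := fun t =>
      (geodesic_equation_iff hk hs' t).1 (hg t)
    refine ⟨logDer n γ 0 1, eq_expCurve hs' (fun t => ?_) h0⟩
    have := is_const_of_deriv_eq_zero (fun t => (hd t).differentiableAt) (fun t => (hd t).deriv) t 0
    ext1
    simpa using this
  · rintro ⟨v, rfl⟩
    refine ⟨⟨fun t => smoothAt_expCurve v t, fun t => ?_⟩, expCurve_zero v⟩
    refine (geodesic_equation_iff hk (smoothAt_expCurve v) t).2 ?_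
    simp only [logDer_expCurve]
    exact hasDerivAt_const _ _

/-- For γ(t) = exp(tv), period 2π amounts to exp(2πv) = 1, so 2πv is the generator of the
homomorphism. -/
theorem isGeodesic_periodic_iff {k : LieRiemannianMetric n G} (hk : IsBiinvariant k)
    (γ : ℝ → G) : (IsGeodesic k γ ∧ Function.Periodic γ (2 * Real.pi) ∧ γ 0 = 1) ↔
      ∃ ρ : Circle →ₜ* G, ∀ t, γ t = ρ (Circle.exp t) := by
  constructor
  · rintro ⟨hg, hp, h0⟩
    obtain ⟨v, rfl⟩ := (isGeodesic_and_iff hk).1 ⟨hg, h0⟩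
    have h1 : expCurve G ((2 * Real.pi) • v) 1 = 1 := by
      rw [expCurve_smul, mul_one, ← zero_add (2 * Real.pi), hp, h0]
    obtain ⟨ρ, hρ⟩ := exists_circleHom h1
    refine ⟨ρ, fun t => ?_⟩
    rw [map_circleExp' (n := n), hρ, smul_smul, inv_mul_cancel₀ (by positivity), one_smul]
  · rintro ⟨ρ, hρ⟩
    have h1 : γ = expCurve G ((2 * Real.pi)⁻¹ • genVec n ρ) := by
      funext t
      rw [hρ, map_circleExp' (n := n)]
    have h2 := (isGeodesic_and_iff hk).2 ⟨_, h1⟩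
    refine ⟨h2.1, fun t => ?_, h2.2⟩
    rw [hρ, hρ, Circle.exp_add, Circle.exp_two_pi, mul_one]

/-- The closed geodesic of a homomorphism from the circle. -/
def circleGeodesic {k : LieRiemannianMetric n G} (hk : IsBiinvariant k) (ρ : Circle →ₜ* G) :
    ClosedGeodesic k :=
  have h := (isGeodesic_periodic_iff hk (fun t => ρ (Circle.exp t))).2 ⟨ρ, fun _ => rfl⟩
  ⟨fun t => ρ (Circle.exp t), h.1, h.2.1, h.2.2⟩

theorem exists_equiv_geodesics {k : LieRiemannianMetric n G} (hk : IsBiinvariant k) :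
    ∃ e : HomModConj G ≃ Quotient (geodesicConj k),
      ∀ (ρ : Circle →ₜ* G) (γ : ClosedGeodesic k),
        e (Quotient.mk (homConj G) ρ) = Quotient.mk (geodesicConj k) γ ↔
          ∃ g : G, ∀ t, γ.toFun t = g * ρ (Circle.exp t) * g⁻¹ := by
  have hcirc : ∀ z : Circle, ∃ t : ℝ, Circle.exp t = z := fun z => ⟨_, Circle.exp_arg z⟩
  let F : HomModConj G → Quotient (geodesicConj k) := Quotient.map (circleGeodesic hk)
    fun ρ ρ' h => h.imp fun g hg t => hg (Circle.exp t)
  have hinj : Function.Injective F := by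
    intro a b
    refine Quotient.inductionOn₂ a b fun ρ ρ' h => ?_
    obtain ⟨g, hg⟩ := Quotient.exact h
    refine Quotient.sound ⟨g, fun z => ?_⟩
    obtain ⟨t, rfl⟩ := hcirc z
    exact hg t
  have hsurj : Function.Surjective F := by
    refine fun q => Quotient.inductionOn q fun γ => ?_
    obtain ⟨ρ, hρ⟩ := (isGeodesic_periodic_iff hk γ.toFun).1
      ⟨γ.isGeodesic, γ.periodic, γ.map_zero⟩
    exact ⟨Quotient.mk _ ρ, Quotient.sound ⟨1, fun t => by simp [circleGeodesic, hρ t]⟩⟩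
  refine ⟨Equiv.ofBijective F ⟨hinj, hsurj⟩, fun ρ γ => ?_⟩
  change Quotient.mk (geodesicConj k) (circleGeodesic hk ρ) = _ ↔ _
  rw [eq_comm, Quotient.eq]
  rfl

end BiinvariantMetrics

/-! ### Nearby homomorphisms are conjugate -/

section Discreteness

open Set Filter Topology

variable {n : ℕ} {G : Type*} [Group G] [TopologicalSpace G]
  [ChartedSpace (EuclideanSpace ℝ (Fin n)) G] [LieGroup (𝓡 n) ∞ G]

lemma hasDerivAt_lieChart_comp {q : ℝ → G} {t : ℝ} (hq : SmoothAt n q t)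
    (ht : q t ∈ lieSource n G) : HasDerivAt (fun s => lieChart n (q s))
      (leftField n G (lieChart n (q t)) (logDer n q t 1)) t := by
  have h1 := ((hq.lieChart_comp ht).differentiableAt (by simp)).hasFDerivAt.hasDerivAt
  rw [logDer_eq_lieParam hq ht, ContinuousLinearMap.comp_apply, leftField_logDer (lieChart_mem ht)]
  exact h1

/-- Generators of closed one-parameter groups that stay close together are close. -/
lemma eventually_norm_sub_le_of_closed {η : ℝ} (hη : 0 < η) (hη2 : η ≤ 1 / 2) :
    ∃ W ∈ 𝓝 (1 : G), ∀ v w : Eu n, expCurve G v 1 = 1 → expCurve G w 1 = 1 →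
      (∀ t, (expCurve G v t)⁻¹ * expCurve G w t ∈ W) → ‖w - v‖ ≤ 4 * η * ‖v‖ := by
  set A : Eu n → (Eu n →L[ℝ] Eu n) := leftField n G with hA
  set M : Eu n → (Eu n →L[ℝ] Eu n) := fun y => (leftField n G y).comp (Ad n (lieParam n G y)⁻¹)
    with hM
  have hAc : ContinuousAt A (lieOrigin n G) := (contDiffAt_leftField lieOrigin_mem).continuousAt
  have hMc : ContinuousAt M (lieOrigin n G) :=
    hAc.clm_comp (SmoothAt.ad (smoothAt_lieParam lieOrigin_mem).inv).continuousAt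
  have hA0 : A (lieOrigin n G) = ContinuousLinearMap.id ℝ _ := by
    ext1 v; exact leftField_lieOrigin v
  have hM0 : M (lieOrigin n G) = ContinuousLinearMap.id ℝ _ := by
    ext1 v
    simp only [M, ContinuousLinearMap.comp_apply, lieParam_lieOrigin, inv_one, Ad_one]
    exact leftField_lieOrigin v
  have hAe : ∀ᶠ y in 𝓝 (lieOrigin n G), ‖A y - ContinuousLinearMap.id ℝ _‖ < η := by
    refine eventually_norm_lt (hAc.sub continuousAt_const) ?_
    change ‖A _ - _‖ < η
    rwa [hA0, sub_self, norm_zero]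
  have hMe : ∀ᶠ y in 𝓝 (lieOrigin n G), ‖M y - ContinuousLinearMap.id ℝ _‖ < η := by
    refine eventually_norm_lt (hMc.sub continuousAt_const) ?_
    change ‖M _ - _‖ < η
    rwa [hM0, sub_self, norm_zero]
  have hch : ContinuousAt (lieChart n (G := G)) 1 := continuousAt_extChartAt (I := 𝓡 n) (1 : G)
  refine ⟨{g | g ∈ lieSource n G ∧ ‖A (lieChart n g) - ContinuousLinearMap.id ℝ _‖ < η ∧
    ‖M (lieChart n g) - ContinuousLinearMap.id ℝ _‖ < η}, ?_, ?_⟩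
  · have h1 : ∀ᶠ g in 𝓝 (1 : G), g ∈ lieSource n G := isOpen_lieSource.mem_nhds one_mem_lieSource
    exact h1.and ((hch.eventually hAe).and (hch.eventually hMe))
  intro v w hv hw hW
  -- Since both groups close up at time 1, this is a loop based at 1. Inside W it can be studied in
  -- the chart, where its velocity is nearly w - v.
  set q : ℝ → G := fun t => (expCurve G v t)⁻¹ * expCurve G w t with hq
  have hqs : ∀ t, SmoothAt n q t := fun t => (smoothAt_expCurve v t).inv.mul (smoothAt_expCurve w t)
  have hql : ∀ t, logDer n q t 1 = w - Ad n (q t)⁻¹ v := by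
    intro t
    rw [hq, logDer_mul (smoothAt_expCurve v t).inv (smoothAt_expCurve w t),
      logDer_inv (smoothAt_expCurve v t), logDer_expCurve, logDer_expCurve]
    simp only [mul_inv_rev, inv_inv, Ad_mul_apply, add_apply, ContinuousLinearMap.comp_apply,
      neg_apply, ContinuousLinearMap.toSpanSingleton_apply, one_smul, map_neg]
    abel
  -- The loop contributes nothing to D(1) - D(0) = -(w - v), while D' is of size η(‖w‖ + ‖v‖).
  set D : ℝ → Eu n := fun t => lieChart n (q t) - t • (w - v) with hD
  have hDd : ∀ t, HasDerivAt D ((A (lieChart n (q t)) w - w) - (M (lieChart n (q t)) v - v)) t := by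
    intro t
    have h1 := (hasDerivAt_lieChart_comp (hqs t) (hW t).1).sub
      ((hasDerivAt_id t).smul_const (w - v))
    refine h1.congr_deriv ?_
    have h2 : lieParam n G (lieChart n (q t)) = q t := lieParam_lieChart (hW t).1
    simp only [A, M, ContinuousLinearMap.comp_apply, h2, hql, map_sub, one_smul]
    abel
  have hbound : ∀ t, ‖(A (lieChart n (q t)) w - w) - (M (lieChart n (q t)) v - v)‖ ≤
      η * (‖w‖ + ‖v‖) := by
    intro t
    have h1 := ContinuousLinearMap.le_of_opNorm_le _ (hW t).2.1.le w
    have h2 := ContinuousLinearMap.le_of_opNorm_le _ (hW t).2.2.le v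
    rw [mul_add]
    exact (norm_sub_le _ _).trans (add_le_add h1 h2)
  have h3 := norm_image_sub_le_of_norm_deriv_le_segment_01' (f := D)
    (fun t _ => (hDd t).hasDerivWithinAt) (fun t _ => hbound t)
  have h4 : D 1 - D 0 = -(w - v) := by
    simp [D, q, hv, hw]
  rw [h4, norm_neg] at h3
  have h5 : ‖w‖ ≤ ‖w - v‖ + ‖v‖ := by
    simpa using norm_add_le (w - v) v
  have h6 := norm_nonneg (w - v)
  have h7 := norm_nonneg v
  -- From ‖w - v‖ ≤ η‖w - v‖ + 2η‖v‖ and η ≤ 1/2 the first term is absorbed, which produces the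
  -- factor 4.
  nlinarith [mul_le_mul_of_nonneg_left h5 hη.le, mul_le_mul_of_nonneg_right hη2 h6]

/-- Decomposition of the Lie algebra for the action of a closed one-parameter group. -/
lemma exists_lieBr_add_eq {v : Eu n} (hv : expCurve G v 1 = 1) (w : Eu n) :
    ∃ x z : Eu n, lieBr n G v z = 0 ∧ lieBr n G x v + z = w := by
  set u : ℝ → Eu n := fun t => Ad n (expCurve G v t) w with hu
  have hud : ∀ t, HasDerivAt u (lieBrL n G v (u t)) t := by
    intro t
    have h1 := (hasFDerivAt_Ad_apply (smoothAt_expCurve (G := G) v t)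
      (hasFDerivAt_const w t)).hasDerivAt
    refine h1.congr_deriv ?_
    simp only [logDer_expCurve, ContinuousLinearMap.comp_apply, ContinuousLinearMap.flip_apply,
      ContinuousLinearMap.toSpanSingleton_apply, one_smul, add_zero]
    rw [← lieBr_eq_lieBrL, ← lieBr_eq_lieBrL, Ad_lieBr,
      Ad_expCurve_of_lieBr_eq_zero (lieBr_self _)]
  have huc : Continuous u := continuous_iff_continuousAt.2 fun t => (hud t).continuousAt
  have hbc : Continuous fun t => lieBrL n G v (u t) := (lieBrL n G v).continuous.comp huc
  -- With u(t) = Ad(exp tv)w one has u' = [v, u] and u(0) = u(1) = w. The mean of u is killed by ad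
  -- v. Integrating (tu)' gives [v, ∫tu] + ∫u = w, whence x = -∫tu.
  refine ⟨-∫ t in (0 : ℝ)..1, t • u t, ∫ t in (0 : ℝ)..1, u t, ?_, ?_⟩
  · rw [lieBr_eq_lieBrL, ← ContinuousLinearMap.intervalIntegral_comp_comm _
      (huc.intervalIntegrable _ _), intervalIntegral.integral_eq_sub_of_hasDerivAt
      (fun t _ => hud t) (hbc.intervalIntegrable _ _)]
    simp [u, hv, Ad_one]
  · have h1 : ∀ t ∈ uIcc (0 : ℝ) 1, HasDerivAt (fun t => t • u t)
        (t • lieBrL n G v (u t) + u t) t := by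
      intro t _
      have h2 := HasDerivAt.fun_smul (hasDerivAt_id' t) (hud t)
      rwa [one_smul] at h2
    have h2 := intervalIntegral.integral_eq_sub_of_hasDerivAt h1
      ((by fun_prop : Continuous fun t => t • lieBrL n G v (u t) + u t).intervalIntegrable _ _)
    have hc1 : Continuous fun t => t • u t := by fun_prop
    rw [intervalIntegral.integral_add ((by fun_prop : Continuous fun t =>
      t • lieBrL n G v (u t)).intervalIntegrable _ _) (huc.intervalIntegrable _ _)] at h2
    have h3 : ∫ t in (0 : ℝ)..1, t • lieBrL n G v (u t) =
        lieBrL n G v (∫ t in (0 : ℝ)..1, t • u t) := by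
      rw [← ContinuousLinearMap.intervalIntegral_comp_comm _ (hc1.intervalIntegrable _ _)]
      simp
    rw [h3] at h2
    rw [lieBr_neg_left, lieBr_skew, neg_neg, lieBr_eq_lieBrL, h2]
    simp [u, hv, Ad_one]

/-- Vectors close to the generator of a closed one-parameter group are conjugate, by an element
close to the identity, to the sum of the generator and a small vector commuting with it. -/
lemma eventually_exists_Ad_add {v : Eu n} (hv : expCurve G v 1 = 1) {U : Set G}
    (hU : U ∈ 𝓝 (1 : G)) :
    ∀ᶠ w in 𝓝 v, ∃ k ∈ U, ∃ z : Eu n, lieBr n G v z = 0 ∧ w = Ad n k (v + z) := by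
  let Z : Submodule ℝ (Eu n) := LinearMap.ker (lieBrL n G v : Eu n →ₗ[ℝ] Eu n)
  let par : Eu n → G := fun x => lieParam n G (lieOrigin n G + x)
  have hpar0 : par 0 = 1 := by simp [par]
  have hpar : SmoothAt n par 0 := smoothAt_lieParam_comp (by fun_prop) (by simpa using lieOrigin_mem)
  have hparl : logDer n par 0 = ContinuousLinearMap.id ℝ _ := by
    have := logDer_comp (n := n) (f := lieParam n G) (u := fun x => lieOrigin n G + x) (x := 0)
      (by simpa using smoothAt_lieParam lieOrigin_mem) (by fun_prop)
    rw [show par = fun x => lieParam n G (lieOrigin n G + x) from rfl, this]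
    have h1 : fderiv ℝ (fun x => lieOrigin n G + x) 0 = ContinuousLinearMap.id ℝ (Eu n) :=
      ((hasFDerivAt_id 0).const_add _).fderiv
    simp [logDer_lieParam_lieOrigin, h1]
  -- The second variable is restricted to the centralizer of v. The derivative at the origin, (x, z)
  -- ↦ [x, v] + z, is onto by `exists_lieBr_add_eq`.
  let Φ : Eu n × Z → Eu n := fun p => Ad n (par p.1) (v + (p.2 : Eu n))
  have hΦc : ContDiffAt ℝ ∞ Φ (0, 0) := by
    have h1 : ContDiffAt ℝ ∞ (fun p : Eu n × Z => Ad n (par p.1)) (0, 0) :=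
      SmoothAt.ad (SmoothAt.comp (u := Prod.fst) hpar contDiffAt_fst)
    refine h1.clm_apply (contDiffAt_const.add ?_)
    exact Z.subtypeL.contDiff.contDiffAt.comp _ contDiffAt_snd
  have hΦs := hΦc.hasStrictFDerivAt (by simp)
  have hΦd : ∀ (x : Eu n) (z : Z), fderiv ℝ Φ (0, 0) (x, z) = lieBr n G x v + z := by
    intro x z
    have h1 : HasFDerivAt (fun p : Eu n × Z => v + (p.2 : Eu n))
        (Z.subtypeL.comp (ContinuousLinearMap.snd ℝ (Eu n) Z)) ((0 : Eu n), (0 : Z)) :=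
      ((Z.subtypeL.comp (ContinuousLinearMap.snd ℝ (Eu n) Z)).hasFDerivAt).const_add v
    have h2 := hasFDerivAt_Ad_apply (n := n) (f := fun p : Eu n × Z => par p.1) (x := (0, 0))
      (SmoothAt.comp (u := Prod.fst) hpar contDiffAt_fst) h1
    rw [h2.fderiv, logDer_comp (n := n) (f := par) (u := Prod.fst) hpar differentiableAt_fst, hparl,
      fderiv_fst]
    simp [hpar0, Ad_one, lieBr_eq_lieBrL]
  have hsurj : (fderiv ℝ Φ (0, 0)).range = ⊤ := by
    rw [LinearMap.range_eq_top]
    intro w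
    obtain ⟨x, z, hz, hw⟩ := exists_lieBr_add_eq hv w
    have hzZ : z ∈ Z := by
      rw [LinearMap.mem_ker]
      rw [lieBr_eq_lieBrL] at hz
      exact hz
    exact ⟨(x, ⟨z, hzZ⟩), (hΦd x ⟨z, hzZ⟩).trans hw⟩
  -- A strict derivative that is onto makes Φ open at the origin, so the conjugating element can be
  -- kept in any prescribed neighbourhood of 1.
  have hmap := hΦs.map_nhds_eq_of_surj hsurj
  have hΦ0 : Φ (0, 0) = v := by simp [Φ, hpar0, Ad_one]
  rw [hΦ0] at hmap
  have hU' : ∀ᶠ p : Eu n × Z in 𝓝 (0, 0), par p.1 ∈ U := by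
    have h1 : ContinuousAt (fun p : Eu n × Z => par p.1) (0, 0) :=
      ContinuousAt.comp (g := par) (f := Prod.fst) hpar.continuousAt continuousAt_fst
    exact h1.preimage_mem_nhds (by simpa [hpar0] using hU)
  rw [← hmap, eventually_map]
  filter_upwards [hU'] with p hp
  refine ⟨par p.1, hp, p.2, ?_, rfl⟩
  rw [lieBr_eq_lieBrL]
  exact p.2.2

/-- By compactness of the circle, mapping it into an open set is an open condition in the
compact-open topology. The conjugating element varies as well, because the normal form of a nearby
homomorphism is reached only after a small conjugation. -/
lemma eventually_conj_mem [IsTopologicalGroup G] (ρ : Circle →ₜ* G) {W : Set G}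
    (hW : W ∈ 𝓝 (1 : G)) :
    ∀ᶠ p : G × (Circle →ₜ* G) in 𝓝 (1, ρ), ∀ z, (ρ z)⁻¹ * (p.1⁻¹ * p.2 z * p.1) ∈ W := by
  let T : G × (Circle →ₜ* G) → C(Circle, G) := fun p =>
    (ρ.toContinuousMap)⁻¹ * (ContinuousMap.const Circle p.1⁻¹ * p.2.toContinuousMap *
      ContinuousMap.const Circle p.1)
  have hT : Continuous T := by
    have h1 : Continuous fun p : G × (Circle →ₜ* G) => ContinuousMap.const Circle p.1 :=
      ContinuousMap.continuous_const'.comp continuous_fst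
    have h2 : Continuous fun p : G × (Circle →ₜ* G) => p.2.toContinuousMap :=
      (ContinuousMonoidHom.isInducing_toContinuousMap Circle G).continuous.comp continuous_snd
    have h3 : Continuous fun p : G × (Circle →ₜ* G) => ContinuousMap.const Circle p.1⁻¹ :=
      ContinuousMap.continuous_const'.comp continuous_fst.inv
    exact continuous_const.mul ((h3.mul h2).mul h1)
  have ho : IsOpen {f : C(Circle, G) | MapsTo f univ (interior W)} :=
    ContinuousMap.isOpen_setOfPred_mapsTo isCompact_univ isOpen_interior
  have h3 : T (1, ρ) ∈ {f : C(Circle, G) | MapsTo f univ (interior W)} := by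
    intro z _
    have : T (1, ρ) z = 1 := by
      change (ρ z)⁻¹ * (1⁻¹ * ρ z * 1) = 1
      group
    rw [this]
    exact mem_interior_iff_mem_nhds.2 hW
  filter_upwards [hT.continuousAt.preimage_mem_nhds (ho.mem_nhds h3)] with p hp z
  exact interior_subset (hp (mem_univ z))

/-- Homomorphisms close to a given one are conjugate to it. -/
theorem eventually_conj (ρ : Circle →ₜ* G) :
    ∀ᶠ ρ' in 𝓝 ρ, ∃ g : G, genVec n ρ' = Ad n g (genVec n ρ) := by
  have : IsTopologicalGroup G := topologicalGroup_of_lieGroup (𝓡 n) ∞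
  set v := genVec n ρ with hv
  have hv1 : expCurve G v 1 = 1 := expCurve_genVec_one ρ
  -- Applied to the generator 0, the bound reads ‖z‖ ≤ 0: W₀ contains no nontrivial closed
  -- one-parameter group.
  obtain ⟨W₀, hW₀, h0⟩ := eventually_norm_sub_le_of_closed (n := n) (G := G) (η := 1 / 2)
    (by norm_num) le_rfl
  have h1 := eventually_conj_mem ρ hW₀
  -- Splitting into a product neighbourhood makes `pa` available beforehand as the set in which the
  -- conjugating element is to be found.
  rw [nhds_prod_eq, eventually_prod_iff] at h1
  obtain ⟨pa, hpa, pb, hpb, h1⟩ := h1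
  have h2 := eventually_exists_Ad_add hv1 hpa
  obtain ⟨ε, hε, h2⟩ := Metric.eventually_nhds_iff.1 h2
  obtain ⟨η, hη, hη2, hηε⟩ : ∃ η : ℝ, 0 < η ∧ η ≤ 1 / 2 ∧ 4 * η * ‖v‖ < ε := by
    refine ⟨min (1 / 2) (ε / (8 * (‖v‖ + 1))), by positivity, min_le_left _ _, ?_⟩
    have h3 : min (1 / 2) (ε / (8 * (‖v‖ + 1))) ≤ ε / (8 * (‖v‖ + 1)) := min_le_right _ _
    have h4 : ε / (8 * (‖v‖ + 1)) * (8 * (‖v‖ + 1)) = ε := div_mul_cancel₀ _ (by positivity)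
    nlinarith [norm_nonneg v, mul_le_mul_of_nonneg_right h3 (norm_nonneg v)]
  obtain ⟨W, hW, h3⟩ := eventually_norm_sub_le_of_closed (n := n) (G := G) hη hη2
  have h4 : ∀ᶠ ρ' in 𝓝 ρ, ∀ z, (ρ z)⁻¹ * ρ' z ∈ W := by
    have h5 := eventually_conj_mem ρ hW
    rw [nhds_prod_eq] at h5
    filter_upwards [h5.curry.self_of_nhds] with ρ' h z
    simpa using h z
  filter_upwards [h4, hpb] with ρ' hρ' hb
  have h5 : dist (genVec n ρ') v < ε := by
    rw [dist_eq_norm]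
    refine (h3 v (genVec n ρ') hv1 (expCurve_genVec_one ρ') fun t => ?_).trans_lt hηε
    rw [← map_circleExp, ← map_circleExp]
    exact hρ' _
  obtain ⟨k, hk, z, hz, hkz⟩ := h2 h5
  have hvz : ∀ t, expCurve G (v + z) t = expCurve G v t * expCurve G z t := fun t =>
    expCurve_add_left (by rw [lieBr_skew, hz, neg_zero]) t
  have hconj : ∀ t, expCurve G (v + z) t = k⁻¹ * expCurve G (genVec n ρ') t * k := by
    intro t
    rw [hkz, expCurve_Ad]; group
  -- Both exp(v + z), a conjugate of a closed group, and exp(v) are closed, and the commuting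
  -- factors multiply; so exp(tz) is closed too.
  have hz1 : expCurve G z 1 = 1 := by
    have h6 := hvz 1
    rw [hconj, expCurve_genVec_one, hv1] at h6
    simpa using h6.symm
  -- exp(tz) equals ρ⁻¹ · (k⁻¹ρ'k) at the corresponding point of the circle, which lies in W₀; hence
  -- z = 0.
  have hz0 := h0 0 z (expCurve_zero_left 1) hz1 fun t => by
    have h6 := h1 hk hb (Circle.exp (2 * Real.pi * t))
    simp only [map_circleExp (n := n)] at h6
    rw [← hconj, ← hv, hvz, inv_mul_cancel_left] at h6
    rw [expCurve_zero_left, inv_one, one_mul]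
    exact h6
  rw [norm_zero, mul_zero, sub_zero, norm_le_zero_iff] at hz0
  exact ⟨k, by rw [hkz, hz0, add_zero]⟩

theorem discreteTopology_homModConj (n : ℕ) (G : Type*) [Group G] [TopologicalSpace G]
    [ChartedSpace (EuclideanSpace ℝ (Fin n)) G] [LieGroup (𝓡 n) ∞ G] :
    DiscreteTopology (HomModConj G) := by
  rw [discreteTopology_iff_isOpen_singleton]
  refine fun q => Quotient.inductionOn q fun ρ₀ => ?_
  rw [← isQuotientMap_quotient_mk'.isOpen_preimage, isOpen_iff_mem_nhds]
  intro ρ hρ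
  have hρ' : Quotient.mk (homConj G) ρ = Quotient.mk (homConj G) ρ₀ := hρ
  filter_upwards [eventually_conj (n := n) ρ] with ρ' h
  exact ((homMk_eq_iff (n := n)).2 h).trans hρ'

end Discreteness

/-! ### The two stereographic parametrizations of the sphere -/

section Stereographic

open Set Filter Topology

/-- The sign `1` or `-1`. -/
def sgn (s : Bool) : ℝ := if s then 1 else -1

lemma sgn_mul_self (s : Bool) : sgn s * sgn s = 1 := by cases s <;> simp [sgn]

lemma sgn_not (s : Bool) : sgn (!s) = -sgn s := by cases s <;> simp [sgn]

lemma sgn_ne_zero (s : Bool) : sgn s ≠ 0 := by cases s <;> simp [sgn]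

/-- A multiple of the stereographic projection. -/
def stereoVec (s : Bool) (z : ℂ) : Eu 3 :=
  !₂[2 * z.re, 2 * z.im, sgn s * (1 - (z.re ^ 2 + z.im ^ 2))]

/-- The norm of `stereoVec`. -/
def stereoNorm (z : ℂ) : ℝ := 1 + (z.re ^ 2 + z.im ^ 2)

lemma stereoNorm_pos (z : ℂ) : 0 < stereoNorm z := by unfold stereoNorm; positivity

lemma norm_stereoVec (s : Bool) (z : ℂ) : ‖stereoVec s z‖ = stereoNorm z := by
  rw [EuclideanSpace.norm_eq, Real.sqrt_eq_iff_mul_self_eq (by positivity) (stereoNorm_pos z).le]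
  simp only [stereoVec, stereoNorm, Fin.sum_univ_three, Real.norm_eq_abs, sq_abs]
  simp
  linear_combination ((1 - (z.re ^ 2 + z.im ^ 2)) ^ 2) * sgn_mul_self s

/-- The inverse of the stereographic projection from a pole. -/
def stereo (s : Bool) (z : ℂ) : S2 :=
  ⟨(stereoNorm z)⁻¹ • stereoVec s z, by
    rw [mem_sphere_zero_iff_norm, norm_smul, norm_stereoVec, norm_inv,
      Real.norm_of_nonneg (stereoNorm_pos z).le, inv_mul_cancel₀ (stereoNorm_pos z).ne']⟩

lemma coe_stereo (s : Bool) (z : ℂ) : (stereo s z : Eu 3) = (stereoNorm z)⁻¹ • stereoVec s z := rfl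

/-- The stereographic projection from a pole. -/
def stereoInv (s : Bool) (x : S2) : ℂ :=
  ⟨(x : Eu 3) 0 / (1 + sgn s * (x : Eu 3) 2), (x : Eu 3) 1 / (1 + sgn s * (x : Eu 3) 2)⟩

lemma sphere_sq (x : S2) : (x : Eu 3) 0 ^ 2 + (x : Eu 3) 1 ^ 2 + (x : Eu 3) 2 ^ 2 = 1 := by
  have h := mem_sphere_zero_iff_norm.1 x.2
  have h2 := EuclideanSpace.real_norm_sq_eq (x : Eu 3)
  rw [h, Fin.sum_univ_three] at h2
  linarith

lemma stereo_zero (s : Bool) (z : ℂ) : (stereo s z : Eu 3) 0 = 2 * z.re / stereoNorm z := by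
  simp [coe_stereo, stereoVec]; ring

lemma stereo_one (s : Bool) (z : ℂ) : (stereo s z : Eu 3) 1 = 2 * z.im / stereoNorm z := by
  simp [coe_stereo, stereoVec]; ring

lemma stereo_two (s : Bool) (z : ℂ) :
    (stereo s z : Eu 3) 2 = sgn s * (1 - (z.re ^ 2 + z.im ^ 2)) / stereoNorm z := by
  simp [coe_stereo, stereoVec]; ring

lemma one_add_stereo_two (s : Bool) (z : ℂ) :
    1 + sgn s * (stereo s z : Eu 3) 2 = 2 / stereoNorm z := by
  have := (stereoNorm_pos z).ne'
  rw [stereo_two, eq_div_iff this, add_mul, mul_assoc, div_mul_cancel₀ _ this]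
  simp only [stereoNorm]
  linear_combination (1 - (z.re ^ 2 + z.im ^ 2)) * sgn_mul_self s

lemma stereoInv_stereo (s : Bool) (z : ℂ) : stereoInv s (stereo s z) = z := by
  have := (stereoNorm_pos z).ne'
  apply Complex.ext
  · simp only [stereoInv, one_add_stereo_two, stereo_zero]
    field_simp
  · simp only [stereoInv, one_add_stereo_two, stereo_one]
    field_simp

lemma stereo_stereoInv {s : Bool} {x : S2} (hx : 1 + sgn s * (x : Eu 3) 2 ≠ 0) :
    stereo s (stereoInv s x) = x := by
  have h1 := sphere_sq x
  have h2 := sgn_mul_self s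
  have h3 : stereoNorm (stereoInv s x) = 2 / (1 + sgn s * (x : Eu 3) 2) := by
    simp only [stereoNorm, stereoInv]
    rw [eq_div_iff hx]
    field_simp
    linear_combination h1 + (x : Eu 3) 2 ^ 2 * h2
  have h4 := (stereoNorm_pos (stereoInv s x)).ne'
  apply Subtype.ext
  ext i
  fin_cases i
  · simp only [Fin.zero_eta, Fin.isValue, stereo_zero, h3]
    simp only [stereoInv]
    field_simp
  · simp only [Fin.mk_one, Fin.isValue, stereo_one, h3]
    simp only [stereoInv]
    field_simp
  · simp only [Fin.reduceFinMk, Fin.isValue, stereo_two, h3]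
    simp only [stereoInv]
    field_simp
    linear_combination (-sgn s) * h1 + (2 * (x : Eu 3) 2 + sgn s * (x : Eu 3) 2 ^ 2) * h2

/-- The region of the sphere that corresponds to the disk of radius two. -/
def cap (s : Bool) : Set S2 := {x | -(3 / 5) < sgn s * (x : Eu 3) 2}

lemma isOpen_cap (s : Bool) : IsOpen (cap s) := by
  refine isOpen_lt continuous_const ?_
  fun_prop

lemma cap_ne_zero {s : Bool} {x : S2} (hx : x ∈ cap s) : 1 + sgn s * (x : Eu 3) 2 ≠ 0 := by
  have : -(3 / 5) < sgn s * (x : Eu 3) 2 := hx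
  intro h; linarith

lemma stereo_mem_cap {s : Bool} {z : ℂ} : stereo s z ∈ cap s ↔ z ∈ Metric.ball (0 : ℂ) 2 := by
  -- At |z| = 2 this height is 2/5 - 1 = -3/5, the constant in `cap`.
  have h1 : sgn s * (stereo s z : Eu 3) 2 = 2 / stereoNorm z - 1 := by
    linarith [one_add_stereo_two s z]
  rw [cap, mem_ofPred_eq, h1, mem_ball_zero_iff, ← sq_lt_sq₀ (norm_nonneg _) (by norm_num),
    Complex.sq_norm, Complex.normSq_apply, lt_sub_iff_add_lt, lt_div_iff₀ (stereoNorm_pos z),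
    stereoNorm]
  constructor <;> intro h <;> nlinarith

/-- Each closed hemisphere is the image of a closed unit disc, so every point has a parameter well
inside one of the discs of radius 2. -/
lemma exists_stereo_eq (x : S2) : ∃ s, ∃ z ∈ Metric.closedBall (0 : ℂ) 1, stereo s z = x := by
  have h0 : ∃ s, 0 ≤ sgn s * (x : Eu 3) 2 := by
    rcases le_total 0 ((x : Eu 3) 2) with h | h
    · exact ⟨true, by simpa [sgn] using h⟩
    · exact ⟨false, by simpa [sgn] using h⟩
  obtain ⟨s, hs⟩ := h0
  have h1 : 1 + sgn s * (x : Eu 3) 2 ≠ 0 := by positivity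
  refine ⟨s, stereoInv s x, ?_, stereo_stereoInv h1⟩
  rw [mem_closedBall_zero_iff, ← sq_le_sq₀ (norm_nonneg _) (by norm_num), Complex.sq_norm,
    Complex.normSq_apply]
  have h2 := one_add_stereo_two s (stereoInv s x)
  rw [stereo_stereoInv h1, eq_div_iff (stereoNorm_pos _).ne'] at h2
  have h3 := stereoNorm_pos (stereoInv s x)
  have h4 : stereoNorm (stereoInv s x) ≤ 2 := by nlinarith
  simp only [stereoNorm] at h4
  linarith

lemma stereoInv_mem_ball {s : Bool} {x : S2} (hx : x ∈ cap s) :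
    stereoInv s x ∈ Metric.ball (0 : ℂ) 2 := by
  rw [← stereo_mem_cap, stereo_stereoInv (cap_ne_zero hx)]
  exact hx

/-- Inversion in the unit circle. -/
def inversion (z : ℂ) : ℂ := ⟨z.re / (z.re ^ 2 + z.im ^ 2), z.im / (z.re ^ 2 + z.im ^ 2)⟩

lemma sq_add_sq_pos {z : ℂ} (hz : z ≠ 0) : 0 < z.re ^ 2 + z.im ^ 2 := by
  have := Complex.normSq_pos.2 hz
  rw [Complex.normSq_apply] at this
  linarith

lemma stereoNorm_inversion {z : ℂ} (hz : z ≠ 0) :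
    stereoNorm (inversion z) = stereoNorm z / (z.re ^ 2 + z.im ^ 2) := by
  have := (sq_add_sq_pos hz).ne'
  simp only [stereoNorm, inversion]
  field_simp
  ring

/-- The two parametrizations use the same horizontal coordinates from opposite poles, so they differ
by z ↦ z/|z|². This map reverses orientation, which is why signs `sgn s` accompany the area forms.
-/
lemma stereo_inversion (s : Bool) {z : ℂ} (hz : z ≠ 0) :
    stereo (!s) (inversion z) = stereo s z := by
  have h1 := (sq_add_sq_pos hz).ne'
  have h2 := (stereoNorm_pos z).ne'
  apply Subtype.ext
  ext i
  fin_cases i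
  · simp only [Fin.zero_eta, Fin.isValue, stereo_zero, stereoNorm_inversion hz]
    simp only [inversion]
    field_simp
  · simp only [Fin.mk_one, Fin.isValue, stereo_one, stereoNorm_inversion hz]
    simp only [inversion]
    field_simp
  · simp only [Fin.reduceFinMk, Fin.isValue, stereo_two, stereoNorm_inversion hz, sgn_not]
    simp only [inversion]
    field_simp
    ring

lemma stereoInv_not_stereo (s : Bool) {z : ℂ} (hz : z ≠ 0) :
    stereoInv (!s) (stereo s z) = inversion z := by
  rw [← stereo_inversion s hz, stereoInv_stereo]

lemma norm_inversion {z : ℂ} (hz : z ≠ 0) : ‖inversion z‖ = ‖z‖⁻¹ := by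
  have h1 := (sq_add_sq_pos hz)
  rw [← sq_eq_sq₀ (norm_nonneg _) (by positivity), inv_pow, Complex.sq_norm, Complex.sq_norm,
    Complex.normSq_apply, Complex.normSq_apply, ← sq, ← sq, ← sq, ← sq]
  simp only [inversion]
  field_simp

lemma contDiff_stereoNorm : ContDiff ℝ ∞ stereoNorm := by
  unfold stereoNorm
  have h1 : ContDiff ℝ ∞ Complex.re := Complex.reCLM.contDiff
  have h2 : ContDiff ℝ ∞ Complex.im := Complex.imCLM.contDiff
  fun_prop

lemma contDiff_stereoVec (s : Bool) : ContDiff ℝ ∞ (stereoVec s) := by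
  have h1 : ContDiff ℝ ∞ Complex.re := Complex.reCLM.contDiff
  have h2 : ContDiff ℝ ∞ Complex.im := Complex.imCLM.contDiff
  rw [contDiff_euclidean]
  intro i
  fin_cases i
  · change ContDiff ℝ ∞ fun z : ℂ => 2 * z.re
    fun_prop
  · change ContDiff ℝ ∞ fun z : ℂ => 2 * z.im
    fun_prop
  · change ContDiff ℝ ∞ fun z : ℂ => sgn s * (1 - (z.re ^ 2 + z.im ^ 2))
    fun_prop

lemma contDiff_coe_stereo (s : Bool) : ContDiff ℝ ∞ fun z => (stereo s z : Eu 3) :=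
  (contDiff_stereoNorm.inv fun z => (stereoNorm_pos z).ne').smul (contDiff_stereoVec s)

lemma contMDiff_stereo (s : Bool) : ContMDiff 𝓘(ℝ, ℂ) (𝓡 2) ∞ (stereo s) :=
  ContMDiff.codRestrict_sphere (contDiff_coe_stereo s).contMDiff fun z => (stereo s z).2

lemma contMDiffAt_stereoInv {s : Bool} {x : S2} (hx : 1 + sgn s * (x : Eu 3) 2 ≠ 0) :
    ContMDiffAt (𝓡 2) 𝓘(ℝ, ℂ) ∞ (stereoInv s) x := by
  have hc : ∀ i, ContDiff ℝ ∞ fun p : Eu 3 => p i := fun i =>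
    (EuclideanSpace.proj (𝕜 := ℝ) i).contDiff
  have h0 := hc 0
  have h1 := hc 1
  have h2 := hc 2
  have hF : ContDiffAt ℝ ∞ (fun p : Eu 3 => Complex.equivRealProdCLM.symm
      (p 0 / (1 + sgn s * p 2), p 1 / (1 + sgn s * p 2))) (x : Eu 3) := by
    refine Complex.equivRealProdCLM.symm.contDiff.contDiffAt.comp _ (ContDiffAt.prodMk ?_ ?_)
    · exact h0.contDiffAt.div (by fun_prop) hx
    · exact h1.contDiffAt.div (by fun_prop) hx
  refine (ContMDiffAt.comp x hF.contMDiffAt (contMDiff_coe_sphere (n := 2) (m := ∞) x)).congr_of_eventuallyEq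
    (Eventually.of_forall fun y => ?_)
  apply Complex.ext <;> simp [stereoInv]

/-- The derivative of the inverse of the stereographic projection. -/
def stereoDeriv (s : Bool) (z : ℂ) : ℂ →L[ℝ] Eu 2 := mfderiv 𝓘(ℝ, ℂ) (𝓡 2) (stereo s) z

lemma stereoDeriv_injective (s : Bool) (z : ℂ) : Function.Injective (stereoDeriv s z) := by
  have h1 : MDifferentiableAt (𝓡 2) 𝓘(ℝ, ℂ) (stereoInv s) (stereo s z) :=
    (contMDiffAt_stereoInv (by rw [one_add_stereo_two]; have := stereoNorm_pos z; positivity)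
      ).mdifferentiableAt (by simp)
  have h2 : MDifferentiableAt 𝓘(ℝ, ℂ) (𝓡 2) (stereo s) z :=
    (contMDiff_stereo s z).mdifferentiableAt (by simp)
  have h3 := mfderiv_comp z h1 h2
  rw [show stereoInv s ∘ stereo s = id from funext (stereoInv_stereo s), mfderiv_id] at h3
  refine Function.LeftInverse.injective
    (g := (mfderiv (𝓡 2) 𝓘(ℝ, ℂ) (stereoInv s) (stereo s z) : Eu 2 →L[ℝ] ℂ)) fun v => ?_
  exact (congrArg (fun L : ℂ →L[ℝ] ℂ => L v) h3).symm

lemma stereoDeriv_surjective (s : Bool) (z : ℂ) : Function.Surjective (stereoDeriv s z) :=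
  (LinearMap.injective_iff_surjective_of_finrank_eq_finrank
    (f := (stereoDeriv s z : ℂ →ₗ[ℝ] Eu 2)) (by simp)).1 (stereoDeriv_injective s z)

lemma ambient_stereoDeriv (s : Bool) (z v : ℂ) :
    ambient (stereo s z) (stereoDeriv s z v) = fderiv ℝ (fun z => (stereo s z : Eu 3)) z v := by
  have h1 : MDifferentiableAt (𝓡 2) 𝓘(ℝ, Eu 3) (fun y : S2 => (y : Eu 3)) (stereo s z) :=
    (contMDiff_coe_sphere (n := 2) (m := ∞) _).mdifferentiableAt (by simp)
  have h2 : MDifferentiableAt 𝓘(ℝ, ℂ) (𝓡 2) (stereo s) z :=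
    (contMDiff_stereo s z).mdifferentiableAt (by simp)
  have h3 := mfderiv_comp z h1 h2
  rw [mfderiv_eq_fderiv] at h3
  exact (congrArg (fun L : ℂ →L[ℝ] Eu 3 => L v) h3).symm

/-- The standard area form of the plane. -/
def wedge (u v : ℂ) : ℝ := u.re * v.im - u.im * v.re

/-- The radial part is left unspecified because it drops out of det(x, u, v). -/
lemma fderiv_coe_stereo (s : Bool) (z v : ℂ) :
    ∃ r : ℝ, fderiv ℝ (fun z => (stereo s z : Eu 3)) z v =
      (stereoNorm z)⁻¹ • !₂[2 * v.re, 2 * v.im, sgn s * (-2 * (z.re * v.re + z.im * v.im))] +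
        r • stereoVec s z := by
  have hn : HasFDerivAt (fun z => (stereoNorm z)⁻¹) _ z :=
    ((contDiff_stereoNorm.inv fun z => (stereoNorm_pos z).ne').contDiffAt.differentiableAt
      (by simp)).hasFDerivAt
  have hv : HasFDerivAt (stereoVec s) _ z :=
    ((contDiff_stereoVec s).contDiffAt.differentiableAt (by simp)).hasFDerivAt
  have h1 := (hn.smul hv).fderiv
  refine ⟨fderiv ℝ (fun z => (stereoNorm z)⁻¹) z v, ?_⟩
  have h2 : fderiv ℝ (stereoVec s) z v =
      !₂[2 * v.re, 2 * v.im, sgn s * (-2 * (z.re * v.re + z.im * v.im))] := by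
    have hre : HasFDerivAt Complex.re Complex.reCLM z := Complex.reCLM.hasFDerivAt
    have him : HasFDerivAt Complex.im Complex.imCLM z := Complex.imCLM.hasFDerivAt
    have hco : ∀ i, (fderiv ℝ (stereoVec s) z v) i = fderiv ℝ (fun y => stereoVec s y i) z v := by
      intro i
      have := ((EuclideanSpace.proj (𝕜 := ℝ) i).hasFDerivAt.comp z hv).fderiv
      exact (congrArg (fun L : ℂ →L[ℝ] ℝ => L v) this).symm
    ext i
    rw [hco]
    fin_cases i
    · change fderiv ℝ (fun z : ℂ => 2 * z.re) z v = 2 * v.re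
      rw [(hre.const_mul 2).fderiv]; simp
    · change fderiv ℝ (fun z : ℂ => 2 * z.im) z v = 2 * v.im
      rw [(him.const_mul 2).fderiv]; simp
    · change fderiv ℝ (fun z : ℂ => sgn s * (1 - (z.re ^ 2 + z.im ^ 2))) z v =
        sgn s * (-2 * (z.re * v.re + z.im * v.im))
      rw [((((hre.pow 2).fun_add (him.pow 2)).const_sub 1).const_mul (sgn s)).fderiv]
      simp
      ring
  rw [show (fun z => (stereo s z : Eu 3)) = fun z => (stereoNorm z)⁻¹ • stereoVec s z from rfl]
  rw [← h2]
  exact congrArg (fun L : ℂ →L[ℝ] Eu 3 => L v) h1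

/-- The round metric is conformal in these coordinates with area factor 4/(1 + |z|²)²; the sign
records the orientation of the parametrization. -/
lemma roundArea_stereoDeriv (s : Bool) (z u v : ℂ) :
    roundArea (stereo s z) (stereoDeriv s z u) (stereoDeriv s z v) =
      sgn s * 4 / stereoNorm z ^ 2 * wedge u v := by
  obtain ⟨a, ha⟩ := fderiv_coe_stereo s z u
  obtain ⟨b, hb⟩ := fderiv_coe_stereo s z v
  unfold roundArea
  rw [ambient_stereoDeriv, ambient_stereoDeriv, ha, hb, coe_stereo, Matrix.det_fin_three]
  have hc : sgn s * 4 / stereoNorm z ^ 2 = (stereoNorm z)⁻¹ ^ 3 * (sgn s * 4 * stereoNorm z) := by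
    have := (stereoNorm_pos z).ne'
    field_simp
  rw [hc]
  generalize (stereoNorm z)⁻¹ = c
  simp [stereoVec, stereoNorm, wedge]
  ring

end Stereographic

/-! ### The area form of a metric in stereographic coordinates -/

section AreaForm

open Set Filter Topology

/-- A Riemannian metric in stereographic coordinates. -/
def stereoMetric (h : SphereMetric) (s : Bool) (z u v : ℂ) : ℝ :=
  h.inner (stereo s z) (stereoDeriv s z u) (stereoDeriv s z v)

lemma stereoMetric_pos (h : SphereMetric) (s : Bool) (z : ℂ) {u : ℂ} (hu : u ≠ 0) :
    0 < stereoMetric h s z u u := by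
  refine h.pos (stereo s z) _ fun h0 => hu ?_
  exact stereoDeriv_injective s z (h0.trans (map_zero _).symm)

lemma contDiff_stereoMetric (h : SphereMetric) (s : Bool) (u v : ℂ) :
    ContDiff ℝ ∞ fun z => stereoMetric h s z u v := by
  have hw : ∀ w : ℂ, ContMDiff 𝓘(ℝ, ℂ) (𝓡 2).tangent ∞ (fun z => Bundle.TotalSpace.mk' (Eu 2)
      (E := fun x : S2 => TangentSpace (𝓡 2) x) (stereo s z) (stereoDeriv s z w)) := by
    intro w
    have h1 : ContMDiff 𝓘(ℝ, ℂ) 𝓘(ℝ, ℂ).tangent ∞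
        (fun z : ℂ => (⟨z, w⟩ : TangentBundle 𝓘(ℝ, ℂ) ℂ)) := by
      intro z
      exact contMDiffAt_vectorSpace_iff_contDiffAt.2 contDiffAt_const
    exact (ContMDiff.contMDiff_tangentMap (m := ∞) (contMDiff_stereo s) le_rfl).comp h1
  rw [← contMDiff_iff_contDiff]
  have h2 : ContMDiff 𝓘(ℝ, ℂ) ((𝓡 2).prod 𝓘(ℝ)) ∞ (fun z => Bundle.TotalSpace.mk' ℝ
      (E := Bundle.Trivial S2 ℝ) (stereo s z) (stereoMetric h s z u v)) := by
    refine ContMDiff.clm_bundle_apply₂ (F₁ := Eu 2) (F₂ := Eu 2)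
      (E₃ := Bundle.Trivial S2 ℝ) (ψ := fun z => h.inner (stereo s z)) ?_ (hw u) (hw v)
    exact h.contMDiff.comp (contMDiff_stereo s)
  intro z
  have h3 := h2 z
  simp only [Bundle.contMDiffAt_totalSpace] at h3
  exact h3.2

/-- The Gram determinant of a Riemannian metric in stereographic coordinates. -/
def stereoGram (h : SphereMetric) (s : Bool) (z : ℂ) : ℝ :=
  stereoMetric h s z 1 1 * stereoMetric h s z Complex.I Complex.I - stereoMetric h s z 1 Complex.I ^ 2

lemma contDiff_stereoGram (h : SphereMetric) (s : Bool) : ContDiff ℝ ∞ (stereoGram h s) :=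
  ((contDiff_stereoMetric h s 1 1).mul (contDiff_stereoMetric h s _ _)).sub
    ((contDiff_stereoMetric h s 1 Complex.I).pow 2)

lemma stereoGram_pos (h : SphereMetric) (s : Bool) (z : ℂ) : 0 < stereoGram h s z := by
  have hI := stereoMetric_pos h s z Complex.I_ne_zero
  set b := stereoMetric h s z 1 Complex.I with hb
  set c := stereoMetric h s z Complex.I Complex.I with hc
  have hsymm : stereoMetric h s z Complex.I 1 = b := h.symm _ _ _
  -- As in Cauchy-Schwarz, this vector is orthogonal to the second basis vector, and its squared
  -- length is c times the Gram determinant.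
  have hw : (c • (1 : ℂ) - b • Complex.I) ≠ 0 := by
    intro h0
    have := congrArg Complex.re h0
    simp at this
    exact hI.ne' this
  have h1 := stereoMetric_pos h s z hw
  have h2 : stereoMetric h s z (c • (1 : ℂ) - b • Complex.I) (c • (1 : ℂ) - b • Complex.I) =
      c * stereoGram h s z := by
    obtain ⟨B, hlin⟩ : ∃ B : Eu 2 →L[ℝ] Eu 2 →L[ℝ] ℝ, ∀ u v : ℂ, stereoMetric h s z u v =
        B (stereoDeriv s z u) (stereoDeriv s z v) := ⟨h.inner (stereo s z), fun u v => rfl⟩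
    have hexp : stereoMetric h s z (c • (1 : ℂ) - b • Complex.I) (c • (1 : ℂ) - b • Complex.I) =
        c * (c * stereoMetric h s z 1 1 - b * stereoMetric h s z Complex.I 1) -
          b * (c * stereoMetric h s z 1 Complex.I - b * stereoMetric h s z Complex.I Complex.I) := by
      simp only [hlin, map_sub, map_smul, sub_apply, smul_apply, smul_eq_mul]
    rw [hexp, hsymm, stereoGram]
    ring
  rw [h2] at h1
  exact pos_of_mul_pos_right h1 hI.le

/-- The determinant of two vectors of the plane. -/
def det2 (u v : Eu 2) : ℝ := u 0 * v 1 - u 1 * v 0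

lemma eq_smul_add_smul (u : Eu 2) :
    u = u 0 • (EuclideanSpace.single 0 (1 : ℝ) : Eu 2) +
      u 1 • (EuclideanSpace.single 1 (1 : ℝ) : Eu 2) := by
  ext i
  fin_cases i <;> simp

/-- An alternating form in two dimensions is a multiple of the determinant. This passes from
`tangentBasis` to the stereographic frame. -/
lemma roundArea_eq_det2 (x : S2) (u v : Eu 2) :
    roundArea x u v = det2 u v * roundArea x (tangentBasis x 0) (tangentBasis x 1) := by
  set L : Eu 2 →L[ℝ] Eu 3 :=
    mfderiv (𝓡 2) 𝓘(ℝ, Eu 3) (fun y : S2 => (y : Eu 3)) x with hL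
  have h1 : ∀ w : Eu 2, ambient x w = L w := fun w => rfl
  have h2 : ∀ w : Eu 2, L w = w 0 • L (EuclideanSpace.single 0 (1 : ℝ)) +
      w 1 • L (EuclideanSpace.single 1 (1 : ℝ)) := by
    intro w
    conv_lhs => rw [eq_smul_add_smul w]
    simp only [map_add, map_smul]
  unfold roundArea tangentBasis
  rw [h1, h1, h1, h1, h2 u, h2 v, Matrix.det_fin_three, Matrix.det_fin_three, det2]
  simp
  ring

lemma det2_stereoDeriv_ne_zero (s : Bool) (z : ℂ) :
    det2 (stereoDeriv s z 1) (stereoDeriv s z Complex.I) ≠ 0 ∧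
      roundArea (stereo s z) (tangentBasis (stereo s z) 0) (tangentBasis (stereo s z) 1) ≠ 0 := by
  have h1 := roundArea_stereoDeriv s z 1 Complex.I
  rw [roundArea_eq_det2] at h1
  refine mul_ne_zero_iff.1 ?_
  rw [h1]
  rw [show wedge 1 Complex.I = 1 by simp [wedge], mul_one]
  exact div_ne_zero (mul_ne_zero (sgn_ne_zero s) (by norm_num))
    (pow_ne_zero 2 (stereoNorm_pos z).ne')

/-- The root of the Gram determinant and the round area both scale by the absolute determinant of a
change of basis, so their ratio may be computed in the stereographic frame. -/
lemma areaDensity_stereo (h : SphereMetric) (s : Bool) (z : ℂ) :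
    areaDensity h (stereo s z) = Real.sqrt (stereoGram h s z) * stereoNorm z ^ 2 / 4 := by
  set x := stereo s z with hx
  obtain ⟨hd, hr⟩ := det2_stereoDeriv_ne_zero s z
  set u := stereoDeriv s z 1 with hu
  set v := stereoDeriv s z Complex.I with hv
  have h1 := roundArea_stereoDeriv s z 1 Complex.I
  rw [roundArea_eq_det2] at h1
  set R := roundArea x (tangentBasis x 0) (tangentBasis x 1) with hR
  obtain ⟨B, hB⟩ : ∃ B : Eu 2 →L[ℝ] Eu 2 →L[ℝ] ℝ, B = h.inner x := ⟨_, rfl⟩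
  set e₀ : Eu 2 := EuclideanSpace.single 0 (1 : ℝ) with he₀
  set e₁ : Eu 2 := EuclideanSpace.single 1 (1 : ℝ) with he₁
  have h4 : B e₁ e₀ = B e₀ e₁ := by rw [hB]; exact h.symm x _ _
  have h3 : ∀ w w' : Eu 2, B w w' = w 0 * w' 0 * B e₀ e₀ +
      (w 0 * w' 1 + w 1 * w' 0) * B e₀ e₁ + w 1 * w' 1 * B e₁ e₁ := by
    intro w w'
    conv_lhs => rw [eq_smul_add_smul w, eq_smul_add_smul w']
    simp only [map_add, map_smul, add_apply, smul_apply, smul_eq_mul, ← he₀, ← he₁, h4]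
    ring
  have h2 : stereoGram h s z = det2 u v ^ 2 * (B e₀ e₀ * B e₁ e₁ - B e₀ e₁ ^ 2) := by
    have h5 : stereoGram h s z = B u u * B v v - B u v ^ 2 := by rw [hB]; rfl
    rw [h5, h3 u u, h3 v v, h3 u v, det2]
    ring
  have h5 : areaDensity h x = Real.sqrt (B e₀ e₀ * B e₁ e₁ - B e₀ e₁ ^ 2) / |R| := by
    rw [hB]; rfl
  rw [h5, h2, Real.sqrt_mul (sq_nonneg _), Real.sqrt_sq_eq_abs]
  have h6 : |det2 u v| * |R| = 4 / stereoNorm z ^ 2 := by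
    rw [← abs_mul, h1]
    have hs : |sgn s| = 1 := by cases s <;> simp [sgn]
    simp [abs_mul, abs_div, hs, wedge]
  have h7 := (stereoNorm_pos z).ne'
  rw [eq_div_iff (by positivity)] at h6
  have h8 : |R| ≠ 0 := abs_ne_zero.2 hr
  rw [div_eq_div_iff h8 (by norm_num)]
  linear_combination (-Real.sqrt (B e₀ e₀ * B e₁ e₁ - B e₀ e₁ ^ 2)) * h6

/-- The coefficient of the area form in stereographic coordinates. -/
def areaCoeff (h : SphereMetric) (s : Bool) (z : ℂ) : ℝ := sgn s * Real.sqrt (stereoGram h s z)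

lemma contDiff_areaCoeff (h : SphereMetric) (s : Bool) : ContDiff ℝ ∞ (areaCoeff h s) :=
  contDiff_const.mul ((contDiff_stereoGram h s).sqrt fun z => (stereoGram_pos h s z).ne')

lemma sgn_mul_areaCoeff_pos (h : SphereMetric) (s : Bool) (z : ℂ) : 0 < sgn s * areaCoeff h s z := by
  rw [areaCoeff, ← mul_assoc, sgn_mul_self, one_mul]
  exact Real.sqrt_pos.2 (stereoGram_pos h s z)

lemma areaCoeff_ne_zero (h : SphereMetric) (s : Bool) (z : ℂ) : areaCoeff h s z ≠ 0 :=
  fun h0 => by simpa [h0] using sgn_mul_areaCoeff_pos h s z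

lemma areaDensity_stereo_eq (h : SphereMetric) (s : Bool) (z : ℂ) :
    areaDensity h (stereo s z) = sgn s * areaCoeff h s z * stereoNorm z ^ 2 / 4 := by
  rw [areaDensity_stereo, areaCoeff, ← mul_assoc, sgn_mul_self, one_mul]

lemma areaForm_stereoDeriv (h : SphereMetric) (s : Bool) (z u v : ℂ) :
    areaForm h (stereo s z) (stereoDeriv s z u) (stereoDeriv s z v) =
      areaCoeff h s z * wedge u v := by
  unfold areaForm
  rw [roundArea_stereoDeriv, areaDensity_stereo, areaCoeff]
  have h7 := (stereoNorm_pos z).ne'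
  field_simp

lemma areaForm_eq_det2 (h : SphereMetric) (x : S2) (u v : Eu 2) :
    areaForm h x u v = det2 u v * areaForm h x (tangentBasis x 0) (tangentBasis x 1) := by
  unfold areaForm
  rw [roundArea_eq_det2]
  ring

/-- The density is a function on the sphere, so its two stereographic expressions agree at the same
point. The factor |z|⁴ comes from the Jacobian and the minus sign from the reversal of orientation.
-/
lemma areaCoeff_inversion (h : SphereMetric) (s : Bool) {z : ℂ} (hz : z ≠ 0) :
    areaCoeff h (!s) (inversion z) = -(areaCoeff h s z * (z.re ^ 2 + z.im ^ 2) ^ 2) := by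
  have h1 := areaDensity_stereo_eq h (!s) (inversion z)
  rw [stereo_inversion s hz, areaDensity_stereo_eq, stereoNorm_inversion hz, sgn_not] at h1
  have h2 := (sq_add_sq_pos hz).ne'
  have h3 := (stereoNorm_pos z).ne'
  have h4 := sgn_ne_zero s
  field_simp at h1
  linear_combination h1

lemma continuous_areaDensity (h : SphereMetric) : Continuous (areaDensity h) := by
  have h1 : ∀ s, ∀ x ∈ cap s, ContinuousAt (areaDensity h) x := by
    intro s x hx
    have h2 : ContinuousAt (fun y => sgn s * areaCoeff h s (stereoInv s y) *
        stereoNorm (stereoInv s y) ^ 2 / 4) x := by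
      have h3 := (contMDiffAt_stereoInv (cap_ne_zero hx)).continuousAt
      have h4 := (contDiff_areaCoeff h s).continuous
      have h5 := contDiff_stereoNorm.continuous
      exact (((continuousAt_const.mul (h4.continuousAt.comp h3)).mul
        ((h5.continuousAt.comp h3).pow 2)).div_const 4)
    refine h2.congr ?_
    filter_upwards [(isOpen_cap s).mem_nhds hx] with y hy
    rw [← areaDensity_stereo_eq, stereo_stereoInv (cap_ne_zero hy)]
  rw [continuous_iff_continuousAt]
  intro x
  obtain ⟨s, z, hz, rfl⟩ := exists_stereo_eq x
  exact h1 s _ (stereo_mem_cap.2 (Metric.closedBall_subset_ball (by norm_num) hz))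

end AreaForm

/-! ### Smooth dependence of integrals on parameters -/

section ParametricIntegrals

open Set Filter Topology MeasureTheory

lemma hasFDerivAt_intervalIntegral_of_contDiff {E F : Type} [NormedAddCommGroup E] [NormedSpace ℝ E]
    [FiniteDimensional ℝ E] [NormedAddCommGroup F] [NormedSpace ℝ F] [CompleteSpace F]
    {f : E × ℝ → F} (hf : ContDiff ℝ ∞ f) (x : E) :
    HasFDerivAt (fun x => ∫ t in (0 : ℝ)..1, f (x, t)) (∫ t in (0 : ℝ)..1,
      (fderiv ℝ f (x, t)).comp (ContinuousLinearMap.inl ℝ E ℝ)) x := by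
  have hc : Continuous fun p : E × ℝ =>
      (fderiv ℝ f p).comp (ContinuousLinearMap.inl ℝ E ℝ) :=
    (hf.continuous_fderiv (by simp)).clm_comp continuous_const
  have : ProperSpace E := FiniteDimensional.proper ℝ E
  obtain ⟨C, hC⟩ := ((isCompact_closedBall x 1).prod (isCompact_Icc (a := (0 : ℝ)) (b := 1))
    ).exists_bound_of_continuousOn hc.continuousOn
  refine intervalIntegral.hasFDerivAt_integral_of_dominated_of_fderiv_le (F := fun x t => f (x, t))
    (F' := fun x t => (fderiv ℝ f (x, t)).comp (ContinuousLinearMap.inl ℝ E ℝ))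
    (bound := fun _ => C) (s := Metric.ball x 1) (Metric.ball_mem_nhds _ one_pos) ?_ ?_ ?_ ?_ ?_ ?_
  · exact Eventually.of_forall fun y =>
      (hf.continuous.comp (by fun_prop : Continuous fun t : ℝ => (y, t))).aestronglyMeasurable
  · exact (hf.continuous.comp (by fun_prop : Continuous fun t : ℝ => (x, t))).intervalIntegrable _ _
  · exact (hc.comp (by fun_prop : Continuous fun t : ℝ => (x, t))).aestronglyMeasurable
  · refine Eventually.of_forall fun t ht y hy => hC (y, t) ⟨Metric.ball_subset_closedBall hy, ?_⟩
    rw [uIoc_of_le zero_le_one] at ht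
    exact Ioc_subset_Icc_self ht
  · exact intervalIntegrable_const
  · refine Eventually.of_forall fun t _ y _ => ?_
    exact HasFDerivAt.comp (g := f) (f := fun y => (y, t)) y
      ((hf.differentiable (by simp)) _).hasFDerivAt (hasFDerivAt_prodMk_left _ _)

/-- The derivative is an integral of the same kind with values in linear maps, so induction on the
order works once the target space is generalized. -/
lemma contDiff_intervalIntegral {E F : Type} [NormedAddCommGroup E] [NormedSpace ℝ E]
    [FiniteDimensional ℝ E] [NormedAddCommGroup F] [NormedSpace ℝ F] [CompleteSpace F]
    {f : E × ℝ → F} (hf : ContDiff ℝ ∞ f) :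
    ContDiff ℝ ∞ fun x => ∫ t in (0 : ℝ)..1, f (x, t) := by
  rw [contDiff_infty]
  intro k
  induction k generalizing F with
  | zero =>
    rw [Nat.cast_zero, contDiff_zero, continuous_iff_continuousAt]
    exact fun x => (hasFDerivAt_intervalIntegral_of_contDiff hf x).continuousAt
  | succ k ih =>
    rw [Nat.cast_succ]
    refine contDiff_succ_iff_hasFDerivAt.2 ⟨_, ih (f := fun p => (fderiv ℝ f p).comp
      (ContinuousLinearMap.inl ℝ E ℝ)) ?_, hasFDerivAt_intervalIntegral_of_contDiff hf⟩
    exact (hf.fderiv_right (by simp)).clm_comp contDiff_const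

end ParametricIntegrals

/-! ### Primitives of the area form on the two discs -/

section AreaPotential

open Set Filter Topology MeasureTheory

/-- The coefficient of a primitive of the area form in stereographic coordinates. -/
def areaPot (h : SphereMetric) (s : Bool) (z : ℂ) : ℝ :=
  ∫ t in (0 : ℝ)..1, t * areaCoeff h s (t • z)

lemma contDiff_areaPot (h : SphereMetric) (s : Bool) : ContDiff ℝ ∞ (areaPot h s) := by
  refine contDiff_intervalIntegral (f := fun p : ℂ × ℝ => p.2 * areaCoeff h s (p.2 • p.1)) ?_
  exact contDiff_snd.mul ((contDiff_areaCoeff h s).comp (contDiff_snd.smul contDiff_fst))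

lemma continuous_mul_areaCoeff (h : SphereMetric) (s : Bool) (z : ℂ) :
    Continuous fun t : ℝ => t * areaCoeff h s (t • z) :=
  continuous_id.mul ((contDiff_areaCoeff h s).continuous.comp (by fun_prop))

/-- Substituting along the ray turns the Poincaré-lemma primitive into an integral with variable
endpoint, which can be differentiated in r even at a fixed direction. -/
lemma sq_mul_areaPot (h : SphereMetric) (s : Bool) (r : ℝ) (z : ℂ) :
    r ^ 2 * areaPot h s (r • z) = ∫ t in (0 : ℝ)..r, t * areaCoeff h s (t • z) := by
  have h1 := intervalIntegral.smul_integral_comp_mul_left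
    (f := fun t => t * areaCoeff h s (t • z)) (a := 0) (b := 1) r
  rw [mul_zero, mul_one] at h1
  rw [← h1, areaPot, sq, mul_assoc, smul_eq_mul, ← intervalIntegral.integral_const_mul]
  congr 1
  refine intervalIntegral.integral_congr fun t _ => ?_
  simp only [smul_smul]
  rw [mul_comm t r]
  ring

lemma sgn_mul_areaPot_pos (h : SphereMetric) (s : Bool) (z : ℂ) : 0 < sgn s * areaPot h s z := by
  rw [areaPot, ← intervalIntegral.integral_const_mul]
  refine intervalIntegral.intervalIntegral_pos_of_pos_on
    ((continuous_const.mul (continuous_mul_areaCoeff h s z)).intervalIntegrable _ _)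
    (fun t ht => ?_) one_pos
  have := mul_pos ht.1 (sgn_mul_areaCoeff_pos h s (t • z))
  linarith

/-- This Euler relation says that the one-form `areaPot` · (x dy - y dx) has the area form as
exterior derivative. It is the derivative at r = 1 of the identity `sq_mul_areaPot`. -/
lemma fderiv_areaPot_self (h : SphereMetric) (s : Bool) (z : ℂ) :
    fderiv ℝ (areaPot h s) z z + 2 * areaPot h s z = areaCoeff h s z := by
  have h1 : HasDerivAt (fun r : ℝ => ∫ t in (0 : ℝ)..r, t * areaCoeff h s (t • z))
      (1 * areaCoeff h s ((1 : ℝ) • z)) 1 :=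
    ((continuous_mul_areaCoeff h s z).integral_hasStrictDerivAt 0 1).hasDerivAt
  have h2 : HasFDerivAt (areaPot h s) (fderiv ℝ (areaPot h s) z) ((1 : ℝ) • z) := by
    rw [one_smul]
    exact ((contDiff_areaPot h s).differentiable (by simp) z).hasFDerivAt
  have h3 : HasDerivAt (fun r : ℝ => r • z) z 1 := by
    simpa using (hasDerivAt_id' (1 : ℝ)).smul_const z
  have h4 := (hasDerivAt_pow 2 (1 : ℝ)).mul (h2.comp_hasDerivAt 1 h3)
  have h5 := (h4.congr_of_eventuallyEq (Eventually.of_forall fun r =>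
    (sq_mul_areaPot h s r z).symm)).unique h1
  simp at h5
  linarith

/-- The integrand of the total area, as a function on the unit circle. -/
def areaRate (h : SphereMetric) (z : ℂ) : ℝ := areaPot h true z - areaPot h false z

lemma areaRate_pos (h : SphereMetric) (z : ℂ) : 0 < areaRate h z := by
  have h1 := sgn_mul_areaPot_pos h true z
  have h2 := sgn_mul_areaPot_pos h false z
  simp [sgn] at h1 h2
  rw [areaRate]; linarith

lemma inversion_smul {r : ℝ} (hr : r ≠ 0) {u : ℂ} (hu : ‖u‖ = 1) :
    inversion (r • u) = r⁻¹ • u := by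
  have h1 : u.re ^ 2 + u.im ^ 2 = 1 := by
    have := Complex.sq_norm u
    rw [hu, Complex.normSq_apply] at this
    linarith
  have h2 : (r • u).re ^ 2 + (r • u).im ^ 2 = r ^ 2 := by
    simp only [Complex.real_smul, Complex.mul_re, Complex.mul_im, Complex.ofReal_re,
      Complex.ofReal_im, zero_mul, sub_zero, add_zero]
    linear_combination r ^ 2 * h1
  apply Complex.ext
  · simp only [inversion, h2]
    simp
    field_simp
  · simp only [inversion, h2]
    simp
    field_simp

/-- The difference of the two primitives of the area form is a multiple of the angular form that
does not depend on the radius. -/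
lemma areaPot_sub_areaPot (h : SphereMetric) {r : ℝ} (hr : 0 < r) {u : ℂ} (hu : ‖u‖ = 1) :
    r ^ 2 * areaPot h true (r • u) - (r⁻¹) ^ 2 * areaPot h false (r⁻¹ • u) = areaRate h u := by
  set g : ℝ → ℝ := fun r => (∫ t in (0 : ℝ)..r, t * areaCoeff h true (t • u)) -
    ∫ t in (0 : ℝ)..r⁻¹, t * areaCoeff h false (t • u) with hg
  -- Moving the circle outward in one disc moves it inward in the other; by `areaCoeff_inversion`
  -- the area gained equals the area lost.
  have hd : ∀ r ∈ Ioi (0 : ℝ), HasDerivAt g 0 r := by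
    intro r hr
    have hr0 : r ≠ 0 := (show (0 : ℝ) < r from hr).ne'
    have h1 : HasDerivAt (fun r : ℝ => ∫ t in (0 : ℝ)..r, t * areaCoeff h true (t • u)) _ r :=
      ((continuous_mul_areaCoeff h true u).integral_hasStrictDerivAt 0 r).hasDerivAt
    have h2 : HasDerivAt (fun r : ℝ => ∫ t in (0 : ℝ)..r, t * areaCoeff h false (t • u)) _ r⁻¹ :=
      ((continuous_mul_areaCoeff h false u).integral_hasStrictDerivAt 0 r⁻¹).hasDerivAt
    have h3 := h1.sub (h2.comp r (hasDerivAt_inv hr0))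
    refine h3.congr_deriv ?_
    have hru : r • u ≠ 0 := smul_ne_zero hr0 (fun h0 => by simp [h0] at hu)
    have h4 := areaCoeff_inversion h true hru
    have h5 : (r • u).re ^ 2 + (r • u).im ^ 2 = r ^ 2 := by
      have := Complex.sq_norm (r • u)
      rw [norm_smul, hu, Complex.normSq_apply, mul_one, Real.norm_eq_abs, sq_abs] at this
      linarith
    rw [inversion_smul hr0 hu, h5, Bool.not_true] at h4
    rw [h4]
    field_simp
    ring
  have hconst : g r = g 1 := by
    refine (convex_Ioi (0 : ℝ)).is_const_of_fderivWithin_eq_zero (𝕜 := ℝ) (f := g)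
      (fun r hr => ((hd r hr).differentiableAt).differentiableWithinAt) (fun r hr => ?_) hr
      (mem_Ioi.2 one_pos)
    rw [fderivWithin_of_isOpen isOpen_Ioi hr]
    ext
    simp [(hd r hr).deriv]
  have h1 : ∀ r, g r = r ^ 2 * areaPot h true (r • u) - (r⁻¹) ^ 2 * areaPot h false (r⁻¹ • u) := by
    intro r
    rw [sq_mul_areaPot, sq_mul_areaPot]
  rw [← h1, hconst, h1]
  simp [areaRate]

end AreaPotential

/-! ### The total area as the period of the difference of primitives -/

section SphereMeasure

open Set Filter Topology MeasureTheory
open scoped Pointwise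

lemma det_clm_three (A : Eu 3 →L[ℝ] Eu 3) :
    A.det = (Matrix.of ![(A (EuclideanSpace.single 0 1)).ofLp, (A (EuclideanSpace.single 1 1)).ofLp,
      (A (EuclideanSpace.single 2 1)).ofLp]).det := by
  have h1 : A.det = LinearMap.det (A : Eu 3 →ₗ[ℝ] Eu 3) := rfl
  rw [h1, ← LinearMap.det_toMatrix (EuclideanSpace.basisFun (Fin 3) ℝ).toBasis,
    ← Matrix.det_transpose]
  congr 1
  ext i j
  fin_cases i <;> simp [LinearMap.toMatrix_apply]

/-- Spherical coordinates with stereographic angular part. -/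
def stereoCone (s : Bool) (p : ℝ × ℂ) : Eu 3 := p.1 • (stereo s p.2 : Eu 3)

/-- Splitting off the first coordinate of three-space. -/
def splitThree : Eu 3 →L[ℝ] ℝ × ℂ :=
  (EuclideanSpace.proj 0).prod ((EuclideanSpace.proj 1).smulRight (1 : ℂ) +
    (EuclideanSpace.proj 2).smulRight Complex.I)

lemma splitThree_apply (w : Eu 3) : splitThree w = (w 0, ⟨w 1, w 2⟩) := by
  refine Prod.ext rfl (Complex.ext ?_ ?_) <;> simp [splitThree]

lemma measurePreserving_splitThree : MeasurePreserving splitThree := by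
  have h1 : MeasurePreserving (@WithLp.ofLp 2 (Fin 3 → ℝ)) := PiLp.volume_preserving_ofLp (Fin 3)
  have h2 := volume_preserving_piFinSuccAbove (fun _ : Fin 3 => ℝ) 0
  have h3 := (MeasurePreserving.id (volume : Measure ℝ)).prod
    (Complex.volume_preserving_equiv_pi.symm)
  have h4 := h3.comp (h2.comp h1)
  convert h4 using 1
  funext w
  rw [splitThree_apply]
  refine Prod.ext rfl (Complex.ext ?_ ?_)
  · simp [Complex.measurableEquivPi_symm_apply]; rfl
  · simp [Complex.measurableEquivPi_symm_apply]; rfl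
  · rfl

lemma measurableEmbedding_splitThree : MeasurableEmbedding splitThree := by
  have hinj : Function.Injective splitThree := by
    intro v w h
    rw [splitThree_apply, splitThree_apply, Prod.mk.injEq, Complex.mk.injEq] at h
    ext i
    fin_cases i
    · exact h.1
    · exact h.2.1
    · exact h.2.2
  exact splitThree.continuous.measurableEmbedding hinj

/-- The change of variables formula needs a self-map of three-space, so (r, z) is first identified
with ℝ³ by `splitThree`. The Jacobian is r² times the round area factor. -/
lemma det_fderiv_stereoCone (s : Bool) (w : Eu 3) :
    ∃ A : Eu 3 →L[ℝ] Eu 3, HasFDerivAt (fun w => stereoCone s (splitThree w)) A w ∧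
      A.det = sgn s * ((splitThree w).1 ^ 2 * (4 / stereoNorm (splitThree w).2 ^ 2)) := by
  set p := splitThree w with hp
  set D := fderiv ℝ (fun z => (stereo s z : Eu 3)) p.2 with hD
  have h1 : HasFDerivAt (fun z => (stereo s z : Eu 3)) D p.2 :=
    ((contDiff_coe_stereo s).differentiable (by simp) _).hasFDerivAt
  have h2 := (ContinuousLinearMap.fst ℝ ℝ ℂ).hasFDerivAt.comp w splitThree.hasFDerivAt
  have h3 := h1.comp w ((ContinuousLinearMap.snd ℝ ℝ ℂ).hasFDerivAt.comp w splitThree.hasFDerivAt)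
  refine ⟨_, h2.smul h3, ?_⟩
  rw [det_clm_three]
  have e0 : splitThree (EuclideanSpace.single 0 1) = (1, 0) := by
    rw [splitThree_apply]; simp; rfl
  have e1 : splitThree (EuclideanSpace.single 1 1) = (0, 1) := by
    rw [splitThree_apply]; simp; rfl
  have e2 : splitThree (EuclideanSpace.single 2 1) = (0, Complex.I) := by
    rw [splitThree_apply]; simp; rfl
  have h4 := roundArea_stereoDeriv s p.2 1 Complex.I
  unfold roundArea at h4
  rw [ambient_stereoDeriv, ambient_stereoDeriv, Matrix.det_fin_three] at h4
  rw [Matrix.det_fin_three]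
  simp [e0, e1, e2, ← hp, ← hD, wedge] at h4 ⊢
  linear_combination p.1 ^ 2 * h4

/-- The open hemispheres. -/
def hemi (s : Bool) : Set S2 := {x | 0 < sgn s * (x : Eu 3) 2}

lemma isOpen_hemi (s : Bool) : IsOpen (hemi s) := by
  refine isOpen_lt continuous_const ?_
  fun_prop

lemma stereo_mem_hemi {s : Bool} {z : ℂ} : stereo s z ∈ hemi s ↔ z ∈ Metric.ball (0 : ℂ) 1 := by
  have h1 : sgn s * (stereo s z : Eu 3) 2 = 2 / stereoNorm z - 1 := by
    linarith [one_add_stereo_two s z]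
  rw [hemi, mem_ofPred_eq, h1, mem_ball_zero_iff, ← sq_lt_sq₀ (norm_nonneg _) (by norm_num),
    Complex.sq_norm, Complex.normSq_apply, lt_sub_iff_add_lt, lt_div_iff₀ (stereoNorm_pos z),
    stereoNorm]
  constructor <;> intro h <;> nlinarith

lemma stereo_injective (s : Bool) : Function.Injective (stereo s) :=
  Function.LeftInverse.injective (stereoInv_stereo s)

/-- The sphere measure of a set is three times the volume of the open cone over it. The cone is
parametrized by radius and stereographic coordinate, and the radial integral separates. -/
lemma toSphere_inter_hemi (s : Bool) {S : Set S2} (hS : MeasurableSet S) :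
    (volume : Measure (Eu 3)).toSphere (S ∩ hemi s) =
      ∫⁻ z in stereo s ⁻¹' S ∩ Metric.ball 0 1, ENNReal.ofReal (4 / stereoNorm z ^ 2) := by
  have hst : Measurable (stereo s) := (contMDiff_stereo s).continuous.measurable
  set T : Set ℂ := stereo s ⁻¹' S ∩ Metric.ball 0 1 with hT
  have hTm : MeasurableSet T := (hst hS).inter measurableSet_ball
  set D : Set (Eu 3) := splitThree ⁻¹' (Ioo 0 1 ×ˢ T) with hD
  have hDm : MeasurableSet D := splitThree.continuous.measurable (measurableSet_Ioo.prod hTm)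
  have himg : Ioo (0 : ℝ) 1 • ((↑) '' (S ∩ hemi s) : Set (Eu 3)) =
      (fun w => stereoCone s (splitThree w)) '' D := by
    ext y
    constructor
    · rintro ⟨r, hr, -, ⟨x, ⟨hxS, hxh⟩, rfl⟩, rfl⟩
      have hx0 : 1 + sgn s * (x : Eu 3) 2 ≠ 0 := by
        have : 0 < sgn s * (x : Eu 3) 2 := hxh
        positivity
      set z := stereoInv s x with hz
      have hzx : stereo s z = x := stereo_stereoInv hx0
      refine ⟨!₂[r, z.re, z.im], ?_, ?_⟩
      · rw [hD, mem_preimage, splitThree_apply]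
        refine ⟨by simpa using hr, ?_, ?_⟩
        · change stereo s z ∈ S
          rwa [hzx]
        · rw [← stereo_mem_hemi (s := s)]
          change stereo s z ∈ hemi s
          rwa [hzx]
      · simp only [splitThree_apply, stereoCone]
        change r • (stereo s z : Eu 3) = _
        rw [hzx]
    · rintro ⟨w, hw, rfl⟩
      rw [hD, mem_preimage] at hw
      exact ⟨(splitThree w).1, hw.1, _, ⟨stereo s (splitThree w).2,
        ⟨hw.2.1, stereo_mem_hemi.2 hw.2.2⟩, rfl⟩, rfl⟩
  have hinj : InjOn (fun w => stereoCone s (splitThree w)) D := by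
    intro v hv w hw h
    have hn : ∀ p : ℝ × ℂ, 0 < p.1 → ‖stereoCone s p‖ = p.1 := by
      intro p hp
      rw [stereoCone, norm_smul, mem_sphere_zero_iff_norm.1 (stereo s p.2).2, mul_one,
        Real.norm_of_nonneg hp.le]
    have h1 : (splitThree v).1 = (splitThree w).1 := by
      rw [← hn _ hv.1.1, ← hn _ hw.1.1]; exact congrArg norm h
    have h2 : (splitThree v).2 = (splitThree w).2 := by
      apply stereo_injective s
      apply Subtype.ext
      simp only [stereoCone, h1] at h
      exact smul_right_injective _ hw.1.1.ne' h
    exact measurableEmbedding_splitThree.injective (Prod.ext h1 h2)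
  choose A hA hdet using det_fderiv_stereoCone s
  rw [Measure.toSphere_apply' _ (hS.inter (isOpen_hemi s).measurableSet), himg,
    ← lintegral_abs_det_fderiv_eq_addHaar_image volume hDm
      (fun w _ => (hA w).hasFDerivWithinAt) hinj]
  have h3 : ∀ w, ENNReal.ofReal |(A w).det| = (fun p : ℝ × ℂ =>
      ENNReal.ofReal (p.1 ^ 2) * ENNReal.ofReal (4 / stereoNorm p.2 ^ 2)) (splitThree w) := by
    intro w
    have hs : |sgn s| = 1 := by cases s <;> simp [sgn]
    rw [hdet, abs_mul, hs, one_mul, abs_of_nonneg (by positivity), ENNReal.ofReal_mul (sq_nonneg _)]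
  simp only [h3]
  have hf1 : Measurable fun r : ℝ => ENNReal.ofReal (r ^ 2) := by fun_prop
  have hf2 : Measurable fun z : ℂ => ENNReal.ofReal (4 / stereoNorm z ^ 2) := by
    have := contDiff_stereoNorm.continuous.measurable
    fun_prop
  rw [hD, measurePreserving_splitThree.setLIntegral_comp_preimage_emb
    measurableEmbedding_splitThree (fun p : ℝ × ℂ =>
      ENNReal.ofReal (p.1 ^ 2) * ENNReal.ofReal (4 / stereoNorm p.2 ^ 2)) (Ioo 0 1 ×ˢ T)]
  have hvol : (volume : Measure (ℝ × ℂ)).restrict (Ioo 0 1 ×ˢ T) =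
      ((volume : Measure ℝ).restrict (Ioo 0 1)).prod ((volume : Measure ℂ).restrict T) :=
    (Measure.prod_restrict _ _).symm
  rw [hvol, lintegral_prod_mul hf1.aemeasurable hf2.aemeasurable]
  -- The radial integral 1/3 cancels the dimension factor 3 in the definition of the sphere measure.
  have hint : ∫⁻ r in Ioo (0 : ℝ) 1, ENNReal.ofReal (r ^ 2) = ENNReal.ofReal (1 / 3) := by
    rw [Measure.restrict_congr_set Ioo_ae_eq_Ioc, ← ofReal_integral_eq_lintegral_ofReal]
    · rw [← intervalIntegral.integral_of_le zero_le_one, integral_pow]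
      norm_num
    · exact (intervalIntegral.intervalIntegrable_pow 2).1
    · exact Eventually.of_forall fun r => sq_nonneg r
  rw [hint, ← mul_assoc]
  have h4 : ((Module.finrank ℝ (Eu 3) : ℕ) : ENNReal) * ENNReal.ofReal (1 / 3) = 1 := by
    rw [finrank_euclideanSpace_fin, ← ENNReal.ofReal_natCast, ← ENNReal.ofReal_mul (by positivity)]
    norm_num
  rw [h4, one_mul]

/-- The cone over the equator lies in a plane, so the hemispheres cover the sphere up to a null set.
-/
lemma toSphere_equator : (volume : Measure (Eu 3)).toSphere {x : S2 | (x : Eu 3) 2 = 0} = 0 := by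
  have hm : MeasurableSet {x : S2 | (x : Eu 3) 2 = 0} := by
    refine (isClosed_eq ?_ continuous_const).measurableSet
    fun_prop
  let W : Submodule ℝ (Eu 3) := LinearMap.ker (EuclideanSpace.proj (𝕜 := ℝ) 2 : Eu 3 →L[ℝ] ℝ).toLinearMap
  have hW : (volume : Measure (Eu 3)) W = 0 := by
    refine Measure.addHaar_submodule _ _ fun h => ?_
    have h1 : (EuclideanSpace.single 2 (1 : ℝ) : Eu 3) ∈ W := h ▸ Submodule.mem_top
    rw [LinearMap.mem_ker] at h1
    simp at h1
  rw [Measure.toSphere_apply' _ hm]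
  have h2 : Ioo (0 : ℝ) 1 • ((↑) '' {x : S2 | (x : Eu 3) 2 = 0} : Set (Eu 3)) ⊆ W := by
    rintro - ⟨r, -, -, ⟨x, hx, rfl⟩, rfl⟩
    rw [SetLike.mem_coe, LinearMap.mem_ker]
    have hx' : (x : Eu 3) 2 = 0 := hx
    simp [hx']
  rw [measure_mono_null h2 hW, mul_zero]

/-- Integration over the sphere in stereographic coordinates. -/
lemma integral_toSphere {f : S2 → ℝ} (hf : Continuous f) :
    ∫ x, f x ∂(volume : Measure (Eu 3)).toSphere =
      ∑ s, ∫ z in Metric.ball (0 : ℂ) 1, 4 / stereoNorm z ^ 2 * f (stereo s z) := by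
  set σ := (volume : Measure (Eu 3)).toSphere with hσ
  have hfi : Integrable f σ := hf.integrable_of_hasCompactSupport (HasCompactSupport.of_compactSpace f)
  have hst : ∀ s, Measurable (stereo s) := fun s => (contMDiff_stereo s).continuous.measurable
  have hres : ∀ s, σ.restrict (hemi s) = (((volume : Measure ℂ).restrict
      (Metric.ball 0 1)).withDensity fun z => ENNReal.ofReal (4 / stereoNorm z ^ 2)).map (stereo s) := by
    intro s
    ext S hS
    rw [Measure.restrict_apply hS, toSphere_inter_hemi s hS, Measure.map_apply (hst s) hS,
      withDensity_apply _ (hst s hS), Measure.restrict_restrict (hst s hS)]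
  have hden : Measurable fun z : ℂ => (4 / stereoNorm z ^ 2).toNNReal := by
    have := contDiff_stereoNorm.continuous.measurable
    fun_prop
  have hint : ∀ s, ∫ x in hemi s, f x ∂σ =
      ∫ z in Metric.ball (0 : ℂ) 1, 4 / stereoNorm z ^ 2 * f (stereo s z) := by
    intro s
    rw [hres, integral_map (hst s).aemeasurable hf.aestronglyMeasurable]
    have := integral_withDensity_eq_integral_smul (μ := (volume : Measure ℂ).restrict
      (Metric.ball 0 1)) hden (fun z => f (stereo s z))
    refine Eq.trans this ?_
    refine integral_congr_ae (Eventually.of_forall fun z => ?_)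
    simp only [NNReal.smul_def, smul_eq_mul]
    rw [Real.coe_toNNReal _ (by positivity)]
  have hunion : ∫ x, f x ∂σ = ∫ x in hemi true ∪ hemi false, f x ∂σ := by
    rw [← setIntegral_univ]
    refine setIntegral_congr_set ?_
    refine (ae_eq_univ.2 (measure_mono_null (fun x hx => ?_) toSphere_equator)).symm
    simp only [mem_compl_iff, mem_union, hemi, mem_ofPred_eq, sgn, not_or, not_lt] at hx
    simp at hx
    exact le_antisymm hx.1 hx.2
  rw [hunion, setIntegral_union _ (isOpen_hemi false).measurableSet hfi.integrableOn hfi.integrableOn,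
    hint, hint, Fintype.sum_bool]
  rw [Set.disjoint_left]
  intro x hx hx'
  simp only [hemi, mem_ofPred_eq, sgn] at hx hx'
  simp at hx hx'
  linarith

lemma integral_ball_eq (f : ℂ → ℝ) (hf : Continuous f) :
    ∫ z in Metric.ball (0 : ℂ) 1, f z =
      ∫ φ in (-Real.pi)..Real.pi, ∫ t in (0 : ℝ)..1, t * f (t • Complex.exp (φ * Complex.I)) := by
  have h1 : ∀ p : ℝ × ℝ, Complex.polarCoord.symm p = p.1 • Complex.exp (p.2 * Complex.I) := by
    intro p
    rw [Complex.polarCoord_symm_apply, Complex.exp_mul_I, Complex.real_smul]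
    push_cast; rfl
  rw [← integral_indicator measurableSet_ball, ← Complex.integral_comp_polarCoord_symm]
  have h2 : ∫ p in polarCoord.target, p.1 • (Metric.ball (0 : ℂ) 1).indicator f
      (Complex.polarCoord.symm p) =
      ∫ p in polarCoord.target, (Ioo (0 : ℝ) 1 ×ˢ Ioo (-Real.pi) Real.pi).indicator
        (fun p : ℝ × ℝ => p.1 * f (p.1 • Complex.exp (p.2 * Complex.I))) p := by
    refine setIntegral_congr_fun polarCoord.open_target.measurableSet fun p hp => ?_
    rw [polarCoord_target] at hp
    have hn : ‖Complex.polarCoord.symm p‖ = p.1 := by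
      rw [h1, norm_smul, Complex.norm_exp_ofReal_mul_I, mul_one, Real.norm_of_nonneg hp.1.le]
    by_cases hlt : p.1 < 1
    · rw [indicator_of_mem (by rwa [mem_ball_zero_iff, hn]), indicator_of_mem (show p ∈ Ioo (0 : ℝ) 1 ×ˢ Ioo (-Real.pi) Real.pi from ⟨⟨hp.1, hlt⟩, hp.2⟩), h1]
      rfl
    · rw [indicator_of_notMem (by rwa [mem_ball_zero_iff, hn]), indicator_of_notMem fun h => hlt h.1.2,
        smul_zero]
  rw [h2, setIntegral_indicator (measurableSet_Ioo.prod measurableSet_Ioo), polarCoord_target]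
  have h3 : Ioi (0 : ℝ) ×ˢ Ioo (-Real.pi) Real.pi ∩ Ioo (0 : ℝ) 1 ×ˢ Ioo (-Real.pi) Real.pi =
      Ioo (0 : ℝ) 1 ×ˢ Ioo (-Real.pi) Real.pi :=
    inter_eq_right.2 (prod_mono Ioo_subset_Ioi_self le_rfl)
  have hc : Continuous fun p : ℝ × ℝ => p.1 * f (p.1 • Complex.exp (p.2 * Complex.I)) := by fun_prop
  rw [h3]
  have hio : IntegrableOn (fun p : ℝ × ℝ => p.1 * f (p.1 • Complex.exp (p.2 * Complex.I)))
      (Ioo (0 : ℝ) 1 ×ˢ Ioo (-Real.pi) Real.pi) (volume.prod volume) :=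
    (hc.continuousOn.integrableOn_compact (isCompact_Icc.prod isCompact_Icc)).mono_set
      (prod_mono Ioo_subset_Icc_self Ioo_subset_Icc_self)
  have h4 := setIntegral_prod_swap (μ := volume) (ν := volume) (Ioo (0 : ℝ) 1)
    (Ioo (-Real.pi) Real.pi) (fun p : ℝ × ℝ => p.1 * f (p.1 • Complex.exp (p.2 * Complex.I)))
  refine (h4.symm.trans (setIntegral_prod _ hio.swap)).trans ?_
  rw [intervalIntegral.integral_of_le (by linarith [Real.pi_pos]),
    ← integral_Ioc_eq_integral_Ioo]
  refine setIntegral_congr_fun measurableSet_Ioc fun φ _ => ?_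
  simp only [Prod.swap]
  rw [← integral_Ioc_eq_integral_Ioo, intervalIntegral.integral_of_le zero_le_one]

/-- The total area is the period of the difference of the primitives of the area form. -/
theorem integral_areaRate (h : SphereMetric) :
    ∫ φ in (-Real.pi)..Real.pi, areaRate h (Complex.exp (φ * Complex.I)) = totalArea h := by
  rw [totalArea, integral_toSphere (continuous_areaDensity h), Fintype.sum_bool]
  -- Stokes on each unit disc: in polar coordinates the radial integral of the area coefficient is
  -- the potential on the unit circle.
  have h1 : ∀ s, ∫ z in Metric.ball (0 : ℂ) 1, 4 / stereoNorm z ^ 2 * areaDensity h (stereo s z) =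
      sgn s * ∫ φ in (-Real.pi)..Real.pi, areaPot h s (Complex.exp (φ * Complex.I)) := by
    intro s
    have h2 : ∀ z, 4 / stereoNorm z ^ 2 * areaDensity h (stereo s z) = sgn s * areaCoeff h s z := by
      intro z
      rw [areaDensity_stereo_eq]
      have := (stereoNorm_pos z).ne'
      field_simp
    simp only [h2]
    rw [integral_const_mul, integral_ball_eq _ (contDiff_areaCoeff h s).continuous]
    rfl
  have hc : ∀ s, Continuous fun φ : ℝ => areaPot h s (Complex.exp (φ * Complex.I)) := fun s =>
    (contDiff_areaPot h s).continuous.comp (by fun_prop)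
  rw [h1, h1]
  simp only [areaRate]
  rw [intervalIntegral.integral_sub ((hc _).intervalIntegrable _ _) ((hc _).intervalIntegrable _ _)]
  simp [sgn]
  ring

lemma totalArea_pos (h : SphereMetric) : 0 < totalArea h := by
  rw [← integral_areaRate]
  refine intervalIntegral.intervalIntegral_pos_of_pos_on ?_ (fun φ _ => areaRate_pos h _)
    (by linarith [Real.pi_pos])
  have hc : ∀ s, Continuous fun φ : ℝ => areaPot h s (Complex.exp (φ * Complex.I)) := fun s =>
    (contDiff_areaPot h s).continuous.comp (by fun_prop)
  exact ((hc true).sub (hc false)).intervalIntegrable _ _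

end SphereMeasure

/-! ### Connections, curvature and gauge transformations in stereographic coordinates -/

section FormsInCoordinates

open Set Filter Topology

variable {n : ℕ} {G : Type*} [Group G] [TopologicalSpace G]
  [ChartedSpace (EuclideanSpace ℝ (Fin n)) G]

/-- The pullback of a one-form on the sphere along a map from a vector space. -/
def pullForm {E : Type*} [NormedAddCommGroup E] [NormedSpace ℝ E] (A : LieOneForm n G)
    (f : E → S2) (z : E) : E →L[ℝ] Eu n :=
  ContinuousLinearMap.comp (show Eu 2 →L[ℝ] Eu n from A (f z))
    (show E →L[ℝ] Eu 2 from mfderiv 𝓘(ℝ, E) (𝓡 2) f z)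

/-- Smoothness of a form is stated on the tangent bundle; composing with the tangent map of f on
constant vector fields gives smooth evaluations, which suffice in finite dimension. The open set s
is needed because inverse charts are smooth only on their domains. -/
lemma contDiffAt_pullForm {E : Type*} [NormedAddCommGroup E] [NormedSpace ℝ E]
    [FiniteDimensional ℝ E] {A : LieOneForm n G} {U : Set S2} (hA : A.SmoothOn U) (hU : IsOpen U)
    {f : E → S2} {s : Set E} (hs : IsOpen s) (hf : ContMDiffOn 𝓘(ℝ, E) (𝓡 2) ∞ f s) {z : E}
    (hz : z ∈ s) (hzU : f z ∈ U) : ContDiffAt ℝ ∞ (pullForm A f) z := by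
  have h1 := hf.contMDiffOn_tangentMapWithin (m := ∞) le_rfl hs.uniqueMDiffOn
  have hWo : IsOpen (s ∩ f ⁻¹' U) := hf.continuousOn.isOpen_inter_preimage hs hU
  have hkey : ∀ v : E, ContDiffOn ℝ ∞ (fun z => pullForm A f z v) (s ∩ f ⁻¹' U) := by
    rintro v z ⟨hz, hzU⟩
    refine ContDiffAt.contDiffWithinAt ?_
    have h2 : ContMDiffAt 𝓘(ℝ, E) 𝓘(ℝ, E).tangent ∞
        (fun z : E => (⟨z, v⟩ : TangentBundle 𝓘(ℝ, E) E)) z :=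
      contMDiffAt_vectorSpace_iff_contDiffAt.2 contDiffAt_const
    have hopen : IsOpen (Bundle.TotalSpace.proj ⁻¹' s : Set (TangentBundle 𝓘(ℝ, E) E)) :=
      hs.preimage (FiberBundle.continuous_proj E (TangentSpace 𝓘(ℝ, E)))
    have h3 : ContMDiffAt 𝓘(ℝ, E).tangent (𝓡 2).tangent ∞ (tangentMapWithin 𝓘(ℝ, E) (𝓡 2) f s)
        (⟨z, v⟩ : TangentBundle 𝓘(ℝ, E) E) :=
      h1.contMDiffAt (hopen.mem_nhds hz)
    have h4 := ContMDiffAt.comp z h3 h2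
    have hopen' : IsOpen (Bundle.TotalSpace.proj ⁻¹' U : Set (TangentBundle (𝓡 2) S2)) :=
      hU.preimage (FiberBundle.continuous_proj (Eu 2) (TangentSpace (𝓡 2)))
    have h5 : ContMDiffAt (𝓡 2).tangent 𝓘(ℝ, Eu n) ∞
        (fun v : TangentBundle (𝓡 2) S2 => lieCoord (A v.proj v.snd))
        (tangentMapWithin 𝓘(ℝ, E) (𝓡 2) f s ⟨z, v⟩) :=
      ContMDiffOn.contMDiffAt hA (hopen'.mem_nhds hzU)
    have h6 := ContMDiffAt.comp z h5 h4
    refine (contMDiffAt_iff_contDiffAt.1 h6).congr_of_eventuallyEq ?_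
    filter_upwards [hs.mem_nhds hz] with y hy
    simp only [Function.comp, tangentMapWithin, mfderivWithin_of_isOpen hs hy]
    rfl
  exact (contDiffOn_clm_apply.2 hkey).contDiffAt (hWo.mem_nhds ⟨hz, hzU⟩)

/-- The curvature of a Lie algebra valued one-form on a vector space. -/
def formCurv (n : ℕ) (G : Type*) [Group G] [TopologicalSpace G]
    [ChartedSpace (EuclideanSpace ℝ (Fin n)) G] (a : ℂ → ℂ →L[ℝ] Eu n) (z u v : ℂ) : Eu n :=
  fderiv ℝ a z u v - fderiv ℝ a z v u + lieBr n G (a z u) (a z v)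

/-- A one-form on the sphere in stereographic coordinates. -/
def stereoForm (A : LieOneForm n G) (s : Bool) : ℂ → ℂ →L[ℝ] Eu n := pullForm A (stereo s)

lemma stereoForm_apply (A : LieOneForm n G) (s : Bool) (z v : ℂ) :
    stereoForm A s z v = lieCoord (A (stereo s z) (stereoDeriv s z v)) := rfl

lemma contDiffAt_stereoForm {A : LieOneForm n G} {U : Set S2} (hA : A.SmoothOn U) (hU : IsOpen U)
    {s : Bool} {z : ℂ} (hz : stereo s z ∈ U) : ContDiffAt ℝ ∞ (stereoForm A s) z :=
  contDiffAt_pullForm hA hU isOpen_univ (contMDiff_stereo s).contMDiffOn (mem_univ z) hz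

/-- Naturality of d: under the change from the chart at x to stereographic coordinates the second
derivative of the transition map is symmetric and cancels. -/
lemma extDerivative_stereoDeriv {A : LieOneForm n G} {U : Set S2} (hA : A.SmoothOn U)
    (hU : IsOpen U) {s : Bool} {z : ℂ} (hz : stereo s z ∈ U) (u v : ℂ) :
    lieCoord (A.extDerivative (stereo s z) (stereoDeriv s z u) (stereoDeriv s z v)) =
      fderiv ℝ (stereoForm A s) z u v - fderiv ℝ (stereoForm A s) z v u := by
  set x := stereo s z with hx
  set σ : Eu 2 → S2 := fun y => (extChartAt (𝓡 2) x).symm y with hσ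
  set τ : ℂ → Eu 2 := fun y => extChartAt (𝓡 2) x (stereo s y) with hτ
  set C : Eu 2 → Eu 2 →L[ℝ] Eu n := pullForm A σ with hC
  have hσs : ContMDiffOn 𝓘(ℝ, Eu 2) (𝓡 2) ∞ σ (extChartAt (𝓡 2) x).target :=
    contMDiffOn_extChartAt_symm x
  have hτz : τ z = extChartAt (𝓡 2) x x := rfl
  have hσz : σ (τ z) = x := (extChartAt (𝓡 2) x).left_inv (mem_extChartAt_source x)
  have hCd : ContDiffAt ℝ ∞ C (τ z) := by
    refine contDiffAt_pullForm hA hU (isOpen_extChartAt_target x) hσs (mem_extChartAt_target x) ?_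
    rw [hσz]; exact hz
  have hsrc : ∀ᶠ y in 𝓝 z, stereo s y ∈ (extChartAt (𝓡 2) x).source :=
    (contMDiff_stereo s z).continuousAt.preimage_mem_nhds (extChartAt_source_mem_nhds x)
  have hτs : ∀ y, stereo s y ∈ (extChartAt (𝓡 2) x).source → ContDiffAt ℝ ∞ τ y := fun y hy =>
    (ContMDiffAt.comp y (contMDiffAt_extChartAt' (by simpa using hy))
      (contMDiff_stereo s y)).contDiffAt
  have hform : stereoForm A s =ᶠ[𝓝 z] fun y => (C (τ y)).comp (fderiv ℝ τ y) := by
    filter_upwards [hsrc.eventually_nhds] with y hy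
    have hy0 := hy.self_of_nhds
    have h1 : σ ∘ τ =ᶠ[𝓝 y] stereo s := by
      filter_upwards [hy] with w hw
      exact (extChartAt (𝓡 2) x).left_inv hw
    have hσd : MDifferentiableAt 𝓘(ℝ, Eu 2) (𝓡 2) σ (τ y) :=
      ((hσs.contMDiffAt ((isOpen_extChartAt_target x).mem_nhds
        ((extChartAt (𝓡 2) x).map_source hy0)))).mdifferentiableAt (by simp)
    have hτd : MDifferentiableAt 𝓘(ℝ, ℂ) 𝓘(ℝ, Eu 2) τ y :=
      ((hτs y hy0).differentiableAt (by simp)).mdifferentiableAt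
    have h2 : (mfderiv 𝓘(ℝ, ℂ) (𝓡 2) (stereo s) y : ℂ →L[ℝ] Eu 2) =
        (mfderiv 𝓘(ℝ, Eu 2) (𝓡 2) σ (τ y) : Eu 2 →L[ℝ] Eu 2).comp (fderiv ℝ τ y) := by
      have h3 := mfderiv_comp y hσd hτd
      rw [mfderiv_eq_fderiv] at h3
      exact (h1.mfderiv_eq (I := 𝓘(ℝ, ℂ)) (I' := 𝓡 2)).symm.trans h3
    let A' : S2 → (Eu 2 →L[ℝ] Eu n) := A
    have h4 : A' (σ (τ y)) = A' (stereo s y) := congrArg A' h1.self_of_nhds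
    change (A' (stereo s y)).comp _ = ((A' (σ (τ y))).comp _).comp _
    rw [h4, ContinuousLinearMap.comp_assoc]
    exact congrArg (A' (stereo s y)).comp h2
  have hsrc0 := hsrc.self_of_nhds
  have hτ2 : HasFDerivAt (fderiv ℝ τ) (fderiv ℝ (fderiv ℝ τ) z) z :=
    (((hτs z hsrc0).fderiv_right (m := ∞) (by simp)).differentiableAt (by simp)).hasFDerivAt
  have hsymm : ∀ u v, fderiv ℝ (fderiv ℝ τ) z u v = fderiv ℝ (fderiv ℝ τ) z v u :=
    fun u v => ((hτs z hsrc0).isSymmSndFDerivAt (by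
      simpa using WithTop.coe_le_coe.2 (le_top : (2 : ℕ∞) ≤ ⊤))) u v
  have hτ1 : HasFDerivAt τ (fderiv ℝ τ z) z :=
    ((hτs z hsrc0).differentiableAt (by simp)).hasFDerivAt
  have hC1 : HasFDerivAt C (fderiv ℝ C (τ z)) (τ z) :=
    (hCd.differentiableAt (by simp)).hasFDerivAt
  have hd : ∀ u v, fderiv ℝ (stereoForm A s) z u v =
      C (τ z) (fderiv ℝ (fderiv ℝ τ) z u v) + fderiv ℝ C (τ z) (fderiv ℝ τ z u) (fderiv ℝ τ z v) := by
    intro u v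
    have h1 : fderiv ℝ (fun y => (C (τ y)).comp (fderiv ℝ τ y)) z = _ :=
      ((hC1.comp z hτ1).clm_comp hτ2).fderiv
    rw [hform.fderiv_eq, h1]
    simp
  have hφ : ∀ w : ℂ, (mfderiv (𝓡 2) 𝓘(ℝ, Eu 2) (extChartAt (𝓡 2) x) x (stereoDeriv s z w) : Eu 2) =
      fderiv ℝ τ z w := by
    intro w
    have h1 := mfderiv_comp z (mdifferentiableAt_extChartAt (I := 𝓡 2) (mem_chart_source _ x))
      ((contMDiff_stereo s z).mdifferentiableAt (by simp))
    have h2 : mfderiv 𝓘(ℝ, ℂ) 𝓘(ℝ, Eu 2) (extChartAt (𝓡 2) x ∘ stereo s) z = fderiv ℝ τ z :=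
      mfderiv_eq_fderiv
    rw [h2] at h1
    exact (congrArg (fun L : ℂ →L[ℝ] Eu 2 => L w) h1).symm
  rw [hd, hd, hsymm u v, add_sub_add_left_eq_sub, ← hφ, ← hφ]
  rfl

variable [LieGroup (𝓡 n) ∞ G]

lemma curvature_stereoDeriv {A : LieOneForm n G} {U : Set S2} (hA : A.SmoothOn U)
    (hU : IsOpen U) {s : Bool} {z : ℂ} (hz : stereo s z ∈ U) (u v : ℂ) :
    lieCoord (A.curvature (stereo s z) (stereoDeriv s z u) (stereoDeriv s z v)) =
      formCurv n G (stereoForm A s) z u v := by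
  rw [formCurv, ← extDerivative_stereoDeriv hA hU hz]
  rfl

/-- The curvature is an alternating form on the plane, so one coefficient determines it. -/
lemma formCurv_eq_wedge (a : ℂ → ℂ →L[ℝ] Eu n) (z u v : ℂ) :
    formCurv n G a z u v = wedge u v • formCurv n G a z 1 Complex.I := by
  have h : ∀ w : ℂ, w = w.re • (1 : ℂ) + w.im • Complex.I := fun w => by
    simp [Complex.re_add_im]
  simp only [formCurv]
  conv_lhs => rw [h u, h v]
  simp only [map_add, map_smul, add_apply, smul_apply, wedge, lieBr_add_left, lieBr_add_right,
    lieBr_smul_left, lieBr_smul_right, lieBr_self, lieBr_skew (a z Complex.I) (a z 1)]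
  module

lemma curvature_eq_det2 (A : LieOneForm n G) (x : S2) (u v : Eu 2) :
    lieCoord (A.curvature x u v) =
      det2 u v • lieCoord (A.curvature x (tangentBasis x 0) (tangentBasis x 1)) := by
  obtain ⟨D, B, h⟩ : ∃ (D : Eu 2 →L[ℝ] Eu 2 →L[ℝ] Eu n) (B : Eu 2 →L[ℝ] Eu n), ∀ u v : Eu 2,
      lieCoord (A.curvature x u v) = D u v - D v u + lieBr n G (B u) (B v) :=
    let L : Eu 2 →L[ℝ] Eu 2 := mfderiv (𝓡 2) 𝓘(ℝ, Eu 2) (extChartAt (𝓡 2) x) x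
    let D₀ : Eu 2 →L[ℝ] Eu 2 →L[ℝ] Eu n := fderiv ℝ (A.coord x) (extChartAt (𝓡 2) x x)
    ⟨((D₀.comp L).flip.comp L).flip, A x, fun u v => rfl⟩
  refine (h u v).trans (Eq.trans ?_ (congrArg (det2 u v • ·)
    (h (EuclideanSpace.single 0 1) (EuclideanSpace.single 1 1)).symm))
  conv_lhs => rw [eq_smul_add_smul u, eq_smul_add_smul v]
  simp only [map_add, map_smul, add_apply, smul_apply, det2, lieBr_add_left, lieBr_add_right,
    lieBr_smul_left, lieBr_smul_right, lieBr_self,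
    lieBr_skew (B (EuclideanSpace.single 1 1)) (B (EuclideanSpace.single 0 1))]
  module

/-- The dual of the curvature in stereographic coordinates. -/
def stereoStar (h : SphereMetric) (A : LieOneForm n G) (s : Bool) (z : ℂ) : Eu n :=
  (areaCoeff h s z)⁻¹ • formCurv n G (stereoForm A s) z 1 Complex.I

/-- Curvature and area form scale by the same determinant, so their ratio may be computed in the
stereographic frame. -/
lemma starCurvature_stereo (h : SphereMetric) {A : LieOneForm n G} {U : Set S2} (hA : A.SmoothOn U)
    (hU : IsOpen U) {s : Bool} {z : ℂ} (hz : stereo s z ∈ U) :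
    lieCoord (A.starCurvature h (stereo s z)) = stereoStar h A s z := by
  rw [stereoStar, ← curvature_stereoDeriv hA hU hz, curvature_eq_det2]
  have h1 := areaForm_stereoDeriv h s z 1 Complex.I
  rw [areaForm_eq_det2, show wedge 1 Complex.I = 1 by simp [wedge], mul_one] at h1
  rw [← h1, smul_smul, mul_inv, mul_comm, ← mul_assoc, mul_inv_cancel₀, one_mul]
  · rfl
  · exact (det2_stereoDeriv_ne_zero s z).1

lemma formCurv_eq_stereoStar (h : SphereMetric) (A : LieOneForm n G) (s : Bool) (z u v : ℂ) :
    formCurv n G (stereoForm A s) z u v = (areaCoeff h s z * wedge u v) • stereoStar h A s z := by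
  rw [formCurv_eq_wedge, stereoStar, smul_smul, mul_comm, ← mul_assoc,
    inv_mul_cancel₀ (areaCoeff_ne_zero h s z), one_mul]

lemma contDiffAt_formCurv {a : ℂ → ℂ →L[ℝ] Eu n} {z : ℂ} (ha : ContDiffAt ℝ ∞ a z) (u v : ℂ) :
    ContDiffAt ℝ ∞ (fun z => formCurv n G a z u v) z := by
  have h1 : ContDiffAt ℝ ∞ (fderiv ℝ a) z := ha.fderiv_right (by simp)
  simp only [formCurv, lieBr_eq_lieBrL]
  refine ContDiffAt.add (ContDiffAt.sub ?_ ?_) ?_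
  · exact (h1.clm_apply contDiffAt_const).clm_apply contDiffAt_const
  · exact (h1.clm_apply contDiffAt_const).clm_apply contDiffAt_const
  · exact (contDiffAt_const.clm_apply (ha.clm_apply contDiffAt_const)).clm_apply
      (ha.clm_apply contDiffAt_const)

lemma contDiffAt_stereoStar (h : SphereMetric) {A : LieOneForm n G} {U : Set S2}
    (hA : A.SmoothOn U) (hU : IsOpen U) {s : Bool} {z : ℂ} (hz : stereo s z ∈ U) :
    ContDiffAt ℝ ∞ (stereoStar h A s) z :=
  ((contDiff_areaCoeff h s).contDiffAt.inv (areaCoeff_ne_zero h s z)).smul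
    (contDiffAt_formCurv (contDiffAt_stereoForm hA hU hz) _ _)

lemma eventually_stereo_mem {U : Set S2} (hU : IsOpen U) {s : Bool} {z : ℂ}
    (hz : stereo s z ∈ U) : ∀ᶠ w in 𝓝 z, stereo s w ∈ U :=
  (contMDiff_stereo s z).continuousAt.preimage_mem_nhds (hU.mem_nhds hz)

lemma eventually_stereo_stereoInv (s : Bool) (z : ℂ) :
    ∀ᶠ x in 𝓝 (stereo s z), stereo s (stereoInv s x) = x := by
  have h1 : ContinuousAt (fun x : S2 => 1 + sgn s * (x : Eu 3) 2) (stereo s z) := by fun_prop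
  have h2 : 1 + sgn s * (stereo s z : Eu 3) 2 ≠ 0 := by
    rw [one_add_stereo_two]
    have := stereoNorm_pos z
    positivity
  filter_upwards [h1.eventually_ne h2] with x hx using stereo_stereoInv hx

lemma contMDiffAt_stereoInv_stereo (s : Bool) (z : ℂ) :
    ContMDiffAt (𝓡 2) 𝓘(ℝ, ℂ) ∞ (stereoInv s) (stereo s z) :=
  contMDiffAt_stereoInv (by
    rw [one_add_stereo_two]
    have := stereoNorm_pos z
    positivity)

lemma covDerivative_stereoDeriv (h : SphereMetric) {A : LieOneForm n G} {U : Set S2}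
    (hA : A.SmoothOn U) (hU : IsOpen U) {s : Bool} {z : ℂ} (hz : stereo s z ∈ U) (v : ℂ) :
    lieCoord (A.covDerivative (A.starCurvature h) (stereo s z) (stereoDeriv s z v)) =
      fderiv ℝ (stereoStar h A s) z v + lieBr n G (stereoForm A s z v) (stereoStar h A s z) := by
  set ξ : S2 → Eu n := fun y => lieCoord (A.starCurvature h y) with hξ
  have h1 : ξ =ᶠ[𝓝 (stereo s z)] fun x => stereoStar h A s (stereoInv s x) := by
    filter_upwards [eventually_stereo_stereoInv s z, hU.mem_nhds hz] with x hx hxU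
    rw [← starCurvature_stereo h hA hU (by rwa [hx]), hx]
  have h2 : ContMDiffAt (𝓡 2) 𝓘(ℝ, Eu n) ∞ ξ (stereo s z) := by
    refine ContMDiffAt.congr_of_eventuallyEq ?_ h1
    refine ContMDiffAt.comp (g := stereoStar h A s) (f := stereoInv s) (stereo s z) ?_
      (contMDiffAt_stereoInv_stereo s z)
    rw [stereoInv_stereo]
    exact (contDiffAt_stereoStar h hA hU hz).contMDiffAt
  have h3 := mfderiv_comp z (h2.mdifferentiableAt (by simp))
    ((contMDiff_stereo s z).mdifferentiableAt (by simp))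
  have h4 : ξ ∘ stereo s =ᶠ[𝓝 z] stereoStar h A s := by
    filter_upwards [eventually_stereo_mem hU hz] with w hw
    exact starCurvature_stereo h hA hU hw
  have h5 : mfderiv 𝓘(ℝ, ℂ) 𝓘(ℝ, Eu n) (ξ ∘ stereo s) z = fderiv ℝ (stereoStar h A s) z :=
    mfderiv_eq_fderiv.trans h4.fderiv_eq
  rw [h5] at h3
  rw [h3, ← starCurvature_stereo h hA hU hz]
  rfl

lemma logDerivative_stereoDeriv {g : S2 → G} {s : Bool} {z : ℂ}
    (hg : ContMDiffAt (𝓡 2) (𝓡 n) ∞ g (stereo s z)) (v : ℂ) :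
    lieCoord (logDerivative n g (stereo s z) (stereoDeriv s z v)) =
      logDer n (fun w => g (stereo s w)) z v := by
  have h1 : SmoothAt n (fun w => g (stereo s w)) z := ContMDiffAt.comp z hg (contMDiff_stereo s z)
  rw [logDer_eq_mfderiv h1]
  have h2 : ContMDiffAt (𝓡 2) (𝓡 n) ∞ (fun y => (g (stereo s z))⁻¹ * g y) (stereo s z) :=
    contMDiffAt_const.mul hg
  exact (congrArg (fun L : ℂ →L[ℝ] Eu n => L v) (mfderiv_comp z (h2.mdifferentiableAt (by simp))
    ((contMDiff_stereo s z).mdifferentiableAt (by simp)))).symm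

/-- A gauge transformation of one-forms in stereographic coordinates. -/
lemma gauge_iff {A B : LieOneForm n G} {g : S2 → G} {s : Bool} {z : ℂ}
    (hg : ContMDiffAt (𝓡 2) (𝓡 n) ∞ g (stereo s z)) :
    (∀ u : TangentSpace (𝓡 2) (stereo s z), B (stereo s z) u =
      adjointAction n (g (stereo s z))⁻¹ (A (stereo s z) u) + logDerivative n g (stereo s z) u) ↔
    stereoForm B s z = (Ad n (g (stereo s z))⁻¹).comp (stereoForm A s z) +
      logDer n (fun w => g (stereo s w)) z := by
  have key : ∀ v, lieCoord (adjointAction n (g (stereo s z))⁻¹ (A (stereo s z) (stereoDeriv s z v)) +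
      logDerivative n g (stereo s z) (stereoDeriv s z v)) =
      ((Ad n (g (stereo s z))⁻¹).comp (stereoForm A s z) +
        logDer n (fun w => g (stereo s w)) z) v := by
    intro v
    rw [add_apply, ← logDerivative_stereoDeriv hg, ContinuousLinearMap.comp_apply,
      stereoForm_apply, ← lieCoord_adjointAction]
    rfl
  constructor
  · intro h
    ext1 v
    rw [← key, stereoForm_apply]
    exact congrArg lieCoord (h _)
  · intro h u
    obtain ⟨v, rfl⟩ := stereoDeriv_surjective s z u
    have h1 := congrArg (fun L : ℂ →L[ℝ] Eu n => L v) h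
    exact h1.trans (key v).symm

/-- Gauge covariance of the curvature. -/
lemma formCurv_gauge {a b : ℂ → ℂ →L[ℝ] Eu n} {g : ℂ → G} {z : ℂ}
    (ha : DifferentiableAt ℝ a z) (hg : ∀ᶠ w in 𝓝 z, SmoothAt n g w)
    (hb : ∀ᶠ w in 𝓝 z, b w = (Ad n (g w)⁻¹).comp (a w) + logDer n g w) (u v : ℂ) :
    formCurv n G b z u v = Ad n (g z)⁻¹ (formCurv n G a z u v) := by
  have hg0 := hg.self_of_nhds
  have hd : ∀ u v, fderiv ℝ b z u v = Ad n (g z)⁻¹ (lieBr n G (logDer n (fun w => (g w)⁻¹) z u)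
      (a z v) + fderiv ℝ a z u v) + fderiv ℝ (logDer n g) z u v := by
    intro u v
    have hbd : HasFDerivAt (fun w => (Ad n (g w)⁻¹).comp (a w) + logDer n g w)
        (fderiv ℝ b z) z := by
      have hb' : b =ᶠ[𝓝 z] fun w => (Ad n (g w)⁻¹).comp (a w) + logDer n g w := hb
      rw [hb'.fderiv_eq]
      exact ((((SmoothAt.ad hg0.inv).differentiableAt (by simp)).clm_comp ha).add
        ((SmoothAt.logDer hg0).differentiableAt (by simp))).hasFDerivAt
    have h1 := hbd.clm_apply (hasFDerivAt_const v z)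
    have h2 := (hasFDerivAt_Ad_apply (n := n) hg0.inv
      (ha.hasFDerivAt.clm_apply (hasFDerivAt_const v z))).add
      (((SmoothAt.logDer hg0).differentiableAt (by simp)).hasFDerivAt.clm_apply
        (hasFDerivAt_const v z))
    have h3 := congrArg (fun L : ℂ →L[ℝ] Eu n => L u) (h1.unique h2)
    simpa [lieBr_eq_lieBrL] using h3
  -- The Maurer-Cartan equation for g cancels the inhomogeneous part of the transformation law.
  have hmc := maurerCartan hg u v
  rw [formCurv, formCurv, hd, hd, hb.self_of_nhds, logDer_inv hg0]
  simp only [add_apply, ContinuousLinearMap.comp_apply, neg_apply, lieBr_add_left, lieBr_add_right,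
    lieBr_neg_left, map_add, map_sub, map_neg, Ad_lieBr, Ad_inv_Ad]
  rw [lieBr_skew (logDer n g z v) (Ad n (g z)⁻¹ (a z u))]
  have h4 : fderiv ℝ (logDer n g) z u v = fderiv ℝ (logDer n g) z v u +
      -lieBr n G (logDer n g z u) (logDer n g z v) := by
    rw [← hmc]; abel
  rw [h4]
  abel

end FormsInCoordinates

/-! ### Trivializing flat connections over discs -/

section FlatSections

open Set Filter Topology

variable {n : ℕ} {G : Type*} [Group G] [TopologicalSpace G]
  [ChartedSpace (EuclideanSpace ℝ (Fin n)) G] [LieGroup (𝓡 n) ∞ G]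

/-- A flat connection on a principal bundle over the plane, described by local sections over an
open cover. -/
structure FlatConnection (n : ℕ) (G : Type*) [Group G] [TopologicalSpace G]
    [ChartedSpace (EuclideanSpace ℝ (Fin n)) G] [LieGroup (𝓡 n) ∞ G] where
  ι : Type
  O : ι → Set ℂ
  isOpen : ∀ i, IsOpen (O i)
  cover : ∀ z, ∃ i, z ∈ O i
  g : ι → ι → ℂ → G
  smooth_g : ∀ i j, ∀ z ∈ O i ∩ O j, SmoothAt n (g i j) z
  cocycle : ∀ i j k, ∀ z ∈ O i ∩ O j ∩ O k, g i j z * g j k z = g i k z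
  b : ι → ℂ → ℂ →L[ℝ] Eu n
  smooth_b : ∀ i, ∀ z ∈ O i, ContDiffAt ℝ ∞ (b i) z
  flat : ∀ i, ∀ z ∈ O i, ∀ u v, formCurv n G (b i) z u v = 0
  compat : ∀ i j, ∀ z ∈ O i ∩ O j, b j z = (Ad n (g i j z)⁻¹).comp (b i z) + logDer n (g i j) z

namespace FlatConnection

/-- A trivialization of a flat connection over `Ω`. -/
def IsTrivialization (B : FlatConnection n G) (Ω : Set ℂ) (f : B.ι → ℂ → G) : Prop :=
  ∀ i, ∀ z ∈ B.O i ∩ Ω, SmoothAt n (f i) z ∧ logDer n (f i) z = B.b i z ∧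
    ∀ j, z ∈ B.O j → f i z * B.g i j z = f j z

variable {B : FlatConnection n G} {Ω Ω' : Set ℂ} {f f' : B.ι → ℂ → G}

lemma IsTrivialization.mono (hf : B.IsTrivialization Ω f) (h : Ω' ⊆ Ω) :
    B.IsTrivialization Ω' f := fun i z hz => hf i z ⟨hz.1, h hz.2⟩

lemma IsTrivialization.const_mul (hf : B.IsTrivialization Ω f) (c : G) :
    B.IsTrivialization Ω (fun i z => c * f i z) := fun i z hz => by
  obtain ⟨h1, h2, h3⟩ := hf i z hz
  refine ⟨smoothAt_const.mul h1, ?_, fun j hj => ?_⟩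
  · rw [← h2]; exact congrFun (logDer_const_mul c _) z
  · rw [mul_assoc, h3 j hj]

/-- By flatness the form of one local section is a logarithmic derivative df = f b; the transition
functions carry this f to every other section. -/
lemma exists_isTrivialization_ball (B : FlatConnection n G) (z : ℂ) :
    ∃ r > 0, ∃ f, B.IsTrivialization (Metric.ball z r) f := by
  obtain ⟨i, hi⟩ := B.cover z
  have ho := (B.isOpen i).mem_nhds hi
  obtain ⟨f, -, hf⟩ := exists_logDer_eq (n := n) (α := B.b i) (x₀ := z) (1 : G)
    (by filter_upwards [ho] with w hw using B.smooth_b i w hw)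
    (by filter_upwards [ho] with w hw using B.flat i w hw)
  obtain ⟨r, hr, hball⟩ := Metric.eventually_nhds_iff_ball.1 (hf.and ho)
  refine ⟨r, hr, fun j w => f w * B.g i j w, fun j w hw => ?_⟩
  obtain ⟨⟨h1, h2⟩, h3⟩ := hball w hw.2
  have hs := B.smooth_g i j w ⟨h3, hw.1⟩
  refine ⟨h1.mul hs, ?_, fun k hk => ?_⟩
  · have h4 := logDer_mul h1 hs
    rw [h2, ← B.compat i j w ⟨h3, hw.1⟩] at h4
    exact h4
  · rw [mul_assoc, B.cocycle i j k w ⟨⟨h3, hw.1⟩, hk⟩]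

/-- The quotient f f'⁻¹ does not depend on the local section and has vanishing logarithmic
derivative. -/
lemma IsTrivialization.exists_eq_mul (hΩ : IsOpen Ω) (hc : IsPreconnected Ω)
    (hf : B.IsTrivialization Ω f) (hf' : B.IsTrivialization Ω f') :
    ∃ c : G, ∀ i, ∀ z ∈ B.O i ∩ Ω, f i z = c * f' i z := by
  rcases Ω.eq_empty_or_nonempty with rfl | ⟨z₀, hz₀⟩
  · exact ⟨1, fun i z hz => hz.2.elim⟩
  choose c hc' using B.cover
  set q : ℂ → G := fun z => f (c z) z * (f' (c z) z)⁻¹ with hq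
  have hq' : ∀ i, ∀ z ∈ B.O i ∩ Ω, q z = f i z * (f' i z)⁻¹ := by
    intro i z hz
    rw [← (hf _ z ⟨hc' z, hz.2⟩).2.2 i hz.1, ← (hf' _ z ⟨hc' z, hz.2⟩).2.2 i hz.1]
    simp [hq, mul_assoc]
  have hev : ∀ z ∈ Ω, q =ᶠ[𝓝 z] fun w => f (c z) w * (f' (c z) w)⁻¹ := by
    intro z hz
    filter_upwards [((B.isOpen _).inter hΩ).mem_nhds ⟨hc' z, hz⟩] with w hw using hq' _ w hw
  have hs : ∀ z ∈ Ω, SmoothAt n q z := fun z hz =>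
    ((hf _ z ⟨hc' z, hz⟩).1.mul (hf' _ z ⟨hc' z, hz⟩).1.inv).congr_of_eventuallyEq (hev z hz)
  have h0 : ∀ z ∈ Ω, logDer n q z = 0 := by
    intro z hz
    obtain ⟨h1, h2, -⟩ := hf _ z ⟨hc' z, hz⟩
    obtain ⟨h1', h2', -⟩ := hf' _ z ⟨hc' z, hz⟩
    rw [logDer_congr (hev z hz), logDer_mul h1 h1'.inv, logDer_inv h1', h2, h2', inv_inv,
      add_neg_cancel]
  refine ⟨q z₀, fun i z hz => ?_⟩
  rw [eq_of_logDer_eq_zero hΩ hc hs h0 hz₀ hz.2, hq' i z hz, inv_mul_cancel_right]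

/-- Over a connected overlap two trivializations differ by a constant, which can be absorbed into
one of them. -/
lemma IsTrivialization.union (hΩ : IsOpen Ω) (hΩ' : IsOpen Ω') (hc : IsPreconnected (Ω ∩ Ω'))
    (hf : B.IsTrivialization Ω f) (hf' : B.IsTrivialization Ω' f') :
    ∃ F, B.IsTrivialization (Ω ∪ Ω') F := by
  classical
  obtain ⟨c, hcc⟩ := (hf.mono inter_subset_left).exists_eq_mul (hΩ.inter hΩ') hc
    (hf'.mono inter_subset_right)
  set F : B.ι → ℂ → G := fun i z => if z ∈ Ω then f i z else c * f' i z with hF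
  have h1 : ∀ i, ∀ z ∈ Ω, F i z = f i z := fun i z hz => if_pos hz
  have h2 : ∀ i, ∀ z ∈ B.O i ∩ Ω', F i z = c * f' i z := by
    intro i z hz
    by_cases hzΩ : z ∈ Ω
    · rw [h1 i z hzΩ, hcc i z ⟨hz.1, hzΩ, hz.2⟩]
    · exact if_neg hzΩ
  refine ⟨F, fun i z hz => ?_⟩
  rcases hz.2 with hzΩ | hzΩ
  · obtain ⟨k1, k2, k3⟩ := hf i z ⟨hz.1, hzΩ⟩
    have hev : F i =ᶠ[𝓝 z] f i := by
      filter_upwards [hΩ.mem_nhds hzΩ] with w hw using h1 i w hw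
    exact ⟨k1.congr_of_eventuallyEq hev, by rw [logDer_congr hev, k2], fun j hj => by
      rw [h1 i z hzΩ, h1 j z hzΩ, k3 j hj]⟩
  · obtain ⟨k1, k2, k3⟩ := hf'.const_mul c i z ⟨hz.1, hzΩ⟩
    have hev : F i =ᶠ[𝓝 z] fun w => c * f' i w := by
      filter_upwards [((B.isOpen i).inter hΩ').mem_nhds ⟨hz.1, hzΩ⟩] with w hw using h2 i w hw
    exact ⟨k1.congr_of_eventuallyEq hev, by rw [logDer_congr hev, k2], fun j hj => by
      rw [h2 i z ⟨hz.1, hzΩ⟩, h2 j z ⟨hj, hzΩ⟩]; exact k3 j hj⟩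

/-- Slabs of width δ are glued one after another, advancing by δ/2; successive overlaps are convex,
hence connected. -/
lemma exists_isTrivialization_of_slabs {C : Set ℂ} (hCo : IsOpen C) (hC : Convex ℝ C)
    (L : ℂ →L[ℝ] ℝ) {a b δ : ℝ} (hδ : 0 < δ)
    (h : ∀ x ∈ Icc a b, ∃ f, B.IsTrivialization (C ∩ L ⁻¹' Ioo x (x + δ)) f) :
    ∃ f, B.IsTrivialization (C ∩ L ⁻¹' Ioo a b) f := by
  rcases lt_or_ge b a with hab | hab
  · exact ⟨fun _ _ => 1, fun i z hz => absurd (hz.2.2.1.trans hz.2.2.2) hab.not_gt⟩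
  have hopen : ∀ x y, IsOpen (C ∩ L ⁻¹' Ioo x y) := fun x y =>
    hCo.inter (isOpen_Ioo.preimage L.continuous)
  have hconv : ∀ x y, Convex ℝ (C ∩ L ⁻¹' Ioo x y) := fun x y =>
    hC.inter ((convex_Ioo x y).linear_preimage L.toLinearMap)
  have key : ∀ k : ℕ, ∃ f, B.IsTrivialization (C ∩ L ⁻¹' Ioo a (min b (a + (k + 1) * (δ / 2)))) f := by
    intro k
    induction k with
    | zero =>
      obtain ⟨f, hf⟩ := h a ⟨le_rfl, hab⟩
      refine ⟨f, hf.mono fun z hz => ⟨hz.1, hz.2.1, ?_⟩⟩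
      have := hz.2.2.trans_le (min_le_right _ _)
      simp only [Nat.cast_zero] at this
      linarith
    | succ k ih =>
      obtain ⟨f, hf⟩ := ih
      rcases le_or_gt b (a + (k + 1) * (δ / 2)) with hb | hb
      · rw [min_eq_left hb] at hf
        exact ⟨f, hf.mono fun z hz => ⟨hz.1, hz.2.1, hz.2.2.trans_le (min_le_left _ _)⟩⟩
      -- The next slab begins δ/2 before the end of the region already covered and reaches δ/2
      -- beyond it.
      set x := a + k * (δ / 2) with hx
      have hx0 : a ≤ x := by have : 0 ≤ k * (δ / 2) := by positivity
                             linarith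
      have hxb : a + (k + 1) * (δ / 2) = x + δ / 2 := by rw [hx]; ring
      rw [hxb] at hb hf
      rw [min_eq_right hb.le] at hf
      obtain ⟨f', hf'⟩ := h x ⟨hx0, by linarith⟩
      have hint : C ∩ L ⁻¹' Ioo a (x + δ / 2) ∩ (C ∩ L ⁻¹' Ioo x (x + δ)) =
          C ∩ L ⁻¹' Ioo x (x + δ / 2) := by
        ext z
        simp only [mem_inter_iff, mem_preimage, mem_Ioo]
        constructor
        · rintro ⟨⟨h1, h2, h3⟩, -, h4, -⟩
          exact ⟨h1, h4, h3⟩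
        · rintro ⟨h1, h2, h3⟩
          exact ⟨⟨h1, by linarith, h3⟩, h1, h2, by linarith⟩
      obtain ⟨F, hF⟩ := hf.union (hopen _ _) (hopen _ _)
        (by rw [hint]; exact (hconv _ _).isPreconnected) hf'
      refine ⟨F, hF.mono fun z hz => ?_⟩
      rcases lt_or_ge (L z) (x + δ / 2) with hlt | hge
      · exact Or.inl ⟨hz.1, hz.2.1, hlt⟩
      · refine Or.inr ⟨hz.1, by linarith, ?_⟩
        have := hz.2.2.trans_le (min_le_right _ _)
        push_cast at this
        rw [hx]
        linarith
  obtain ⟨k, hk⟩ := exists_nat_gt ((b - a) / (δ / 2))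
  obtain ⟨f, hf⟩ := key k
  rw [min_eq_left] at hf
  · exact ⟨f, hf⟩
  · rw [div_lt_iff₀ (by positivity)] at hk
    linarith

/-- A Lebesgue number bounds the size of squares on which trivializations exist. Gluing squares
along the real direction gives strips, and gluing strips along the imaginary direction gives the
large square containing the disc. -/
lemma exists_isTrivialization (B : FlatConnection n G) (R : ℝ) :
    ∃ f, B.IsTrivialization (Metric.ball 0 R) f := by
  choose r hr f hf using B.exists_isTrivialization_ball
  obtain ⟨δ, hδ, hleb⟩ := lebesgue_number_lemma_of_metric
    (c := fun z => Metric.ball z (r z)) (isCompact_Icc.reProdIm isCompact_Icc :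
      IsCompact (Icc (-R) R ×ℂ Icc (-R) R)) (fun _ => Metric.isOpen_ball)
    (fun z _ => mem_iUnion.2 ⟨z, Metric.mem_ball_self (hr z)⟩)
  obtain ⟨F, hF⟩ := exists_isTrivialization_of_slabs (B := B) (a := -R) (b := R) (δ := δ / 2)
    (isOpen_Ioo.preimage Complex.continuous_re : IsOpen (Complex.reCLM ⁻¹' Ioo (-R) R))
    ((convex_Ioo (-R) R).linear_preimage Complex.reCLM.toLinearMap) Complex.imCLM (half_pos hδ)
    (fun y hy => by
      obtain ⟨F, hF⟩ := exists_isTrivialization_of_slabs (B := B) (a := -R) (b := R) (δ := δ / 2)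
        (isOpen_Ioo.preimage Complex.continuous_im :
          IsOpen (Complex.imCLM ⁻¹' Ioo y (y + δ / 2)))
        ((convex_Ioo y (y + δ / 2)).linear_preimage Complex.imCLM.toLinearMap) Complex.reCLM
        (half_pos hδ) (fun x hx => by
          obtain ⟨w, hw⟩ := hleb (⟨x, y⟩ : ℂ) ⟨hx, hy⟩
          refine ⟨f w, (hf w).mono fun z hz => hw ?_⟩
          obtain ⟨⟨h1, h2⟩, h3, h4⟩ := hz
          simp only [Complex.reCLM_apply] at h1 h2 h3 h4
          rw [Metric.mem_ball, dist_eq_norm]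
          -- Both coordinates differ by less than δ/2, so the distance to the corner is below δ.
          refine (Complex.norm_le_abs_re_add_abs_im _).trans_lt ?_
          simp only [Complex.sub_re, Complex.sub_im]
          rw [abs_of_pos (by linarith), abs_of_pos (by linarith)]
          linarith)
      exact ⟨F, hF.mono fun z hz => ⟨hz.2, hz.1⟩⟩)
  refine ⟨F, hF.mono fun z hz => ?_⟩
  rw [mem_ball_zero_iff] at hz
  exact ⟨abs_lt.1 ((Complex.abs_re_le_norm z).trans_lt hz),
    abs_lt.1 ((Complex.abs_im_le_norm z).trans_lt hz)⟩

/-- A parallel section of the adjoint bundle is constant in a trivialization. -/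
lemma IsTrivialization.exists_Ad_eq (hΩ : IsOpen Ω) (hc : IsPreconnected Ω)
    (hf : B.IsTrivialization Ω f) {ξ : B.ι → ℂ → Eu n}
    (hξ : ∀ i, ∀ z ∈ B.O i, DifferentiableAt ℝ (ξ i) z)
    (hpar : ∀ i, ∀ z ∈ B.O i, ∀ u, fderiv ℝ (ξ i) z u + lieBr n G (B.b i z u) (ξ i z) = 0)
    (hglue : ∀ i j, ∀ z ∈ B.O i ∩ B.O j, ξ j z = Ad n (B.g i j z)⁻¹ (ξ i z)) :
    ∃ M : Eu n, ∀ i, ∀ z ∈ B.O i ∩ Ω, Ad n (f i z) (ξ i z) = M := by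
  rcases Ω.eq_empty_or_nonempty with rfl | ⟨z₀, hz₀⟩
  · exact ⟨0, fun i z hz => hz.2.elim⟩
  choose c hc' using B.cover
  set q : ℂ → Eu n := fun z => Ad n (f (c z) z) (ξ (c z) z) with hq
  have hq' : ∀ i, ∀ z ∈ B.O i ∩ Ω, q z = Ad n (f i z) (ξ i z) := by
    intro i z hz
    rw [← (hf _ z ⟨hc' z, hz.2⟩).2.2 i hz.1, hglue _ i z ⟨hc' z, hz.1⟩, Ad_mul_apply,
      Ad_Ad_inv]
  have hev : ∀ z ∈ Ω, q =ᶠ[𝓝 z] fun w => Ad n (f (c z) w) (ξ (c z) w) := by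
    intro z hz
    filter_upwards [((B.isOpen _).inter hΩ).mem_nhds ⟨hc' z, hz⟩] with w hw using hq' _ w hw
  have hd : ∀ z ∈ Ω, HasFDerivAt q (0 : ℂ →L[ℝ] Eu n) z := by
    intro z hz
    obtain ⟨h1, h2, -⟩ := hf _ z ⟨hc' z, hz⟩
    have h3 := hasFDerivAt_Ad_apply h1 (hξ _ z (hc' z)).hasFDerivAt
    refine (h3.congr_of_eventuallyEq (hev z hz)).congr_fderiv ?_
    ext1 u
    have h4 := hpar _ z (hc' z) u
    rw [h2]
    simp only [ContinuousLinearMap.comp_apply, add_apply, ContinuousLinearMap.flip_apply,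
      zero_apply, ← lieBr_eq_lieBrL]
    rw [add_comm, h4, map_zero]
  refine ⟨q z₀, fun i z hz => ?_⟩
  rw [← hq' i z hz]
  exact hΩ.is_const_of_fderiv_eq_zero (𝕜 := ℝ) hc (fun w hw => (hd w hw).differentiableAt.differentiableWithinAt)
    (fun w hw => (hd w hw).fderiv) hz.2 hz₀

end FlatConnection

end FlatSections

/-! ### Yang-Mills connections on a disc in normal form -/

section AdaptedSections

open Set Filter Topology

variable {n : ℕ} {G : Type*} [Group G] [TopologicalSpace G]
  [ChartedSpace (EuclideanSpace ℝ (Fin n)) G] [LieGroup (𝓡 n) ∞ G]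

/-- The area form of the plane, as a bilinear map. -/
def wedgeL : ℂ →L[ℝ] ℂ →L[ℝ] ℝ :=
  Complex.reCLM.smulRight Complex.imCLM - Complex.imCLM.smulRight Complex.reCLM

@[simp] lemma wedgeL_apply (u v : ℂ) : wedgeL u v = wedge u v := by
  simp [wedgeL, wedge]

/-- A primitive of the area form in stereographic coordinates. -/
def areaPrim (h : SphereMetric) (s : Bool) (z : ℂ) : ℂ →L[ℝ] ℝ := areaPot h s z • wedgeL z

lemma areaPrim_apply (h : SphereMetric) (s : Bool) (z v : ℂ) :
    areaPrim h s z v = areaPot h s z * wedge z v := by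
  simp [areaPrim]

lemma contDiff_areaPrim (h : SphereMetric) (s : Bool) : ContDiff ℝ ∞ (areaPrim h s) :=
  (contDiff_areaPot h s).smul wedgeL.contDiff

/-- Antisymmetrizing the product rule leaves the potential twice and its radial derivative, which
sum to the area coefficient by `fderiv_areaPot_self`. -/
lemma fderiv_areaPrim (h : SphereMetric) (s : Bool) (z u v : ℂ) :
    fderiv ℝ (areaPrim h s) z u v - fderiv ℝ (areaPrim h s) z v u = areaCoeff h s z * wedge u v := by
  have h1 : HasFDerivAt (areaPrim h s)
      (areaPot h s z • wedgeL + (fderiv ℝ (areaPot h s) z).smulRight (wedgeL z)) z :=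
    (((contDiff_areaPot h s).differentiable (by simp) z).hasFDerivAt).smul wedgeL.hasFDerivAt
  rw [h1.fderiv, ← fderiv_areaPot_self]
  set ℓ := fderiv ℝ (areaPot h s) z
  have h2 : ∀ w, ℓ w = w.re * ℓ 1 + w.im * ℓ Complex.I := fun w => by
    conv_lhs => rw [show w = w.re • (1 : ℂ) + w.im • Complex.I by simp [Complex.re_add_im]]
    simp only [map_add, map_smul, smul_eq_mul]
  simp only [add_apply, smul_apply, ContinuousLinearMap.smulRight_apply, wedgeL_apply, smul_eq_mul]
  rw [h2 u, h2 v, h2 z]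
  simp only [wedge]
  ring

lemma contDiffAt_smulRight {E F : Type*} [NormedAddCommGroup E] [NormedSpace ℝ E]
    [NormedAddCommGroup F] [NormedSpace ℝ F] {c : E → E →L[ℝ] ℝ} {f : E → F} {z : E}
    (hc : ContDiffAt ℝ ∞ c z) (hf : ContDiffAt ℝ ∞ f z) :
    ContDiffAt ℝ ∞ (fun z => (c z).smulRight (f z)) z :=
  (ContinuousLinearMap.smulRightL ℝ E F).isBoundedBilinearMap.contDiff.contDiffAt.comp z
    (hc.prodMk hf)

/-- Gauge covariance of the dual of the curvature. -/
lemma stereoStar_gauge (h : SphereMetric) {A B : LieOneForm n G} {U V : Set S2} {g : S2 → G}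
    (hA : A.SmoothOn U) (hU : IsOpen U) (hV : IsOpen V) (hg : ContMDiffOn (𝓡 2) (𝓡 n) ∞ g (U ∩ V))
    (hc : ∀ x ∈ U ∩ V, ∀ u : TangentSpace (𝓡 2) x,
      B x u = adjointAction n (g x)⁻¹ (A x u) + logDerivative n g x u)
    {s : Bool} {z : ℂ} (hz : stereo s z ∈ U ∩ V) :
    stereoStar h B s z = Ad n (g (stereo s z))⁻¹ (stereoStar h A s z) := by
  have hev := eventually_stereo_mem (hU.inter hV) hz
  have hga : ∀ x ∈ U ∩ V, ContMDiffAt (𝓡 2) (𝓡 n) ∞ g x := fun x hx =>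
    hg.contMDiffAt ((hU.inter hV).mem_nhds hx)
  rw [stereoStar, stereoStar, map_smul]
  congr 1
  refine formCurv_gauge (g := fun w => g (stereo s w))
    ((contDiffAt_stereoForm hA hU hz.1).differentiableAt (by simp)) ?_ ?_ _ _
  · filter_upwards [hev] with w hw
    exact ContMDiffAt.comp w (hga _ hw) (contMDiff_stereo s w)
  · filter_upwards [hev] with w hw
    exact (gauge_iff (hga _ hw)).1 (hc _ hw)

lemma contMDiffAt_g (P : BundleConnection n G) {i j : P.ι} {x : S2} (hx : x ∈ P.U i ∩ P.U j) :
    ContMDiffAt (𝓡 2) (𝓡 n) ∞ (P.g i j) x :=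
  (P.smooth_g i j).contMDiffAt (((P.isOpen i).inter (P.isOpen j)).mem_nhds hx)

lemma fderiv_stereoStar_eq {h : SphereMetric} {P : BundleConnection n G} (hP : IsYangMills h P)
    {s : Bool} {i : P.ι} {z : ℂ} (hz : stereo s z ∈ P.U i) (v : ℂ) :
    fderiv ℝ (stereoStar h (P.A i) s) z v +
      lieBr n G (stereoForm (P.A i) s z v) (stereoStar h (P.A i) s z) = 0 := by
  rw [← covDerivative_stereoDeriv h (P.smooth_A i) (P.isOpen i) hz]
  exact congrArg lieCoord (hP i _ hz _)

/-- Subtracting the curvature part from a Yang-Mills connection yields a flat connection. -/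
def yangMillsFlat {h : SphereMetric} {P : BundleConnection n G} (hP : IsYangMills h P) (s : Bool) :
    FlatConnection n G where
  ι := P.ι
  O i := stereo s ⁻¹' P.U i
  isOpen i := (P.isOpen i).preimage (contMDiff_stereo s).continuous
  cover z := P.cover _
  g i j z := P.g i j (stereo s z)
  smooth_g i j z hz := ContMDiffAt.comp z (contMDiffAt_g P hz) (contMDiff_stereo s z)
  cocycle i j k z hz := P.cocycle i j k _ hz
  b i z := stereoForm (P.A i) s z - (areaPrim h s z).smulRight (stereoStar h (P.A i) s z)
  smooth_b i z hz := by
    exact (contDiffAt_stereoForm (P.smooth_A i) (P.isOpen i) hz).sub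
      (contDiffAt_smulRight (contDiff_areaPrim h s).contDiffAt
        (contDiffAt_stereoStar h (P.smooth_A i) (P.isOpen i) hz))
  -- With dθ the area form, subtracting θξ removes the curvature ξ dθ. The cross terms combine to θ
  -- ∧ d_A ξ = 0, and the quadratic term vanishes because [ξ, ξ] = 0.
  flat i z hz u v := by
    set a := stereoForm (P.A i) s with ha
    set ξ := stereoStar h (P.A i) s with hξ
    set θ := areaPrim h s with hθ
    have had : DifferentiableAt ℝ a z :=
      (contDiffAt_stereoForm (P.smooth_A i) (P.isOpen i) hz).differentiableAt (by simp)
    have hξd : DifferentiableAt ℝ ξ z :=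
      (contDiffAt_stereoStar h (P.smooth_A i) (P.isOpen i) hz).differentiableAt (by simp)
    have hθd : DifferentiableAt ℝ θ z := (contDiff_areaPrim h s).differentiable (by simp) z
    have hpar : ∀ v, fderiv ℝ ξ z v = - lieBr n G (a z v) (ξ z) := fun v =>
      eq_neg_of_add_eq_zero_left (fderiv_stereoStar_eq hP hz v)
    have hd : ∀ u v, fderiv ℝ (fun z => a z - (θ z).smulRight (ξ z)) z u v =
        fderiv ℝ a z u v - (fderiv ℝ θ z u v • ξ z + θ z v • fderiv ℝ ξ z u) := by
      intro u v
      have h0 : DifferentiableAt ℝ (fun z => a z - (θ z).smulRight (ξ z)) z :=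
        had.sub ((contDiffAt_smulRight (contDiff_areaPrim h s).contDiffAt
          (contDiffAt_stereoStar h (P.smooth_A i) (P.isOpen i) hz)).differentiableAt (by simp))
      have h1 := h0.hasFDerivAt.clm_apply (hasFDerivAt_const v z)
      have h2 := (had.hasFDerivAt.clm_apply (hasFDerivAt_const v z)).sub
        ((hθd.hasFDerivAt.clm_apply (hasFDerivAt_const v z)).smul hξd.hasFDerivAt)
      have h3 := congrArg (fun L : ℂ →L[ℝ] Eu n => L u) (h1.unique h2)
      simpa [add_comm] using h3
    have hF := formCurv_eq_stereoStar h (P.A i) s z u v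
    rw [← fderiv_areaPrim, formCurv] at hF
    rw [formCurv, hd, hd, hpar, hpar]
    simp only [sub_apply, ContinuousLinearMap.smulRight_apply, lieBr_sub_left, lieBr_sub_right,
      lieBr_smul_left, lieBr_smul_right, lieBr_self, lieBr_skew (ξ z) (a z v)]
    rw [← ha, ← hξ, ← hθ] at hF
    have hF' : fderiv ℝ a z u v = (fderiv ℝ θ z u v - fderiv ℝ θ z v u) • ξ z -
        lieBr n G (a z u) (a z v) + fderiv ℝ a z v u := by
      rw [← hF]; abel
    rw [hF']
    module
  compat i j z hz := by
    have h1 := (gauge_iff (contMDiffAt_g P hz)).1 (P.compat i j _ hz)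
    rw [h1, stereoStar_gauge h (P.smooth_A i) (P.isOpen i) (P.isOpen j) (P.smooth_g i j)
      (P.compat i j) hz]
    ext1 v
    simp only [sub_apply, add_apply, ContinuousLinearMap.comp_apply,
      ContinuousLinearMap.smulRight_apply, map_sub, map_smul]
    abel

/-- Sections over a stereographic disc, relative to which the connection is `M` times the
primitive of the area form: `f i` is the transition function to the local section `i`. -/
def IsAdapted (h : SphereMetric) (P : BundleConnection n G) (s : Bool) (M : Eu n)
    (f : P.ι → ℂ → G) : Prop :=
  ∀ i, ∀ z ∈ Metric.ball (0 : ℂ) 2, stereo s z ∈ P.U i →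
    SmoothAt n (f i) z ∧ Ad n (f i z) (stereoStar h (P.A i) s z) = M ∧
    logDer n (f i) z =
      stereoForm (P.A i) s z - (areaPrim h s z).smulRight (stereoStar h (P.A i) s z) ∧
    ∀ j, stereo s z ∈ P.U j → f i z * P.g i j (stereo s z) = f j z

/-- Trivialize the flat part over the disc; the parallel section ξ then becomes a constant M, and
only θM is left of the connection. -/
lemma exists_isAdapted {h : SphereMetric} {P : BundleConnection n G} (hP : IsYangMills h P)
    (s : Bool) : ∃ M f, IsAdapted h P s M f := by
  obtain ⟨f, hf⟩ := (yangMillsFlat hP s).exists_isTrivialization 2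
  obtain ⟨M, hM⟩ := hf.exists_Ad_eq Metric.isOpen_ball (convex_ball (0 : ℂ) 2).isPreconnected
    (ξ := fun i => stereoStar h (P.A i) s)
    (fun i z hz =>
      (contDiffAt_stereoStar h (P.smooth_A i) (P.isOpen i) hz).differentiableAt (by simp))
    -- ξ stays parallel for the flat connection, since the subtracted part commutes with ξ.
    (fun i z hz u => by
      refine Eq.trans ?_ (fderiv_stereoStar_eq hP hz u)
      simp [yangMillsFlat, lieBr_sub_left, lieBr_smul_left, lieBr_self])
    (fun i j z hz => stereoStar_gauge h (P.smooth_A i) (P.isOpen i) (P.isOpen j) (P.smooth_g i j)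
      (P.compat i j) hz)
  refine ⟨M, f, fun i z hz hzU => ?_⟩
  obtain ⟨h1, h2, h3⟩ := hf i z ⟨hzU, hz⟩
  exact ⟨h1, hM i z ⟨hzU, hz⟩, h2, h3⟩

lemma IsAdapted.const_mul {h : SphereMetric} {P : BundleConnection n G} {s : Bool} {M : Eu n}
    {f : P.ι → ℂ → G} (hf : IsAdapted h P s M f) (c : G) :
    IsAdapted h P s (Ad n c M) (fun i z => c * f i z) := fun i z hz hzU => by
  obtain ⟨h1, h2, h3, h4⟩ := hf i z hz hzU
  refine ⟨smoothAt_const.mul h1, by rw [Ad_mul_apply, h2],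
    (congrFun (logDer_const_mul c _) z).trans h3, fun j hj => by rw [mul_assoc, h4 j hj]⟩

end AdaptedSections

/-! ### The transition function on the overlap of the discs -/

section Transition

open Set Filter Topology

variable {n : ℕ} {G : Type*} [Group G] [TopologicalSpace G]
  [ChartedSpace (EuclideanSpace ℝ (Fin n)) G] [LieGroup (𝓡 n) ∞ G]

/-- The open annulus covered by both stereographic discs. -/
def annulus : Set ℂ := {z | ‖z‖ ∈ Ioo (2⁻¹ : ℝ) 2}

lemma isOpen_annulus : IsOpen annulus := isOpen_Ioo.preimage continuous_norm

lemma ne_zero_of_mem_annulus {z : ℂ} (hz : z ∈ annulus) : z ≠ 0 := by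
  rintro rfl
  have := hz.1
  rw [norm_zero] at this
  norm_num at this

lemma inversion_mem_annulus {z : ℂ} (hz : z ∈ annulus) : inversion z ∈ annulus := by
  have h0 := ne_zero_of_mem_annulus hz
  change ‖inversion z‖ ∈ Ioo (2⁻¹ : ℝ) 2
  rw [norm_inversion h0]
  have hp := norm_pos_iff.2 h0
  exact ⟨inv_strictAnti₀ hp hz.2, by simpa using inv_strictAnti₀ (by norm_num) hz.1⟩

lemma mem_ball_of_mem_annulus {z : ℂ} (hz : z ∈ annulus) : z ∈ Metric.ball (0 : ℂ) 2 :=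
  mem_ball_zero_iff.2 hz.2

lemma isPreconnected_annulus : IsPreconnected annulus := by
  have h1 : annulus = (fun p : ℝ × ℝ => (p.1 : ℂ) * Complex.exp (p.2 * Complex.I)) ''
      (Ioo (2⁻¹ : ℝ) 2 ×ˢ univ) := by
    ext z
    constructor
    · intro hz
      exact ⟨(‖z‖, z.arg), ⟨hz, mem_univ _⟩, Complex.norm_mul_exp_arg_mul_I z⟩
    · rintro ⟨⟨r, t⟩, ⟨hr, -⟩, rfl⟩
      have : ‖(r : ℂ) * Complex.exp (t * Complex.I)‖ = r := by
        rw [norm_mul, Complex.norm_exp_ofReal_mul_I, mul_one, Complex.norm_real,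
          Real.norm_of_nonneg]
        have := hr.1
        norm_num at this ⊢
        linarith
      rw [annulus, mem_ofPred_eq, this]
      exact hr
  rw [h1]
  exact (isPreconnected_Ioo.prod isPreconnected_univ).image _ (by fun_prop)

lemma inversion_eq_smul : inversion = fun z : ℂ => (z.re ^ 2 + z.im ^ 2)⁻¹ • z := by
  funext z
  apply Complex.ext <;>
    simp only [Complex.smul_re, Complex.smul_im, smul_eq_mul, inversion, div_eq_inv_mul]

lemma contDiffAt_inversion {z : ℂ} (hz : z ≠ 0) : ContDiffAt ℝ ∞ inversion z := by
  rw [inversion_eq_smul]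
  have hre : ContDiffAt ℝ ∞ Complex.re z := Complex.reCLM.contDiff.contDiffAt
  have him : ContDiffAt ℝ ∞ Complex.im z := Complex.imCLM.contDiff.contDiffAt
  exact (((hre.pow 2).add (him.pow 2)).inv (sq_add_sq_pos hz).ne').smul contDiffAt_id

/-- Inversion multiplies z by a positive function, and the derivative of that function contributes a
multiple of z, which the wedge kills. In other words, inversion preserves the angular form. -/
lemma wedge_fderiv_inversion {z : ℂ} (hz : z ≠ 0) (v : ℂ) :
    wedge (inversion z) (fderiv ℝ inversion z v) = wedge z v / (‖z‖ ^ 2) ^ 2 := by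
  set c : ℂ → ℝ := fun z => (z.re ^ 2 + z.im ^ 2)⁻¹ with hc
  have h1 : inversion = fun z : ℂ => c z • z := inversion_eq_smul
  have hre : ContDiffAt ℝ ∞ Complex.re z := Complex.reCLM.contDiff.contDiffAt
  have him : ContDiffAt ℝ ∞ Complex.im z := Complex.imCLM.contDiff.contDiffAt
  have hcd : DifferentiableAt ℝ c z :=
    (((hre.pow 2).add (him.pow 2)).inv (sq_add_sq_pos hz).ne').differentiableAt (by simp)
  have h2 := (hcd.hasFDerivAt.smul (hasFDerivAt_id z)).fderiv
  have h3 : fderiv ℝ inversion z v = c z • v + (fderiv ℝ c z v) • z := by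
    rw [h1]
    refine (congrArg (fun L : ℂ →L[ℝ] ℂ => L v) h2).trans ?_
    simp
  rw [h3, h1, Complex.sq_norm, Complex.normSq_apply]
  simp only [wedge, Complex.add_re, Complex.add_im, Complex.smul_re, Complex.smul_im, smul_eq_mul]
  have h5 : c z = (z.re * z.re + z.im * z.im)⁻¹ := by simp [c, sq]
  rw [h5, div_eq_mul_inv, ← inv_pow]
  ring

/-- The difference of the primitives of the area form on the two stereographic discs. -/
def areaJump (h : SphereMetric) (z : ℂ) : ℂ →L[ℝ] ℝ :=
  areaPrim h true z - (areaPrim h false (inversion z)).comp (fderiv ℝ inversion z)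

/-- By `areaPot_sub_areaPot` the coefficient does not depend on the radius, so the jump is a
function of the angle times the angular form (x dy - y dx)/|z|². -/
lemma areaJump_apply (h : SphereMetric) {z : ℂ} (hz : z ≠ 0) (v : ℂ) :
    areaJump h z v = areaRate h (‖z‖⁻¹ • z) * (wedge z v / ‖z‖ ^ 2) := by
  have hp := norm_pos_iff.2 hz
  set u : ℂ := ‖z‖⁻¹ • z with hu
  have hu1 : ‖u‖ = 1 := by rw [hu, norm_smul, norm_inv, norm_norm, inv_mul_cancel₀ hp.ne']
  have hzu : z = ‖z‖ • u := by rw [hu, smul_smul, mul_inv_cancel₀ hp.ne', one_smul]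
  have h1 := areaPot_sub_areaPot h hp hu1
  rw [← inversion_smul hp.ne' hu1, ← hzu] at h1
  rw [areaJump, sub_apply, ContinuousLinearMap.comp_apply, areaPrim_apply, areaPrim_apply,
    wedge_fderiv_inversion hz, ← h1]
  field_simp

lemma stereoForm_inversion (A : LieOneForm n G) {z : ℂ} (hz : z ≠ 0) :
    stereoForm A true z = (stereoForm A false (inversion z)).comp (fderiv ℝ inversion z) := by
  have h1 : stereo false ∘ inversion =ᶠ[𝓝 z] stereo true := by
    filter_upwards [isOpen_ne.mem_nhds hz] with w hw using stereo_inversion true hw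
  have h2 := mfderiv_comp z ((contMDiff_stereo false (inversion z)).mdifferentiableAt (by simp))
    ((contDiffAt_inversion hz).differentiableAt (by simp)).mdifferentiableAt
  rw [mfderiv_eq_fderiv] at h2
  have h3 : (mfderiv 𝓘(ℝ, ℂ) (𝓡 2) (stereo true) z : ℂ →L[ℝ] Eu 2) =
      (mfderiv 𝓘(ℝ, ℂ) (𝓡 2) (stereo false) (inversion z) : ℂ →L[ℝ] Eu 2).comp
        (fderiv ℝ inversion z) :=
    (h1.mfderiv_eq (I := 𝓘(ℝ, ℂ)) (I' := 𝓡 2)).symm.trans h2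
  let A' : S2 → (Eu 2 →L[ℝ] Eu n) := A
  have h4 : A' (stereo false (inversion z)) = A' (stereo true z) := congrArg A' h1.self_of_nhds
  change (A' (stereo true z)).comp _ = ((A' (stereo false (inversion z))).comp _).comp _
  rw [h4, ContinuousLinearMap.comp_assoc]
  exact congrArg (A' (stereo true z)).comp h3

lemma stereoStar_inversion (h : SphereMetric) {A : LieOneForm n G} {U : Set S2}
    (hA : A.SmoothOn U) (hU : IsOpen U) {z : ℂ} (hz : z ≠ 0) (hzU : stereo true z ∈ U) :
    stereoStar h A false (inversion z) = stereoStar h A true z := by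
  have h1 : stereo false (inversion z) = stereo true z := stereo_inversion true hz
  rw [← starCurvature_stereo h hA hU hzU, ← starCurvature_stereo h hA hU (by rwa [h1]), h1]

/-- `T` is the transition function between adapted sections on the two stereographic discs. -/
def IsTransition (h : SphereMetric) (P : BundleConnection n G) (M : Bool → Eu n)
    (f : Bool → P.ι → ℂ → G) (T : ℂ → G) : Prop :=
  ∀ z ∈ annulus, SmoothAt n T z ∧ logDer n T z = (areaJump h z).smulRight (M true) ∧
    M false = Ad n (T z) (M true) ∧
    ∀ i, stereo true z ∈ P.U i → f false i (inversion z) = T z * f true i z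

/-- The cocycle relations make f₋ f₊⁻¹ independent of the local section used to compute it. The
pullbacks of the connection form cancel in its logarithmic derivative and leave the jump of the
primitives times M. -/
lemma exists_isTransition {h : SphereMetric} {P : BundleConnection n G} {M : Bool → Eu n}
    {f : Bool → P.ι → ℂ → G} (hf : ∀ s, IsAdapted h P s (M s) (f s)) :
    ∃ T, IsTransition h P M f T := by
  choose c hc using P.cover
  set T : ℂ → G := fun z => f false (c (stereo true z)) (inversion z) *
    (f true (c (stereo true z)) z)⁻¹ with hT
  have hst : ∀ z ∈ annulus, stereo false (inversion z) = stereo true z := fun z hz =>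
    stereo_inversion true (ne_zero_of_mem_annulus hz)
  have hT' : ∀ z ∈ annulus, ∀ i, stereo true z ∈ P.U i →
      T z = f false i (inversion z) * (f true i z)⁻¹ := by
    intro z hz i hi
    have h1 := (hf true _ z (mem_ball_of_mem_annulus hz) (hc _)).2.2.2 i hi
    have h2 := (hf false (c (stereo true z)) (inversion z)
      (mem_ball_of_mem_annulus (inversion_mem_annulus hz)) (by rw [hst z hz]; exact hc _)).2.2.2 i
      (by rwa [hst z hz])
    rw [hst z hz] at h2
    rw [← h1, ← h2]
    simp [hT, mul_assoc]
  refine ⟨T, fun z hz => ?_⟩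
  have hz0 := ne_zero_of_mem_annulus hz
  set i := c (stereo true z) with hi
  have hzU : stereo true z ∈ P.U i := hc _
  have hzU' : stereo false (inversion z) ∈ P.U i := by rwa [hst z hz]
  obtain ⟨k1, k2, k3, -⟩ := hf true i z (mem_ball_of_mem_annulus hz) hzU
  obtain ⟨l1, l2, l3, -⟩ := hf false i (inversion z)
    (mem_ball_of_mem_annulus (inversion_mem_annulus hz)) hzU'
  have hev : T =ᶠ[𝓝 z] fun w => f false i (inversion w) * (f true i w)⁻¹ := by
    filter_upwards [isOpen_annulus.mem_nhds hz, eventually_stereo_mem (P.isOpen i) hzU]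
      with w hwA hwU using hT' w hwA i hwU
  have hF := l1.comp (contDiffAt_inversion hz0)
  have hFl := logDer_comp l1 ((contDiffAt_inversion hz0).differentiableAt (by simp))
  have hstar := stereoStar_inversion h (P.smooth_A i) (P.isOpen i) hz0 hzU
  refine ⟨(hF.mul k1.inv).congr_of_eventuallyEq hev, ?_, ?_, fun j hj => ?_⟩
  · rw [logDer_congr hev, logDer_mul hF k1.inv, logDer_inv k1, hFl, l3, k3, hstar, inv_inv,
      stereoForm_inversion _ hz0]
    ext1 v
    simp only [areaJump, ← k2, sub_apply, add_apply, neg_apply, ContinuousLinearMap.comp_apply,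
      ContinuousLinearMap.smulRight_apply, map_sub, map_smul]
    module
  · rw [hT' z hz i hzU, Ad_mul_apply, ← k2, Ad_inv_Ad, ← hstar, l2]
  · rw [hT' z hz j hj, inv_mul_cancel_right]

end Transition

/-! ### Quantization of the curvature -/

section CurvatureGenerators

open Set Filter Topology

variable {n : ℕ} {G : Type*} [Group G] [TopologicalSpace G]
  [ChartedSpace (EuclideanSpace ℝ (Fin n)) G] [LieGroup (𝓡 n) ∞ G]

lemma contDiff_areaRate (h : SphereMetric) : ContDiff ℝ ∞ (areaRate h) :=
  (contDiff_areaPot h true).sub (contDiff_areaPot h false)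

lemma contDiff_exp_mul_I : ContDiff ℝ ∞ fun t : ℝ => Complex.exp (t * Complex.I) :=
  (Complex.contDiff_exp (𝕜 := ℝ)).comp (Complex.ofRealCLM.contDiff.mul contDiff_const)

/-- The area of the sector of the sphere between the angles `-π` and `φ`. -/
def sectorArea (h : SphereMetric) (φ : ℝ) : ℝ :=
  ∫ t in (-Real.pi)..φ, areaRate h (Complex.exp (t * Complex.I))

lemma continuous_areaRate_exp (h : SphereMetric) :
    Continuous fun t : ℝ => areaRate h (Complex.exp (t * Complex.I)) :=
  ((contDiff_areaRate h).comp contDiff_exp_mul_I).continuous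

lemma hasDerivAt_sectorArea (h : SphereMetric) (φ : ℝ) :
    HasDerivAt (sectorArea h) (areaRate h (Complex.exp (φ * Complex.I))) φ :=
  ((continuous_areaRate_exp h).integral_hasStrictDerivAt _ _).hasDerivAt

lemma contDiff_sectorArea (h : SphereMetric) : ContDiff ℝ ∞ (sectorArea h) := by
  rw [contDiff_infty_iff_deriv]
  refine ⟨fun φ => (hasDerivAt_sectorArea h φ).differentiableAt, ?_⟩
  rw [show deriv (sectorArea h) = _ from funext fun φ => (hasDerivAt_sectorArea h φ).deriv]
  exact (contDiff_areaRate h).comp contDiff_exp_mul_I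

lemma sectorArea_add_two_pi (h : SphereMetric) (φ : ℝ) :
    sectorArea h (φ + 2 * Real.pi) = sectorArea h φ + totalArea h := by
  have hc : ∀ a b, IntervalIntegrable (fun t : ℝ => areaRate h (Complex.exp (t * Complex.I)))
      MeasureTheory.volume a b := fun a b => (continuous_areaRate_exp h).intervalIntegrable a b
  have hp : Function.Periodic (fun t : ℝ => areaRate h (Complex.exp (t * Complex.I)))
      (2 * Real.pi) := fun t => by
    simp only []
    congr 1
    push_cast
    rw [add_mul, Complex.exp_periodic]
  have h1 := hp.intervalIntegral_add_eq φ (-Real.pi)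
  rw [show -Real.pi + 2 * Real.pi = Real.pi by ring, integral_areaRate] at h1
  rw [sectorArea, sectorArea, ← h1]
  exact (intervalIntegral.integral_add_adjacent_intervals (hc _ _) (hc _ _)).symm

lemma sectorArea_neg_pi (h : SphereMetric) : sectorArea h (-Real.pi) = 0 :=
  intervalIntegral.integral_same

lemma exp_mul_I_mem_annulus (φ : ℝ) : Complex.exp (φ * Complex.I) ∈ annulus := by
  rw [annulus, mem_ofPred_eq, Complex.norm_exp_ofReal_mul_I]
  norm_num

lemma one_mem_annulus : (1 : ℂ) ∈ annulus := by
  simpa using exp_mul_I_mem_annulus 0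

/-- Along the unit circle T solves the equation of exp(sM) with s the area of the sector swept out.
After one turn s has grown by the total area while T has returned to its initial value. -/
lemma expCurve_totalArea {h : SphereMetric} {M : Eu n} {T : ℂ → G}
    (hT : ∀ z ∈ annulus, SmoothAt n T z ∧ logDer n T z = (areaJump h z).smulRight M) :
    expCurve G M (totalArea h) = 1 := by
  set e : ℝ → ℂ := fun t => Complex.exp (t * Complex.I) with he
  have hed : ∀ φ : ℝ, HasDerivAt e (Complex.exp (φ * Complex.I) * Complex.I) φ := by
    intro φ
    have := ((Complex.ofRealCLM.hasDerivAt (x := φ)).mul_const Complex.I).cexp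
    simpa [e] using this
  have hs : ∀ φ, SmoothAt n (fun φ => T (e φ)) φ := fun φ =>
    (hT _ (exp_mul_I_mem_annulus φ)).1.comp (u := e) contDiff_exp_mul_I.contDiffAt
  have hs' : ∀ φ, SmoothAt n (fun φ => T (e (-Real.pi)) * expCurve G M (sectorArea h φ)) φ :=
    fun φ => smoothAt_const.mul
      ((smoothAt_expCurve M _).comp (contDiff_sectorArea h).contDiffAt)
  have hl : ∀ φ, logDer n (fun φ => T (e φ)) φ =
      logDer n (fun φ => T (e (-Real.pi)) * expCurve G M (sectorArea h φ)) φ := by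
    intro φ
    obtain ⟨h1, h2⟩ := hT _ (exp_mul_I_mem_annulus φ)
    rw [logDer_const_mul, logDer_real_comp (smoothAt_expCurve M _) (logDer_expCurve M _)
      (hasDerivAt_sectorArea h φ), logDer_comp (u := e) h1 (hed φ).differentiableAt, h2]
    ext1
    have h3 : wedge (e φ) (e φ * Complex.I) = 1 := by
      have h4 := Complex.sq_norm (e φ)
      rw [Complex.norm_exp_ofReal_mul_I, Complex.normSq_apply] at h4
      simp only [wedge, Complex.mul_re, Complex.mul_im, Complex.I_re, Complex.I_im]
      linarith
    have h5 : ‖e φ‖ = 1 := Complex.norm_exp_ofReal_mul_I φ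
    have h6 : fderiv ℝ e φ 1 = e φ * Complex.I := by
      rw [← deriv, (hed φ).deriv]
    simp only [ContinuousLinearMap.comp_apply, ContinuousLinearMap.smulRight_apply, h6]
    have h7 : areaJump h (e φ) (e φ * Complex.I) = areaRate h (e φ) := by
      rw [areaJump_apply h (Complex.exp_ne_zero _), h3, h5, inv_one, one_smul, one_pow, div_one,
        mul_one]
    refine (congrArg (· • M) h7).trans ?_
    rw [spanL, ContinuousLinearMap.toSpanSingleton_apply, one_smul]
  have key := eqOn_of_logDer_eq isOpen_univ isPreconnected_univ (fun φ _ => hs φ)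
    (fun φ _ => hs' φ) (fun φ _ => hl φ) (mem_univ (-Real.pi))
    (by rw [sectorArea_neg_pi, expCurve_zero, mul_one]) (mem_univ Real.pi)
  have h1 : e Real.pi = e (-Real.pi) := by
    simp [e, Complex.exp_neg, Complex.exp_pi_mul_I]
  simp only [h1, sectorArea, integral_areaRate] at key
  exact (mul_eq_left.1 key.symm)

/-- All values of *F(A) are conjugate to M on the first disc: on each disc *F is M up to Ad, and T
conjugates the two constants. -/
lemma hasCurvatureGenerator_iff {h : SphereMetric} {P : BundleConnection n G} {M : Bool → Eu n}
    {f : Bool → P.ι → ℂ → G} {T : ℂ → G} (hf : ∀ s, IsAdapted h P s (M s) (f s))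
    (hT : IsTransition h P M f T) (ρ : Circle →ₜ* G) :
    HasCurvatureGenerator h P ρ ↔ ∃ g : G, totalArea h • M true = Ad n g (genVec n ρ) := by
  constructor
  · intro hρ
    obtain ⟨i, hi⟩ := P.cover (stereo true 0)
    obtain ⟨g, hg⟩ := hρ i _ hi
    have h1 : totalArea h • stereoStar h (P.A i) true 0 = Ad n g (genVec n ρ) := by
      rw [← starCurvature_stereo h (P.smooth_A i) (P.isOpen i) hi]
      exact (congrArg lieCoord hg).trans (lieCoord_adjointAction g _)
    refine ⟨f true i 0 * g, ?_⟩
    rw [Ad_mul_apply, ← h1, map_smul, (hf true i 0 (by simp) hi).2.1]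
  · rintro ⟨g, hg⟩ i x hx
    obtain ⟨s, z, hz, rfl⟩ := exists_stereo_eq x
    obtain ⟨c, hc⟩ : ∃ c : G, M s = Ad n c (M true) := by
      cases s
      · exact ⟨T 1, (hT 1 one_mem_annulus).2.2.1⟩
      · exact ⟨1, by simp⟩
    have hz' : z ∈ Metric.ball (0 : ℂ) 2 :=
      Metric.closedBall_subset_ball (by norm_num) hz
    refine ⟨(f s i z)⁻¹ * (c * g), ?_⟩
    have h1 : totalArea h • stereoStar h (P.A i) s z =
        Ad n ((f s i z)⁻¹ * (c * g)) (genVec n ρ) := by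
      rw [Ad_mul_apply, Ad_mul_apply, ← hg, map_smul, map_smul, ← hc, ← (hf s i z hz' hx).2.1,
        Ad_inv_Ad]
    rw [← starCurvature_stereo h (P.smooth_A i) (P.isOpen i) hx] at h1
    exact h1.trans (lieCoord_adjointAction _ _).symm

lemma exists_adapted_pair {h : SphereMetric} {P : BundleConnection n G} (hP : IsYangMills h P) :
    ∃ M f T, (∀ s, IsAdapted h P s (M s) (f s)) ∧ IsTransition h P M f T := by
  choose M f hf using fun s => exists_isAdapted hP s
  obtain ⟨T, hT⟩ := exists_isTransition hf
  exact ⟨M, f, T, hf, hT⟩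

lemma exists_hasCurvatureGenerator {h : SphereMetric} {P : BundleConnection n G}
    (hP : IsYangMills h P) : ∃ ρ : Circle →ₜ* G, HasCurvatureGenerator h P ρ := by
  obtain ⟨M, f, T, hf, hT⟩ := exists_adapted_pair hP
  have h1 := expCurve_totalArea fun z hz => ⟨(hT z hz).1, (hT z hz).2.1⟩
  obtain ⟨ρ, hρ⟩ := exists_circleHom (G := G) (v := totalArea h • M true) (by
    rw [expCurve_smul, mul_one, h1])
  exact ⟨ρ, (hasCurvatureGenerator_iff hf hT ρ).2 ⟨1, by rw [hρ]; simp⟩⟩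

lemma HasCurvatureGenerator.homMk_eq {h : SphereMetric} {P : BundleConnection n G}
    (hP : IsYangMills h P) {ρ ρ' : Circle →ₜ* G} (hρ : HasCurvatureGenerator h P ρ)
    (hρ' : HasCurvatureGenerator h P ρ') :
    Quotient.mk (homConj G) ρ = Quotient.mk (homConj G) ρ' := by
  obtain ⟨M, f, T, hf, hT⟩ := exists_adapted_pair hP
  obtain ⟨g, hg⟩ := (hasCurvatureGenerator_iff hf hT ρ).1 hρ
  obtain ⟨g', hg'⟩ := (hasCurvatureGenerator_iff hf hT ρ').1 hρ'
  refine (homMk_eq_iff (n := n)).2 ⟨g⁻¹ * g', ?_⟩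
  rw [Ad_mul_apply, ← hg', hg, Ad_inv_Ad]

lemma HasCurvatureGenerator.congr {h : SphereMetric} {P : BundleConnection n G}
    {ρ ρ' : Circle →ₜ* G} (hρ : HasCurvatureGenerator h P ρ)
    (e : Quotient.mk (homConj G) ρ = Quotient.mk (homConj G) ρ') :
    HasCurvatureGenerator h P ρ' := by
  obtain ⟨g, hg⟩ := (homMk_eq_iff (n := n)).1 e
  intro i x hx
  obtain ⟨g', hg'⟩ := hρ i x hx
  have h1 : lieCoord (adjointAction n g' (generator n ρ)) =
      lieCoord (adjointAction n (g' * g) (generator n ρ')) := by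
    rw [lieCoord_adjointAction, lieCoord_adjointAction, Ad_mul_apply]
    exact congrArg (Ad n g') hg
  exact ⟨g' * g, hg'.trans h1⟩

/-- Adapted sections normalized by the generator. -/
lemma exists_normalized {h : SphereMetric} {P : BundleConnection n G} (hP : IsYangMills h P)
    {ρ : Circle →ₜ* G} (hρ : HasCurvatureGenerator h P ρ) :
    ∃ (f : Bool → P.ι → ℂ → G) (T : ℂ → G),
      (∀ s, IsAdapted h P s ((totalArea h)⁻¹ • genVec n ρ) (f s)) ∧
      IsTransition h P (fun _ => (totalArea h)⁻¹ • genVec n ρ) f T ∧ T 1 = 1 := by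
  obtain ⟨M, f, T, hf, hT⟩ := exists_adapted_pair hP
  obtain ⟨g, hg⟩ := (hasCurvatureGenerator_iff hf hT ρ).1 hρ
  have ha := (totalArea_pos h).ne'
  set N : Eu n := (totalArea h)⁻¹ • genVec n ρ with hN
  have h1 : M true = Ad n g N := by
    rw [hN, map_smul, ← hg, smul_smul, inv_mul_cancel₀ ha, one_smul]
  have h2 : M false = Ad n (T 1 * g) N := by
    rw [(hT 1 one_mem_annulus).2.2.1, h1, Ad_mul_apply]
  -- The constant on the first disc turns M into N; the one on the second is corrected by T(1),
  -- which gives the same N and makes the new transition function 1 at 1.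
  have h3 : ∀ s, IsAdapted h P s N (fun i z => (bif s then g⁻¹ else (T 1 * g)⁻¹) * f s i z) := by
    intro s
    cases s
    · have := (hf false).const_mul (T 1 * g)⁻¹
      rwa [h2, Ad_inv_Ad] at this
    · have := (hf true).const_mul g⁻¹
      rwa [h1, Ad_inv_Ad] at this
  obtain ⟨T', hT'⟩ := exists_isTransition h3
  refine ⟨_, T', h3, hT', ?_⟩
  obtain ⟨i, hi⟩ := P.cover (stereo true 1)
  have h4 := (hT' 1 one_mem_annulus).2.2.2 i hi
  simp only [(hT 1 one_mem_annulus).2.2.2 i hi, cond_true, cond_false, mul_inv_rev, mul_assoc, inv_mul_cancel_left] at h4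
  exact mul_eq_right.1 h4.symm

end CurvatureGenerators

/-! ### Curvature determines the connection up to isomorphism -/

section GaugeEquivalence

open Set Filter Topology

variable {n : ℕ} {G : Type*} [Group G] [TopologicalSpace G]
  [ChartedSpace (EuclideanSpace ℝ (Fin n)) G] [LieGroup (𝓡 n) ∞ G]

lemma ne_zero_of_stereo_mem_cap_not {s : Bool} {z : ℂ} (hz : stereo s z ∈ cap (!s)) : z ≠ 0 := by
  rintro rfl
  have h1 := one_add_stereo_two s 0
  have h2 := cap_ne_zero hz
  rw [sgn_not] at h2
  simp only [stereoNorm, Complex.zero_re, Complex.zero_im] at h1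
  norm_num at h1
  apply h2
  linarith

lemma stereoInv_mem_annulus {x : S2} (h1 : x ∈ cap true) (h0 : x ∈ cap false) :
    stereoInv true x ∈ annulus ∧ stereoInv false x = inversion (stereoInv true x) := by
  obtain ⟨z, rfl⟩ : ∃ z, stereo true z = x := ⟨_, stereo_stereoInv (cap_ne_zero h1)⟩
  have hz := ne_zero_of_stereo_mem_cap_not (s := true) h0
  have hi : stereoInv false (stereo true z) = inversion z := stereoInv_not_stereo true hz
  have h2 := stereoInv_mem_ball h0
  have h3 := stereoInv_mem_ball h1
  rw [hi, mem_ball_zero_iff, norm_inversion hz] at h2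
  rw [stereoInv_stereo] at h3 ⊢
  exact ⟨⟨inv_lt_of_inv_lt₀ (norm_pos_iff.2 hz) h2, mem_ball_zero_iff.1 h3⟩, hi⟩

lemma exists_stereo_cap_eq (x : S2) : ∃ s, ∃ z ∈ Metric.ball (0 : ℂ) 2, stereo s z = x := by
  obtain ⟨s, z, hz, hx⟩ := exists_stereo_eq x
  exact ⟨s, z, Metric.closedBall_subset_ball (by norm_num) hz, hx⟩

lemma hasCurvatureGenerator_iff_stereoStar {h : SphereMetric} {P : BundleConnection n G}
    {ρ : Circle →ₜ* G} : HasCurvatureGenerator h P ρ ↔ ∀ i s z, stereo s z ∈ P.U i →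
      ∃ g : G, totalArea h • stereoStar h (P.A i) s z = Ad n g (genVec n ρ) := by
  have key : ∀ i s z, stereo s z ∈ P.U i → ∀ g : G,
      (totalArea h • (P.A i).starCurvature h (stereo s z) = adjointAction n g (generator n ρ) ↔
        totalArea h • stereoStar h (P.A i) s z = Ad n g (genVec n ρ)) := by
    intro i s z hz g
    rw [← starCurvature_stereo h (P.smooth_A i) (P.isOpen i) hz]
    exact Eq.congr_right (lieCoord_adjointAction g _)
  constructor
  · intro hρ i s z hz
    obtain ⟨g, hg⟩ := hρ i _ hz
    exact ⟨g, (key i s z hz g).1 hg⟩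
  · intro hρ i x hx
    obtain ⟨s, z, -, rfl⟩ := exists_stereo_cap_eq x
    obtain ⟨g, hg⟩ := hρ i s z hx
    exact ⟨g, (key i s z hx g).2 hg⟩

lemma GaugeEquivalent.hasCurvatureGenerator_iff {h : SphereMetric} {P Q : BundleConnection n G}
    (hPQ : GaugeEquivalent P Q) (ρ : Circle →ₜ* G) :
    HasCurvatureGenerator h P ρ ↔ HasCurvatureGenerator h Q ρ := by
  obtain ⟨q, hq, -, -, hc⟩ := hPQ
  have key : ∀ i k s z, stereo s z ∈ P.U i → stereo s z ∈ Q.U k → stereoStar h (Q.A k) s z =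
      Ad n (q i k (stereo s z))⁻¹ (stereoStar h (P.A i) s z) := fun i k s z hi hk =>
    stereoStar_gauge h (P.smooth_A i) (P.isOpen i) (Q.isOpen k) (hq i k) (hc i k) ⟨hi, hk⟩
  rw [hasCurvatureGenerator_iff_stereoStar, hasCurvatureGenerator_iff_stereoStar]
  constructor
  · intro hρ k s z hk
    obtain ⟨i, hi⟩ := P.cover (stereo s z)
    obtain ⟨g, hg⟩ := hρ i s z hi
    exact ⟨(q i k (stereo s z))⁻¹ * g, by rw [key i k s z hi hk, ← map_smul, hg, Ad_mul_apply]⟩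
  · intro hρ i s z hi
    obtain ⟨k, hk⟩ := Q.cover (stereo s z)
    obtain ⟨g, hg⟩ := hρ k s z hk
    exact ⟨q i k (stereo s z) * g, by
      rw [Ad_mul_apply, ← hg, key i k s z hi hk, map_smul, Ad_Ad_inv]⟩

/-- After normalization both bundles are given by the same forms θM on the discs, and their
transition functions solve the same equation with the same value at 1, hence agree. The comparison
f⁻¹f' of adapted sections therefore patches over the two caps. -/
lemma gaugeEquivalent_of_hasCurvatureGenerator {h : SphereMetric} {P Q : BundleConnection n G}
    (hP : IsYangMills h P) (hQ : IsYangMills h Q) {ρ : Circle →ₜ* G}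
    (hPρ : HasCurvatureGenerator h P ρ) (hQρ : HasCurvatureGenerator h Q ρ) :
    GaugeEquivalent P Q := by
  classical
  obtain ⟨f, T, hf, hT, hT1⟩ := exists_normalized hP hPρ
  obtain ⟨f', T', hf', hT', hT1'⟩ := exists_normalized hQ hQρ
  have hTT : EqOn T T' annulus := eqOn_of_logDer_eq isOpen_annulus isPreconnected_annulus
    (fun z hz => (hT z hz).1) (fun z hz => (hT' z hz).1)
    (fun z hz => (hT z hz).2.1.trans (hT' z hz).2.1.symm) one_mem_annulus (hT1.trans hT1'.symm)
  set κ : Bool → P.ι → Q.ι → S2 → G := fun s i k x =>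
    (f s i (stereoInv s x))⁻¹ * f' s k (stereoInv s x) with hκ
  set q : P.ι → Q.ι → S2 → G := fun i k x => if x ∈ cap true then κ true i k x else κ false i k x
    with hq
  -- On the overlap the common transition function cancels from f⁻¹f', so the choice of cap in the
  -- definition of `q` does not matter.
  have hqκ : ∀ s i k x, x ∈ cap s → x ∈ P.U i ∩ Q.U k → q i k x = κ s i k x := by
    intro s i k x hx hxU
    cases s
    · by_cases hx1 : x ∈ cap true
      · obtain ⟨ha, hinv⟩ := stereoInv_mem_annulus hx1 hx
        have hst := stereo_stereoInv (cap_ne_zero hx1)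
        have e1 := (hT _ ha).2.2.2 i (by rw [hst]; exact hxU.1)
        have e2 := (hT' _ ha).2.2.2 k (by rw [hst]; exact hxU.2)
        simp only [hq, if_pos hx1, hκ]
        rw [hinv, e1, e2, hTT ha]
        group
      · exact if_neg hx1
    · exact if_pos hx
  have hqz : ∀ s i k z, z ∈ Metric.ball (0 : ℂ) 2 → stereo s z ∈ P.U i ∩ Q.U k →
      q i k (stereo s z) = (f s i z)⁻¹ * f' s k z := by
    intro s i k z hz hzU
    rw [hqκ s i k _ (stereo_mem_cap.2 hz) hzU]
    simp only [hκ, stereoInv_stereo]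
  have hqs : ∀ i k, ∀ x ∈ P.U i ∩ Q.U k, ContMDiffAt (𝓡 2) (𝓡 n) ∞ (q i k) x := by
    intro i k x hx
    obtain ⟨s, z, hz, rfl⟩ := exists_stereo_cap_eq x
    have h1 : SmoothAt n (fun w => (f s i w)⁻¹ * f' s k w) z :=
      (hf s i z hz hx.1).1.inv.mul (hf' s k z hz hx.2).1
    have h2 : ContMDiffAt (𝓡 2) (𝓡 n) ∞ (κ s i k) (stereo s z) := by
      refine ContMDiffAt.comp (g := fun w => (f s i w)⁻¹ * f' s k w) (f := stereoInv s)
        (stereo s z) ?_ (contMDiffAt_stereoInv_stereo s z)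
      rw [stereoInv_stereo]
      exact h1
    refine h2.congr_of_eventuallyEq ?_
    filter_upwards [((P.isOpen i).inter (Q.isOpen k)).mem_nhds hx,
      (isOpen_cap s).mem_nhds (stereo_mem_cap.2 hz)] with y hy hys using hqκ s i k y hys hy
  refine ⟨q, fun i k x hx => (hqs i k x hx).contMDiffWithinAt, ?_, ?_, ?_⟩
  · rintro i j k x ⟨⟨hi, hj⟩, hk⟩
    obtain ⟨s, z, hz, rfl⟩ := exists_stereo_cap_eq x
    rw [hqz s i k z hz ⟨hi, hk⟩, hqz s j k z hz ⟨hj, hk⟩, ← (hf s i z hz hi).2.2.2 j hj]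
    group
  · rintro i k l x ⟨⟨hi, hk⟩, hl⟩
    obtain ⟨s, z, hz, rfl⟩ := exists_stereo_cap_eq x
    rw [hqz s i k z hz ⟨hi, hk⟩, hqz s i l z hz ⟨hi, hl⟩, ← (hf' s k z hz hk).2.2.2 l hl,
      mul_assoc]
  · intro i k x hx
    obtain ⟨s, z, hz, rfl⟩ := exists_stereo_cap_eq x
    refine (gauge_iff (hqs i k _ hx)).2 ?_
    obtain ⟨h1, h2, h3, -⟩ := hf s i z hz hx.1
    obtain ⟨h1', h2', h3', -⟩ := hf' s k z hz hx.2
    have hev : (fun w => q i k (stereo s w)) =ᶠ[𝓝 z] fun w => (f s i w)⁻¹ * f' s k w := by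
      filter_upwards [eventually_stereo_mem ((P.isOpen i).inter (Q.isOpen k)) hx,
        Metric.isOpen_ball.mem_nhds hz] with w hw hwb using hqz s i k w hwb hw
    have h4 : stereoStar h (Q.A k) s z = Ad n (f' s k z)⁻¹ (Ad n (f s i z)
        (stereoStar h (P.A i) s z)) := by
      rw [h2, ← h2', Ad_inv_Ad]
    rw [logDer_congr hev, logDer_mul h1.inv h1', logDer_inv h1, h3, h3', h4, hqz s i k z hz hx,
      mul_inv_rev, inv_inv, Ad_mul]
    ext1 v
    simp only [sub_apply, add_apply, neg_apply, ContinuousLinearMap.comp_apply,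
      ContinuousLinearMap.smulRight_apply, map_sub, map_smul, map_neg]
    abel

end GaugeEquivalence

/-! ### Clutching construction of a connection with given generator -/

section ModelConnections

open Set Filter Topology

variable {n : ℕ} {G : Type*} [Group G] [TopologicalSpace G]
  [ChartedSpace (EuclideanSpace ℝ (Fin n)) G] [LieGroup (𝓡 n) ∞ G]

/-- A full turn adds the total area to the sector area, and the closing condition on M makes this
invisible to the exponential. -/
lemma expCurve_sectorArea_eq {h : SphereMetric} {M : Eu n}
    (hM : expCurve G M (totalArea h) = 1) {φ ψ : ℝ} (hφ : (φ : Real.Angle) = ψ) :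
    expCurve G M (sectorArea h φ) = expCurve G M (sectorArea h ψ) := by
  have hp : Function.Periodic (fun φ => expCurve G M (sectorArea h φ)) (2 * Real.pi) := fun φ => by
    simp only [sectorArea_add_two_pi, expCurve_add, hM, mul_one]
  obtain ⟨k, hk⟩ := Real.Angle.angle_eq_iff_two_pi_dvd_sub.1 hφ
  have h1 := hp.int_mul k ψ
  rw [show ψ + k * (2 * Real.pi) = φ by linarith] at h1
  exact h1

/-- A smooth choice of the argument near `z`. -/
def localArg (z w : ℂ) : ℝ := z.arg + (Complex.log (w / z)).im

lemma localArg_self {z : ℂ} (hz : z ≠ 0) : localArg z z = z.arg := by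
  simp [localArg, div_self hz]

lemma contDiffAt_localArg {z : ℂ} (hz : z ≠ 0) : ContDiffAt ℝ ∞ (localArg z) z := by
  have h1 : ContDiffAt ℂ ∞ (fun w => Complex.log (w / z)) z :=
    (Complex.contDiffAt_log (by simp [div_self hz, Complex.one_mem_slitPlane])).comp z
      (contDiffAt_id.div_const z)
  exact contDiffAt_const.add (Complex.imCLM.contDiff.contDiffAt.comp z (h1.restrict_scalars ℝ))

lemma fderiv_localArg {z : ℂ} (hz : z ≠ 0) (v : ℂ) :
    fderiv ℝ (localArg z) z v = wedge z v / ‖z‖ ^ 2 := by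
  have h1 : HasDerivAt (fun w => Complex.log (w / z)) (1 / z / (z / z)) z :=
    ((hasDerivAt_id z).div_const z).clog (by simp [div_self hz, Complex.one_mem_slitPlane])
  have h2 : HasFDerivAt (localArg z) (Complex.imCLM.comp
      ((ContinuousLinearMap.toSpanSingleton ℂ (1 / z / (z / z))).restrictScalars ℝ)) z :=
    (Complex.imCLM.hasFDerivAt.comp z (h1.hasFDerivAt.restrictScalars ℝ)).const_add z.arg
  rw [h2.fderiv, div_self hz, div_one, Complex.sq_norm]
  simp [wedge, Complex.mul_im, Complex.inv_re, Complex.inv_im]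
  ring

lemma coe_localArg {z w : ℂ} (hz : z ≠ 0) (hw : w ≠ 0) :
    ((localArg z w : ℝ) : Real.Angle) = w.arg := by
  have h1 := Complex.arg_mul_coe_angle hz (div_ne_zero hw hz)
  rw [mul_div_cancel₀ _ hz] at h1
  rw [localArg, Complex.log_im, Real.Angle.coe_add, h1]

/-- The transition function of the model connection. -/
def modelTransition (G : Type*) [Group G] [TopologicalSpace G]
    [ChartedSpace (EuclideanSpace ℝ (Fin n)) G] [LieGroup (𝓡 n) ∞ G] (h : SphereMetric)
    (M : Eu n) (z : ℂ) : G :=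
  expCurve G M (sectorArea h z.arg)

/-- `Complex.arg` jumps on the negative axis; replacing it locally by a smooth branch changes the
angle by a multiple of 2π only, hence not the value of the transition function. -/
lemma modelTransition_eventuallyEq {h : SphereMetric} {M : Eu n}
    (hM : expCurve G M (totalArea h) = 1) {z : ℂ} (hz : z ≠ 0) :
    modelTransition G h M =ᶠ[𝓝 z] fun w => expCurve G M (sectorArea h (localArg z w)) := by
  filter_upwards [isOpen_ne.mem_nhds hz] with w hw
  exact (expCurve_sectorArea_eq hM (coe_localArg hz hw)).symm

lemma contDiffAt_sectorArea_localArg (h : SphereMetric) {z : ℂ} (hz : z ≠ 0) :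
    ContDiffAt ℝ ∞ (fun w => sectorArea h (localArg z w)) z :=
  (contDiff_sectorArea h).contDiffAt.comp z (contDiffAt_localArg hz)

lemma smoothAt_modelTransition {h : SphereMetric} {M : Eu n}
    (hM : expCurve G M (totalArea h) = 1) {z : ℂ} (hz : z ≠ 0) :
    SmoothAt n (modelTransition G h M) z :=
  ((smoothAt_expCurve M _).comp (u := fun w => sectorArea h (localArg z w))
    (contDiffAt_sectorArea_localArg h hz)).congr_of_eventuallyEq
    (modelTransition_eventuallyEq hM hz)

lemma logDer_modelTransition {h : SphereMetric} {M : Eu n}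
    (hM : expCurve G M (totalArea h) = 1) {z : ℂ} (hz : z ≠ 0) :
    logDer n (modelTransition G h M) z = (areaJump h z).smulRight M := by
  have h1 : HasFDerivAt (fun w => sectorArea h (localArg z w)) _ z :=
    (hasDerivAt_sectorArea h (localArg z z)).comp_hasFDerivAt z
      ((contDiffAt_localArg hz).differentiableAt (by simp)).hasFDerivAt
  rw [logDer_congr (modelTransition_eventuallyEq hM hz),
    logDer_comp (u := fun w => sectorArea h (localArg z w)) (smoothAt_expCurve M _)
      h1.differentiableAt, logDer_expCurve, h1.fderiv]
  ext1 v
  have h2 : Complex.exp (z.arg * Complex.I) = ‖z‖⁻¹ • z := by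
    have h3 := norm_pos_iff.2 hz
    rw [Complex.real_smul, Complex.ofReal_inv, eq_inv_mul_iff_mul_eq₀ (by exact_mod_cast h3.ne')]
    exact Complex.norm_mul_exp_arg_mul_I z
  rw [ContinuousLinearMap.comp_apply, smul_apply, fderiv_localArg hz, localArg_self hz, h2,
    ContinuousLinearMap.smulRight_apply, areaJump_apply h hz, spanL,
    ContinuousLinearMap.toSpanSingleton_apply, smul_eq_mul]

/-- The connection form of the model connection over a cap. -/
def modelForm (G : Type*) [Group G] [TopologicalSpace G]
    [ChartedSpace (EuclideanSpace ℝ (Fin n)) G] (h : SphereMetric) (M : Eu n) (s : Bool) :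
    LieOneForm n G := fun x =>
  show Eu 2 →L[ℝ] Eu n from ((areaPrim h s (stereoInv s x)).comp
    (show Eu 2 →L[ℝ] ℂ from mfderiv (𝓡 2) 𝓘(ℝ, ℂ) (stereoInv s) x)).smulRight M

/-- The vector part of a tangent vector of the plane. -/
def tangentSnd (w : TangentBundle 𝓘(ℝ, ℂ) ℂ) : ℂ := w.snd

lemma contMDiff_areaPrim_smul (h : SphereMetric) (s : Bool) (M : Eu n) :
    ContMDiff 𝓘(ℝ, ℂ).tangent 𝓘(ℝ, Eu n) ∞
      (fun w : TangentBundle 𝓘(ℝ, ℂ) ℂ => (areaPrim h s w.proj (tangentSnd w)) • M) := by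
  have h1 : ContMDiff 𝓘(ℝ, ℂ).tangent 𝓘(ℝ, ℂ) ∞ tangentSnd :=
    contMDiff_snd_tangentBundle_modelSpace ℂ 𝓘(ℝ, ℂ)
  have h2 : ContMDiff 𝓘(ℝ, ℂ).tangent 𝓘(ℝ, ℂ) ∞
      (fun w : TangentBundle 𝓘(ℝ, ℂ) ℂ => w.proj) :=
    Bundle.contMDiff_proj (TangentSpace 𝓘(ℝ, ℂ))
  have h3 : ContDiff ℝ ∞ (fun p : ℂ × ℂ => (areaPrim h s p.1 p.2) • M) :=
    (((contDiff_areaPrim h s).comp contDiff_fst).clm_apply contDiff_snd).smul contDiff_const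
  have h4 : ContMDiff 𝓘(ℝ, ℂ).tangent 𝓘(ℝ, ℂ × ℂ) ∞
      (fun w : TangentBundle 𝓘(ℝ, ℂ) ℂ => ((w.proj, tangentSnd w) : ℂ × ℂ)) :=
    h2.prodMk_space h1
  exact ContMDiff.comp (g := fun p : ℂ × ℂ => (areaPrim h s p.1 p.2) • M)
    (f := fun w : TangentBundle 𝓘(ℝ, ℂ) ℂ => ((w.proj, tangentSnd w) : ℂ × ℂ)) h3.contMDiff h4

lemma smoothOn_modelForm (h : SphereMetric) (M : Eu n) (s : Bool) :
    (modelForm G h M s).SmoothOn (cap s) := by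
  have h1 : ContMDiffOn (𝓡 2) 𝓘(ℝ, ℂ) ∞ (stereoInv s) (cap s) := fun x hx =>
    (contMDiffAt_stereoInv (cap_ne_zero hx)).contMDiffWithinAt
  have h2 := h1.contMDiffOn_tangentMapWithin (m := ∞) le_rfl (isOpen_cap s).uniqueMDiffOn
  have h3 := contMDiff_areaPrim_smul h s M
  refine (h3.comp_contMDiffOn h2).congr fun v hv => ?_
  simp only [Function.comp, tangentMapWithin, mfderivWithin_of_isOpen (isOpen_cap s) hv]
  rfl

lemma stereoForm_modelForm (h : SphereMetric) (M : Eu n) (s : Bool) (z : ℂ) :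
    stereoForm (modelForm G h M s) s z = (areaPrim h s z).smulRight M := by
  have h1 := mfderiv_comp z ((contMDiffAt_stereoInv_stereo s z).mdifferentiableAt (by simp))
    ((contMDiff_stereo s z).mdifferentiableAt (by simp))
  have h2 : stereoInv s ∘ stereo s = id := funext fun w => stereoInv_stereo s w
  rw [h2, mfderiv_id] at h1
  ext1 v
  have h3 := congrArg (fun L : ℂ →L[ℝ] ℂ => areaPrim h s (stereoInv s (stereo s z)) (L v) • M) h1
  refine h3.symm.trans ?_
  simp only [stereoInv_stereo]
  rfl

/-- The transition functions of the model connection. -/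
def modelGauge (G : Type*) [Group G] [TopologicalSpace G]
    [ChartedSpace (EuclideanSpace ℝ (Fin n)) G] [LieGroup (𝓡 n) ∞ G] (h : SphereMetric)
    (M : Eu n) : Bool → Bool → S2 → G
  | false, true, x => modelTransition G h M (stereoInv true x)
  | true, false, x => (modelTransition G h M (stereoInv true x))⁻¹
  | true, true, _ => 1
  | false, false, _ => 1

lemma contMDiffAt_modelTransition_stereoInv {h : SphereMetric} {M : Eu n}
    (hM : expCurve G M (totalArea h) = 1) {z : ℂ} (hz : z ≠ 0) :
    ContMDiffAt (𝓡 2) (𝓡 n) ∞ (fun x => modelTransition G h M (stereoInv true x))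
      (stereo true z) := by
  refine ContMDiffAt.comp (g := modelTransition G h M) (f := stereoInv true) (stereo true z) ?_
    (contMDiffAt_stereoInv_stereo true z)
  rw [stereoInv_stereo]
  exact smoothAt_modelTransition hM hz

/-- The transition function takes values in the one-parameter group of M, so its Ad fixes M, and the
gauge relation reduces to the equation for its logarithmic derivative. -/
lemma stereoForm_modelForm_gauge {h : SphereMetric} {M : Eu n}
    (hM : expCurve G M (totalArea h) = 1) {z : ℂ} (hz : z ≠ 0) :
    stereoForm (modelForm G h M true) true z =
      (Ad n (modelTransition G h M z)⁻¹).comp (stereoForm (modelForm G h M false) true z) +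
        logDer n (modelTransition G h M) z := by
  rw [stereoForm_inversion (modelForm G h M false) hz, stereoForm_modelForm, stereoForm_modelForm,
    logDer_modelTransition hM hz]
  have h1 : Ad n (modelTransition G h M z)⁻¹ M = M := by
    rw [modelTransition, ← expCurve_neg, Ad_expCurve_of_lieBr_eq_zero (lieBr_self M)]
  ext1 v
  simp only [areaJump, sub_apply, add_apply, ContinuousLinearMap.comp_apply,
    ContinuousLinearMap.smulRight_apply, map_smul, h1]
  module

/-- The connection on the two stereographic caps with constant curvature `M` times the area form. -/
def modelConnection {h : SphereMetric} {M : Eu n} (hM : expCurve G M (totalArea h) = 1) :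
    BundleConnection n G where
  ι := Bool
  U := cap
  isOpen := isOpen_cap
  cover x := by
    obtain ⟨s, z, hz, rfl⟩ := exists_stereo_cap_eq x
    exact ⟨s, stereo_mem_cap.2 hz⟩
  g := modelGauge G h M
  smooth_g i j x hx := by
    refine ContMDiffAt.contMDiffWithinAt ?_
    have key : x ∈ cap true → x ∈ cap false → ContMDiffAt (𝓡 2) (𝓡 n) ∞
        (fun x => modelTransition G h M (stereoInv true x)) x := fun h1 h0 => by
      rw [← stereo_stereoInv (cap_ne_zero h1)]
      exact contMDiffAt_modelTransition_stereoInv hM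
        (ne_zero_of_mem_annulus (stereoInv_mem_annulus h1 h0).1)
    cases i <;> cases j
    · exact contMDiffAt_const
    · exact key hx.2 hx.1
    · exact (key hx.1 hx.2).inv
    · exact contMDiffAt_const
  cocycle i j k x _ := by
    cases i <;> cases j <;> cases k <;> simp [modelGauge]
  A := modelForm G h M
  smooth_A := smoothOn_modelForm h M
  compat i j x hx := by
    have hdiag : ∀ s, x ∈ cap s → ∀ u : TangentSpace (𝓡 2) x, modelForm G h M s x u =
        adjointAction n ((fun _ => 1 : S2 → G) x)⁻¹ (modelForm G h M s x u) +
          logDerivative n (fun _ => 1 : S2 → G) x u := by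
      intro s hs
      obtain ⟨z, rfl⟩ : ∃ z, stereo s z = x := ⟨_, stereo_stereoInv (cap_ne_zero hs)⟩
      refine (gauge_iff contMDiffAt_const).2 ?_
      rw [logDer_const, inv_one]
      ext1 v
      simp
    cases i <;> cases j
    · exact hdiag false hx.1
    · obtain ⟨z, rfl⟩ : ∃ z, stereo true z = x := ⟨_, stereo_stereoInv (cap_ne_zero hx.2)⟩
      have hz := ne_zero_of_stereo_mem_cap_not (s := true) hx.1
      refine (gauge_iff (g := modelGauge G h M false true)
        (contMDiffAt_modelTransition_stereoInv hM hz)).2 ?_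
      simp only [modelGauge, stereoInv_stereo]
      exact stereoForm_modelForm_gauge hM hz
    · obtain ⟨z, rfl⟩ : ∃ z, stereo true z = x := ⟨_, stereo_stereoInv (cap_ne_zero hx.1)⟩
      have hz := ne_zero_of_stereo_mem_cap_not (s := true) hx.2
      refine (gauge_iff (g := modelGauge G h M true false)
        (contMDiffAt_modelTransition_stereoInv hM hz).inv).2 ?_
      simp only [modelGauge, stereoInv_stereo]
      rw [stereoForm_modelForm_gauge hM hz, logDer_inv (smoothAt_modelTransition hM hz), inv_inv]
      ext1 v
      simp
    · exact hdiag true hx.1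

/-- The form θM takes values in one line, so the brackets vanish and the curvature is M dθ, that is
M times the area form. -/
lemma stereoStar_modelForm (h : SphereMetric) (M : Eu n) (s : Bool) (z : ℂ) :
    stereoStar h (modelForm G h M s) s z = M := by
  have h1 : stereoForm (modelForm G h M s) s = fun z => (areaPrim h s z).smulRight M :=
    funext fun z => stereoForm_modelForm h M s z
  have h2 : ∀ u v, fderiv ℝ (fun z => (areaPrim h s z).smulRight M) z u v =
      fderiv ℝ (areaPrim h s) z u v • M := by
    intro u v
    have hd : DifferentiableAt ℝ (areaPrim h s) z :=
      (contDiff_areaPrim h s).differentiable (by simp) z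
    have k1 := ((contDiffAt_smulRight (contDiff_areaPrim h s).contDiffAt
      (contDiffAt_const (c := M) (x := z))).differentiableAt (by simp)).hasFDerivAt.clm_apply
        (hasFDerivAt_const v z)
    have k2 := (hd.hasFDerivAt.clm_apply (hasFDerivAt_const v z)).smul (hasFDerivAt_const M z)
    have k3 := congrArg (fun L : ℂ →L[ℝ] Eu n => L u) (k1.unique k2)
    simpa using k3
  rw [stereoStar, h1, formCurv, h2, h2, ← sub_smul, fderiv_areaPrim]
  simp only [ContinuousLinearMap.smulRight_apply, lieBr_smul_left, lieBr_smul_right, lieBr_self,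
    smul_zero, add_zero]
  rw [show wedge 1 Complex.I = 1 by simp [wedge], mul_one, smul_smul,
    inv_mul_cancel₀ (areaCoeff_ne_zero h s z), one_smul]

lemma isYangMills_modelConnection {h : SphereMetric} {M : Eu n}
    (hM : expCurve G M (totalArea h) = 1) : IsYangMills h (modelConnection hM) := by
  intro (s : Bool) x hx u
  change x ∈ cap s at hx
  obtain ⟨z, rfl⟩ : ∃ z, stereo s z = x := ⟨_, stereo_stereoInv (cap_ne_zero hx)⟩
  obtain ⟨v, rfl⟩ := stereoDeriv_surjective s z u
  have h1 := covDerivative_stereoDeriv h (smoothOn_modelForm (G := G) h M s) (isOpen_cap s) hx v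
  refine Eq.trans h1 ?_
  have h2 : stereoStar h (modelForm G h M s) s = fun _ => M :=
    funext fun z => stereoStar_modelForm h M s z
  rw [h2, stereoForm_modelForm]
  simp only [fderiv_fun_const, Pi.zero_apply, zero_apply, ContinuousLinearMap.smulRight_apply,
    lieBr_smul_left, lieBr_self, smul_zero, add_zero]
  rfl

/-- Take M to be the generator divided by the total area a; the closing condition exp(aM) = 1 is
that of ρ. -/
lemma exists_isYangMills (h : SphereMetric) (ρ : Circle →ₜ* G) :
    ∃ P : BundleConnection n G, IsYangMills h P ∧ HasCurvatureGenerator h P ρ := by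
  have ha := (totalArea_pos h).ne'
  have hM : expCurve G ((totalArea h)⁻¹ • genVec n ρ) (totalArea h) = 1 := by
    rw [expCurve_smul, inv_mul_cancel₀ ha]
    exact expCurve_genVec_one (n := n) ρ
  refine ⟨modelConnection hM, isYangMills_modelConnection hM, fun (s : Bool) x hx => ⟨1, ?_⟩⟩
  change x ∈ cap s at hx
  obtain ⟨z, rfl⟩ : ∃ z, stereo s z = x := ⟨_, stereo_stereoInv (cap_ne_zero hx)⟩
  have h1 := starCurvature_stereo h (smoothOn_modelForm (G := G) h ((totalArea h)⁻¹ • genVec n ρ) s)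
    (isOpen_cap s) hx
  rw [stereoStar_modelForm] at h1
  have h2 : totalArea h • ((totalArea h)⁻¹ • genVec n ρ) = genVec n ρ := by
    rw [smul_smul, mul_inv_cancel₀ ha, one_smul]
  refine (congrArg (totalArea h • ·) h1).trans (h2.trans ?_)
  exact Eq.symm ((lieCoord_adjointAction 1 (generator n ρ)).trans (by rw [Ad_one]; rfl))

end ModelConnections
-- Assembly
theorem mainTheorem4 (n : ℕ) (G : Type*) [Group G] [TopologicalSpace G] [T2Space G]
    [CompactSpace G] [ChartedSpace (EuclideanSpace ℝ (Fin n)) G] [LieGroup (𝓡 n) ∞ G] :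
    DiscreteTopology (HomModConj G) ∧
    (∀ h : SphereMetric,
      ∃ Φ : {P : BundleConnection n G // IsYangMills h P} → HomModConj G,
        Function.Surjective Φ ∧
        (∀ P Q, Φ P = Φ Q ↔ GaugeEquivalent P.1 Q.1) ∧
        (∀ P ρ, Φ P = Quotient.mk (homConj G) ρ ↔ HasCurvatureGenerator h P.1 ρ)) ∧
    (∀ k : LieRiemannianMetric n G, IsBiinvariant k →
      (∀ γ : ℝ → G, (IsGeodesic k γ ∧ Function.Periodic γ (2 * Real.pi) ∧ γ 0 = 1) ↔
        ∃ ρ : Circle →ₜ* G, ∀ t, γ t = ρ (Circle.exp t)) ∧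
      ∃ e : HomModConj G ≃ Quotient (geodesicConj k),
        ∀ (ρ : Circle →ₜ* G) (γ : ClosedGeodesic k),
          e (Quotient.mk (homConj G) ρ) = Quotient.mk (geodesicConj k) γ ↔
            ∃ g : G, ∀ t, γ.toFun t = g * ρ (Circle.exp t) * g⁻¹) := by
  refine ⟨discreteTopology_homModConj n G, fun h => ?_, fun k hk =>
    ⟨isGeodesic_periodic_iff hk, exists_equiv_geodesics hk⟩⟩
  -- A generator is chosen for each connection; `key` shows that its class is the only one
  -- compatible with the curvature, so the choice is harmless.
  choose r hr using fun P : {P : BundleConnection n G // IsYangMills h P} =>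
    exists_hasCurvatureGenerator P.2
  have key : ∀ P ρ, Quotient.mk (homConj G) (r P) = Quotient.mk (homConj G) ρ ↔
      HasCurvatureGenerator h P.1 ρ := fun P ρ =>
    ⟨(hr P).congr, HasCurvatureGenerator.homMk_eq P.2 (hr P)⟩
  refine ⟨fun P => Quotient.mk (homConj G) (r P), fun q => ?_, fun P Q => ?_, key⟩
  · obtain ⟨ρ, rfl⟩ := Quotient.exists_rep q
    obtain ⟨P, hP, hρ⟩ := exists_isYangMills (n := n) h ρ
    exact ⟨⟨P, hP⟩, (key ⟨P, hP⟩ ρ).2 hρ⟩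
  -- Equality of the two classes now means that the generator chosen for Q also fits P.
  · rw [key]
    exact ⟨fun hP => gaugeEquivalent_of_hasCurvatureGenerator P.2 Q.2 hP (hr Q),
      fun hPQ => (hPQ.hasCurvatureGenerator_iff (r Q)).2 (hr Q)⟩

end
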